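/- **Setting.** Identify $\mathbb H^n\cong\mathbb R^{4n}$, $q_l=x_{4l}+\mathbf i x_{4l+1}+\mathbf j x_{4l+2}+\mathbf k x_{4l+3}$ ($0\le l<n$), with Lebesgue measure $dV$. Let $\omega^0,\dots,\omega^{2n-1}$ be a basis of $\mathbb C^{2n}$, $\Omega_{2n}=\omega^0\wedge\dots\wedge\omega^{2n-1}$, $\beta_n=\sum_{l=0}^{n-1}\omega^{2l}\wedge\omega^{2l+1}$. Put $$\begin{pmatrix}\nabla_{(2l)0}&\nabla_{(2l)1}\\ \nabla_{(2l+1)0}&\nabla_{(2l+1)1}\end{pmatrix}=\begin{pmatrix}\partial_{x_{4l}}+\mathbf i\partial_{x_{4l+1}}&-\partial_{x_{4l+2}}-\mathbf i\partial_{x_{4l+3}}\\ \partial_{x_{4l+2}}-\mathbf i\partial_{x_{4l+3}}&\partial_{x_{4l}}-\mathbf i\partial_{x_{4l+1}}\end{pmatrix},$$ $d_\alpha\big(\sum_I f_I\omega^I\big)=\sum_{k,I}\nabla_{k\alpha}f_I\,\omega^k\wedge\omega^I$ for $\alpha=0,1$, and $\triangle=d_0d_1$. For a quaternion $a=a^0+a^1\mathbf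 i+a^2\mathbf j+a^3\mathbf k$ let $\tau(a)=\begin{pmatrix}a^0-\mathbf i a^1&-a^2+\mathbf i a^3\\ a^2+\mathbf i a^3&a^0+\mathbf i a^1\end{pmatrix}$. For a right $\mathbb H$-linear map $\eta(q)=\sum_l a_lq_l$ from $\mathbb H^n$ to $\mathbb H$ put $\eta^*\widetilde\omega^p=\sum_{l}\sum_{s=0,1}\tau(a_l)_{ps}\,\omega^{2l+s}$, $p=0,1$. The cone $SP^{2m}\mathbb C^{2n}$ of strongly positive elements consists of the finite combinations, with nonnegative coefficients, of the elements $\eta_1^*\widetilde\omega^0\wedge\eta_1^*\widetilde\omega^1\wedge\dots\wedge\eta_m^*\widetilde\omega^0\wedge\eta_m^*\widetilde\omega^1$ with $\eta_1,\dots,\eta_m$ linearly independent. A function on an open set $\Omega\subseteq\mathbb H^n$ is plurisubharmonic ($PSH$) if it is upper semicontinuous and subharmonic on each right quaternionic line $\{a+bt:t\in\mathbb H\}$. A $2k$-current $T$ on $\Omega$ is a continuous linear functional on the smooth compactly supported $(2n-2k)$-forms in $\Omega$; it is positive if $T(\eta)\ge0$ whenever $\eta$ has values in $SP^{2n-2k}\mathbb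 C^{2n}$; $(\triangle T)(\eta):=T(\triangle\eta)$; and if $T=\sum_I T_I\omega^I$ has (complex Radon) measure coefficients and $u$ is a locally bounded Borel function, $uT:=\sum_I(uT_I)\omega^I$. For $u_1,\dots,u_k\in PSH\cap C^2(\Omega)$, $\triangle u_1\wedge\dots\wedge\triangle u_k$ is the pointwise product, and $\|\triangle u_1\wedge\dots\wedge\triangle u_k\|_L:=\int_L f\,dV$ where $\triangle u_1\wedge\dots\wedge\triangle u_k\wedge\beta_n^{n-k}=f\,\Omega_{2n}$. For $u_1,\dots,u_k\in PSH\cap L^\infty_{loc}(\Omega)$, $\triangle u_1\wedge\dots\wedge\triangle u_k$ is the current defined inductively by $\triangle u_1\wedge\dots\wedge\triangle u_k:=\triangle(u_1\,\triangle u_2\wedge\dots\wedge\triangle u_k)$, starting from the constant $0$-current $1$; and $\|T\|_L:=\nu(L)$ if $T$ is a positive $2k$-current and $\nu$ is the Radon measure on $\Omega$ with $T\wedge\beta_n^{n-k}=\nu\,\Omega_{2n}$, i.e. $T(f\beta_n^{n-k})=\int f\,d\nu$ for all test functions $f$. **Statement.** Let $K,L\subset\mathbb H^n$ be compact with $L\subset\operatorname{int}K$.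 There is a constant $C>0$, depending only on $K$ and $L$, such that for every open set $\Omega\supseteq K$ and all $k\le n$: 1. for all $u_1,\dots,u_k\in PSH\cap C^2(\Omega)$, $$0\le\|\triangle u_1\wedge\dots\wedge\triangle u_k\|_L\le C\prod_{i=1}^k\|u_i\|_{L^\infty(K)};$$ 2. for all $u_1,\dots,u_k\in PSH\cap L^\infty_{loc}(\Omega)$, the current $\triangle u_1\wedge\dots\wedge\triangle u_k$ is a positive current with measure coefficients, and $$\|\triangle u_1\wedge\dots\wedge\triangle u_k\|_L\le C\prod_{i=1}^k\|u_i\|_{L^\infty(K)}.$$ -/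

import Mathlib

open MeasureTheory TopologicalSpace Set
open scoped Distributions ENNReal NNReal ComplexOrder

noncomputable section

namespace QPlurisubharmonic

/-! ### The flat quaternionic space -/

/-- The quaternionic space `ℍⁿ ≅ ℝ⁴ⁿ`, with its Euclidean norm and Lebesgue measure.  The point `x`
has quaternionic coordinates `q_l = x (l,0) + x (l,1) i + x (l,2) j + x (l,3) k`. -/
abbrev HSpace (n : ℕ) : Type := EuclideanSpace ℝ (Fin n × Fin 4)

/-- The point of `ℍⁿ` with given quaternionic coordinates. -/
def ofQuat {n : ℕ} (q : Fin n → Quaternion ℝ) : HSpace n :=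
  WithLp.toLp 2 fun p => ![(q p.1).re, (q p.1).imI, (q p.1).imJ, (q p.1).imK] p.2

/-- A quaternion from its four real coordinates. -/
def quatOf (t : EuclideanSpace ℝ (Fin 4)) : Quaternion ℝ := ⟨t 0, t 1, t 2, t 3⟩

/-- The parametrization `t ↦ a + b t` of a right quaternionic line of `ℍⁿ`. -/
def rightLine {n : ℕ} (a b : Fin n → Quaternion ℝ) (t : EuclideanSpace ℝ (Fin 4)) : HSpace n :=
  ofQuat fun l => a l + b l * quatOf t

/-! ### Plurisubharmonic functions -/

/-- Real-valued subharmonic functions on an open subset `D` of a Euclidean space: upper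
semicontinuous, with the sub-mean value inequality on every closed ball contained in `D`.
(An upper semicontinuous function is bounded above on a closed ball, so its mean over the ball is
always defined in `[-∞, ∞)`; the inequality forces it to be finite, i.e. the function to be
integrable on the ball.) -/
structure IsSubharmonicOn {ι : Type*} [Fintype ι] (v : EuclideanSpace ℝ ι → ℝ)
    (D : Set (EuclideanSpace ℝ ι)) : Prop where
  usc : UpperSemicontinuousOn v D
  integrableOn : ∀ x r, 0 < r → Metric.closedBall x r ⊆ D →
    IntegrableOn v (Metric.closedBall x r) volume
  le_average : ∀ x r, 0 < r → Metric.closedBall x r ⊆ D →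
    v x ≤ ⨍ y in Metric.closedBall x r, v y ∂volume

/-- Real-valued quaternionic plurisubharmonic functions on the open set `Ω ⊆ ℍⁿ`: upper
semicontinuous and subharmonic on each right quaternionic line. -/
structure IsPSH {n : ℕ} (Ω : Opens (HSpace n)) (u : HSpace n → ℝ) : Prop where
  usc : UpperSemicontinuousOn u Ω
  subharmonic : ∀ a b : Fin n → Quaternion ℝ,
    IsSubharmonicOn (fun t => u (rightLine a b t)) {t | rightLine a b t ∈ Ω}

/-- `u ∈ L^∞_loc(Ω)`. -/
def IsLocallyBounded {n : ℕ} (Ω : Opens (HSpace n)) (u : HSpace n → ℝ) : Prop :=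
  ∀ K : Set (HSpace n), IsCompact K → K ⊆ Ω → MemLp u ∞ (volume.restrict K)

/-- The norm `‖u‖_{L^∞(K)}`. -/
def supNorm {n : ℕ} (K : Set (HSpace n)) (u : HSpace n → ℝ) : ℝ :=
  (eLpNorm u ∞ (volume.restrict K)).toReal

/-! ### The exterior algebra of `ℂ²ⁿ` -/

/-- The exterior algebra `∧ ℂ²ⁿ`.  The index `2l + s` (with `s = 0, 1`) of `Fin (n * 2)` has
`divNat = l` and `modNat = s`. -/
abbrev Ext (n : ℕ) : Type := ExteriorAlgebra ℂ (Fin (n * 2) → ℂ)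

/-- Coefficient vectors `(f_I)_I`, `I ⊆ {0, …, 2n-1}`, of elements of `∧ ℂ²ⁿ`. -/
abbrev Coeff (n : ℕ) : Type := Finset (Fin (n * 2)) → ℂ

/-- The basis element `ω^j` of `ℂ²ⁿ`. -/
def omega {n : ℕ} (j : Fin (n * 2)) : Ext n := ExteriorAlgebra.ι ℂ (Pi.single j 1)

/-- The identification of `∑_I f_I ω^I` with `(f_I)_I`, where
`ω^I = ω^{i₁} ∧ … ∧ ω^{i_p}` for `I = {i₁ < … < i_p}`. -/
def coeff (n : ℕ) : Ext n ≃ₗ[ℂ] Coeff n := (Pi.basisFun ℂ (Fin (n * 2))).ExteriorAlgebra.equivFun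

/-- The coefficient of `Ω_{2n} = ω^0 ∧ ω^1 ∧ … ∧ ω^{2n-1}`. -/
def topCoeff {n : ℕ} (w : Ext n) : ℂ := coeff n w Finset.univ

/-- `β_n = ∑_l ω^{2l} ∧ ω^{2l+1}`. -/
def beta (n : ℕ) : Ext n :=
  ∑ l : Fin n, omega (finProdFinEquiv (l, 0)) * omega (finProdFinEquiv (l, 1))

/-- Exterior multiplication `a ∧ ·` by `a`, on coefficient vectors. -/
def wedgeLeft {n : ℕ} (a : Ext n) : Coeff n →L[ℂ] Coeff n :=
  LinearMap.toContinuousLinearMap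
    ((coeff n).toLinearMap ∘ₗ LinearMap.mulLeft ℂ a ∘ₗ (coeff n).symm.toLinearMap)

/-- The pairing `(φ, ψ) ↦` coefficient of `Ω_{2n}` in `ψ ∧ φ`, on coefficient vectors. -/
def topPairing (n : ℕ) : Coeff n →L[ℂ] Coeff n →L[ℂ] ℂ :=
  LinearMap.toContinuousLinearMap
    (LinearMap.toContinuousLinearMap.toLinearMap ∘ₗ
      LinearMap.mk₂ ℂ
        (fun φ ψ : Coeff n => topCoeff ((coeff n).symm ψ * (coeff n).symm φ))
        (by intros; simp [topCoeff, mul_add]) (by intros; simp [topCoeff])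
        (by intros; simp [topCoeff, add_mul]) (by intros; simp [topCoeff]))

theorem topPairing_apply {n : ℕ} (φ ψ : Coeff n) :
    topPairing n φ ψ = topCoeff ((coeff n).symm ψ * (coeff n).symm φ) := rfl

/-! ### Strongly positive elements -/

/-- The complex `2 × 2` matrix `τ(q)` of a quaternion `q`. -/
def tau (q : Quaternion ℝ) : Matrix (Fin 2) (Fin 2) ℂ :=
  !![(q.re : ℂ) - Complex.I * q.imI, -(q.imJ : ℂ) + Complex.I * q.imK;
     (q.imJ : ℂ) + Complex.I * q.imK, (q.re : ℂ) + Complex.I * q.imI]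

/-- The pull-back `η^* ω̃^p = ∑_j τ(η)_{pj} ω^j` under the right `ℍ`-linear map
`η : ℍⁿ → ℍ`, `η(q) = ∑_l η_l q_l`. -/
def pullback {n : ℕ} (η : Fin n → Quaternion ℝ) (p : Fin 2) : Ext n :=
  ∑ j : Fin (n * 2), tau (η j.divNat) p j.modNat • omega j

/-- Elementary strongly positive `2m`-elements
`η_1^* ω̃^0 ∧ η_1^* ω̃^1 ∧ … ∧ η_m^* ω̃^0 ∧ η_m^* ω̃^1`, where `η_1, …, η_m : ℍⁿ → ℍ` are
linearly independent right `ℍ`-linear maps (these maps form a left `ℍ`-module, the module of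
their rows). -/
def IsElementarySP (n m : ℕ) (w : Ext n) : Prop :=
  ∃ η : Fin m → Fin n → Quaternion ℝ, LinearIndependent (Quaternion ℝ) η ∧
    w = (List.ofFn fun i => pullback (η i) 0 * pullback (η i) 1).prod

/-- The convex cone `SP^{2m} ℂ²ⁿ` of strongly positive elements: finite combinations of elementary
strongly positive ones with nonnegative real coefficients. -/
def SP (n m : ℕ) : Submodule ℝ≥0 (Ext n) := Submodule.span ℝ≥0 {w | IsElementarySP n m w}

/-! ### The operators `d₀`, `d₁` and the Baston operator on functions -/

/-- The coefficients of `∇_{jα}` for `j = 2l + s` with respect to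
`∂_{x_{4l}}, ∂_{x_{4l+1}}, ∂_{x_{4l+2}}, ∂_{x_{4l+3}}`. -/
def nablaCoeff (s α : Fin 2) : Fin 4 → ℂ :=
  ![![![1, Complex.I, 0, 0], ![0, 0, -1, -Complex.I]],
    ![![0, 0, 1, -Complex.I], ![1, -Complex.I, 0, 0]]] s α

/-- The coordinate direction of `x_{4l+m}` in `ℍⁿ`. -/
def dir {n : ℕ} (l : Fin n) (m : Fin 4) : HSpace n := EuclideanSpace.single (l, m) 1

/-- `∇_{jα}`, acting coefficientwise on form-valued functions. -/
def nabla {n : ℕ} (j : Fin (n * 2)) (α : Fin 2) (F : HSpace n → Coeff n) (x : HSpace n) : Coeff n :=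
  ∑ m : Fin 4, nablaCoeff j.modNat α m • fderiv ℝ F x (dir j.divNat m)

/-- `d_α F = ∑_{k,I} ∇_{kα} f_I ω^k ∧ ω^I` for `F = ∑_I f_I ω^I`. -/
def dForm {n : ℕ} (α : Fin 2) (F : HSpace n → Coeff n) (x : HSpace n) : Coeff n :=
  ∑ j : Fin (n * 2), wedgeLeft (omega j) (nabla j α F x)

/-- A scalar function as a `0`-form. -/
def zeroForm {n : ℕ} (u : HSpace n → ℝ) (x : HSpace n) : Coeff n :=
  coeff n (algebraMap ℂ (Ext n) (u x))

/-- The `2`-form `△u = d₀ d₁ u`. -/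
def baston {n : ℕ} (u : HSpace n → ℝ) (x : HSpace n) : Ext n :=
  (coeff n).symm (dForm 0 (dForm 1 (zeroForm u)) x)

/-- The `2k`-form `△u_1 ∧ … ∧ △u_k` for `C²` functions. -/
def bastonWedge {n k : ℕ} (u : Fin k → HSpace n → ℝ) (x : HSpace n) : Ext n :=
  (List.ofFn fun i => baston (u i) x).prod

/-- `‖F‖_L = ∫_L F ∧ β_n^p` for a (continuous) form `F` of degree `2n - 2p`. -/
def formMass {n : ℕ} (L : Set (HSpace n)) (p : ℕ) (F : HSpace n → Ext n) : ℂ :=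
  ∫ x in L, topCoeff (F x * beta n ^ p) ∂volume

/-! ### Currents -/

/-- Test forms on `Ω`: smooth compactly supported functions with values in `∧ ℂ²ⁿ`, of all
degrees simultaneously (written through their coefficients). -/
abbrev TestForm {n : ℕ} (Ω : Opens (HSpace n)) : Type := 𝓓(Ω, Coeff n)

/-- Currents on `Ω`: the topological dual of the space of test forms.  A `p`-current is a current
that only depends on the component of degree `2n - p` of the test form. -/
abbrev Current {n : ℕ} (Ω : Opens (HSpace n)) : Type := TestForm Ω →L[ℂ] ℂ

/-- `∇_{jα}` on test forms. -/
def nablaTest {n : ℕ} (Ω : Opens (HSpace n)) (j : Fin (n * 2)) (α : Fin 2) :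
    TestForm Ω →L[ℂ] TestForm Ω :=
  ∑ m : Fin 4,
    TestFunction.postcompCLM (nablaCoeff j.modNat α m • ContinuousLinearMap.id ℂ (Coeff n)) ∘L
      TestFunction.lineDerivCLM ℂ (dir j.divNat m)

/-- `d_α` on test forms. -/
def dTest {n : ℕ} (Ω : Opens (HSpace n)) (α : Fin 2) : TestForm Ω →L[ℂ] TestForm Ω :=
  ∑ j : Fin (n * 2), TestFunction.postcompCLM (wedgeLeft (omega j)) ∘L nablaTest Ω j α

theorem dTest_apply {n : ℕ} (Ω : Opens (HSpace n)) (α : Fin 2) (η : TestForm Ω) (x : HSpace n) :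
    dTest Ω α η x = dForm α (fun y => η y) x := by
  have hs : ∀ {ι : Type} (s : Finset ι) (A : ι → TestForm Ω), (∑ i ∈ s, A i : TestForm Ω) x =
      ∑ i ∈ s, A i x := by
    intro ι s A
    classical
    induction s using Finset.induction_on with
    | empty => simp
    | insert a s ha ih => rw [Finset.sum_insert ha, Finset.sum_insert ha, ← ih]; rfl
  have h1 : ∀ j, nablaTest Ω j α η x = nabla j α (fun y => η y) x := by
    intro j
    rw [nablaTest, sum_apply, hs]
    refine Finset.sum_congr rfl fun m _ => ?_
    show nablaCoeff j.modNat α m •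
      (TestFunction.lineDerivCLM ℂ (dir j.divNat m) η : TestForm Ω) x = _
    rw [TestFunction.lineDerivCLM_eq_fderivCLM, TestFunction.fderivCLM_apply_of_le _ (by simp)]
  rw [dTest, sum_apply, hs]
  refine Finset.sum_congr rfl fun j _ => ?_
  rw [← h1 j]
  rfl

variable {n : ℕ} {Ω : Opens (HSpace n)}

/-- `△T`, defined by `(△T)(η) = T(△η)` with `△η = d₀ d₁ η`. -/
def Current.baston (T : Current Ω) : Current Ω := T ∘L dTest Ω 0 ∘L dTest Ω 1

/-- The current `φ ↦ ∫ ψ ∧ φ`, for `ψ = ∑_I (h_I μ) ω^I` a form with measure coefficients `h_I μ`,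
where `μ` is a positive measure and the densities `h_I` are locally `μ`-integrable in `Ω`. -/
def Current.ofMeasure (Ω : Opens (HSpace n)) (μ : Measure (HSpace n)) (h : HSpace n → Coeff n) :
    Current Ω :=
  TestFunction.integralAgainstBilinCLM (topPairing n) μ h

/-- `T = ∑_I T_I ω^I` with complex Radon measures `T_I = h_I μ` on `Ω`. -/
def Current.HasMeasureRep (T : Current Ω) (μ : Measure (HSpace n)) (h : HSpace n → Coeff n) :
    Prop :=
  LocallyIntegrableOn h Ω μ ∧ T = Current.ofMeasure Ω μ h

/-- `T` has measure coefficients, i.e. is of order zero. -/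
def Current.HasMeasureCoeff (T : Current Ω) : Prop :=
  ∃ (μ : Measure (HSpace n)) (h : HSpace n → Coeff n), T.HasMeasureRep μ h

open Classical in
/-- The product `u T = ∑_I (u T_I) ω^I` of a locally bounded Borel function `u` and a current
`T = ∑_I T_I ω^I` with measure coefficients (which does not depend on how the measures `T_I` are
written as `h_I μ`).  For other currents the value is the dummy `0`. -/
def Current.mulFun (u : HSpace n → ℝ) (T : Current Ω) : Current Ω :=
  if H : T.HasMeasureCoeff then
    Current.ofMeasure Ω H.choose fun x => (u x : ℂ) • H.choose_spec.choose x
  else 0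

/-- The `0`-current `φ ↦ ∫_Ω φ` given by the constant function `1`. -/
def Current.one (Ω : Opens (HSpace n)) : Current Ω :=
  Current.ofMeasure Ω volume fun _ => coeff n 1

/-- The current `△u_1 ∧ … ∧ △u_k`, defined inductively by
`△u_1 ∧ … ∧ △u_k = △(u_1 △u_2 ∧ … ∧ △u_k)`. -/
def bastonProduct (Ω : Opens (HSpace n)) : List (HSpace n → ℝ) → Current Ω
  | [] => Current.one Ω
  | u :: us => ((bastonProduct Ω us).mulFun u).baston

/-- A current `T` is positive in degree `2k` if `T(η) ≥ 0` for every test form `η` with values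
in `SP^{2n-2k} ℂ²ⁿ`. -/
def Current.IsPositive (k : ℕ) (T : Current Ω) : Prop :=
  ∀ η : TestForm Ω, (∀ x, (coeff n).symm (η x) ∈ SP n (n - k)) → 0 ≤ T η

/-- The test form `f w`, for a scalar test function `f` and a constant element `w` of `∧ ℂ²ⁿ`. -/
def constTestForm (w : Ext n) (f : 𝓓(Ω, ℂ)) : TestForm Ω :=
  TestFunction.postcompCLM
    (ContinuousLinearMap.smulRight (1 : ℂ →L[ℂ] ℂ) (coeff n w)) f

/-- The `2n`-current `T ∧ β_n^p` is `ν Ω_{2n}`, for the positive Radon measure `ν` on `Ω`.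
By the Riesz representation theorem, `ν` is unique on `Ω`; then `‖T‖_L = ∫_L T ∧ β_n^p = ν(L)`
for all compact `L ⊆ Ω`. -/
structure Current.IsMassMeasure (T : Current Ω) (p : ℕ) (ν : Measure (HSpace n)) : Prop where
  finite : ∀ K : Set (HSpace n), IsCompact K → K ⊆ Ω → ν K < ∞
  eq_integral : ∀ f : 𝓓(Ω, ℂ), T (constTestForm (beta n ^ p) f) = ∫ x, f x ∂ν

end QPlurisubharmonic

end

/-!
The form `△u` of a smooth plurisubharmonic function is strongly positive, so regularizing `u` shows
that `△(u T)` is positive whenever `T` is closed and positive; a positive current has measure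
coefficients, and so the product of bounded functions makes sense one factor at a time.

For the estimate, take a cutoff function `χ` with compact support in the interior of `K`. Since
`T` is closed, `△(u T)(χ β_n^p)` is `T` evaluated at `u △χ ∧ β_n^p`. If `χ'` is a cutoff function
with a large constant value on the support of `χ`, then `χ' β_n ± △χ` is strongly positive, and the
positivity of `T` bounds this by `‖u‖_{L^∞(K)} T(χ' β_n^{p+1})`. Hence one factor is removed at the
cost of `‖u‖_{L^∞(K)}` and a new cutoff function, chosen independently of `Ω` and of the `u_i`.
-/

noncomputable section

open scoped Quaternion ContDiff Topology Matrix

namespace QPlurisubharmonic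

variable {n m : ℕ}

/-! ### Quaternionic determinants -/

/-- The embedding `τ` of the quaternions into the complex `2 × 2` matrices as a homomorphism of
real algebras. -/
def tauHom : ℍ[ℝ] →ₐ[ℝ] Matrix (Fin 2) (Fin 2) ℂ :=
  AlgHom.ofLinearMap
    { toFun := tau
      map_add' := fun a b => by
        ext i j
        fin_cases i <;> fin_cases j <;> simp [tau] <;> ring
      map_smul' := fun c a => by
        ext i j
        fin_cases i <;> fin_cases j <;> simp [tau] <;> ring }
    (by
      ext i j
      fin_cases i <;> fin_cases j <;> simp [tau])
    (fun a b => by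
      ext i j
      fin_cases i <;> fin_cases j <;>
        simp [tau, Matrix.mul_apply, Fin.sum_univ_two] <;>
        ring_nf <;> simp only [Complex.I_sq] <;> ring)

theorem tau_add (a b : ℍ[ℝ]) : tau (a + b) = tau a + tau b := map_add tauHom a b

theorem tau_sub (a b : ℍ[ℝ]) : tau (a - b) = tau a - tau b := map_sub tauHom a b

theorem tau_mul (a b : ℍ[ℝ]) : tau (a * b) = tau a * tau b := map_mul tauHom a b

theorem tau_smul (c : ℝ) (a : ℍ[ℝ]) : tau (c • a) = c • tau a := map_smul tauHom c a

theorem tau_zero : tau 0 = 0 := map_zero tauHom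

theorem tau_one : tau 1 = 1 := map_one tauHom

theorem det_tau (a : ℍ[ℝ]) : (tau a).det = (Quaternion.normSq a : ℝ) := by
  rw [Matrix.det_fin_two, Quaternion.normSq_def']
  simp only [tau, Matrix.of_apply, Matrix.cons_val_zero, Matrix.cons_val_one]
  push_cast
  linear_combination (-(a.imI : ℂ) ^ 2 - (a.imK : ℂ) ^ 2) * Complex.I_sq

/-- The complexification of the quaternions is the algebra of complex `2 × 2` matrices. -/
theorem span_range_tau : Submodule.span ℂ (range tau) = ⊤ := by
  refine eq_top_iff.2 fun M _ => ?_
  have hM : M = ((M 0 0 + M 1 1) / 2) • tau ⟨1, 0, 0, 0⟩ +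
      (Complex.I * (M 0 0 - M 1 1) / 2) • tau ⟨0, 1, 0, 0⟩ +
      ((M 1 0 - M 0 1) / 2) • tau ⟨0, 0, 1, 0⟩ +
      (-Complex.I * (M 0 1 + M 1 0) / 2) • tau ⟨0, 0, 0, 1⟩ := by
    ext i j
    fin_cases i <;> fin_cases j <;> simp [tau] <;> ring_nf <;> simp only [Complex.I_sq] <;> ring
  rw [hM]
  have mem (c : ℂ) (q : ℍ[ℝ]) : c • tau q ∈ Submodule.span ℂ (range tau) :=
    Submodule.smul_mem _ _ (Submodule.subset_span ⟨q, rfl⟩)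
  exact add_mem (add_mem (add_mem (mem _ _) (mem _ _)) (mem _ _)) (mem _ _)

/-- The complex matrix obtained from a quaternionic matrix by replacing each entry `q` by the
`2 × 2` block `τ(q)`. -/
def tauMatrix {ι κ : Type*} (A : Matrix ι κ ℍ[ℝ]) : Matrix (ι × Fin 2) (κ × Fin 2) ℂ :=
  Matrix.comp ι κ (Fin 2) (Fin 2) ℂ (A.map tau)

theorem tauMatrix_apply {ι κ : Type*} (A : Matrix ι κ ℍ[ℝ]) (i : ι × Fin 2) (j : κ × Fin 2) :
    tauMatrix A i j = tau (A i.1 j.1) i.2 j.2 := rfl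

/-- One step of Gaussian elimination over the skew field of quaternions. -/
theorem det_tauMatrix_of_pivot (A : Matrix (Fin (m + 1)) (Fin (m + 1)) ℍ[ℝ]) (h : A 0 0 ≠ 0) :
    (tauMatrix A).det = (Quaternion.normSq (A 0 0) : ℝ) *
      (tauMatrix (.of fun i j : Fin m =>
        A i.succ j.succ - A i.succ 0 * (A 0 0)⁻¹ * A 0 j.succ)).det := by
  let e : Fin 2 ⊕ (Fin m × Fin 2) ≃ Fin (m + 1) × Fin 2 :=
    { toFun := Sum.elim (fun s => (0, s)) (fun p => (p.1.succ, p.2))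
      invFun := fun p => Fin.cases (motive := fun _ => Fin 2 ⊕ (Fin m × Fin 2))
        (Sum.inl p.2) (fun i => Sum.inr (i, p.2)) p.1
      left_inv := by rintro (s | ⟨i, s⟩) <;> rfl
      right_inv := by
        rintro ⟨i, s⟩
        refine Fin.cases ?_ (fun i => ?_) i <;> rfl }
  let : Invertible (tau (A 0 0)) :=
    ⟨tau (A 0 0)⁻¹, by rw [← tau_mul, inv_mul_cancel₀ h, tau_one],
      by rw [← tau_mul, mul_inv_cancel₀ h, tau_one]⟩
  have hinv : ⅟(tau (A 0 0)) = tau (A 0 0)⁻¹ := rfl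
  have hblocks : (tauMatrix A).submatrix e e = Matrix.fromBlocks (tau (A 0 0))
      (.of fun s p => tau (A 0 p.1.succ) s p.2) (.of fun p s => tau (A p.1.succ 0) p.2 s)
      (tauMatrix (.of fun i j => A i.succ j.succ)) := by
    ext (s | ⟨i, s⟩) (t | ⟨j, t⟩) <;> rfl
  rw [← Matrix.det_submatrix_equiv_self e, hblocks, Matrix.det_fromBlocks₁₁, det_tau]
  congr 2
  ext ⟨i, s⟩ ⟨j, t⟩
  simp only [Matrix.sub_apply, tauMatrix_apply, hinv, tau_sub, tau_mul, Matrix.mul_apply,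
    Matrix.of_apply]

theorem det_tauMatrix_nonneg (A : Matrix (Fin m) (Fin m) ℍ[ℝ]) : 0 ≤ (tauMatrix A).det := by
  induction m with
  | zero => simp
  | succ m ih =>
    have of_pivot (B : Matrix (Fin (m + 1)) (Fin (m + 1)) ℍ[ℝ]) (h : B 0 0 ≠ 0) :
        0 ≤ (tauMatrix B).det := by
      rw [det_tauMatrix_of_pivot B h]
      exact mul_nonneg (by exact_mod_cast Quaternion.normSq_nonneg) (ih _)
    by_cases h : ∃ i, A i 0 ≠ 0
    · obtain ⟨i, hi⟩ := h
      have hswap := of_pivot (A.submatrix (Equiv.swap 0 i) id) (by simpa)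
      -- Exchanging two quaternionic rows exchanges two pairs of complex rows.
      rw [show tauMatrix (A.submatrix (Equiv.swap 0 i) id) = (tauMatrix A).submatrix
        (Equiv.prodCongrLeft fun _ : Fin 2 => Equiv.swap 0 i) id from rfl,
        Matrix.det_permute, Equiv.Perm.sign_prodCongrLeft] at hswap
      rcases Int.units_eq_one_or (Equiv.Perm.sign (Equiv.swap 0 i)) with hs | hs <;>
        simpa [hs] using hswap
    · push Not at h
      rw [Matrix.det_eq_zero_of_column_eq_zero (0, 0)]
      rintro ⟨i, s⟩
      simp [tauMatrix_apply, h i, tau_zero]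

/-! ### Pull-backs of the basis of `ℂ²` -/

theorem commute_ι_mul_ι {R M : Type*} [CommRing R] [AddCommGroup M] [Module R M] (v w : M)
    (x : ExteriorAlgebra R M) :
    Commute (ExteriorAlgebra.ι R v * ExteriorAlgebra.ι R w) x := by
  have swap (a b : M) : ExteriorAlgebra.ι R a * ExteriorAlgebra.ι R b =
      -(ExteriorAlgebra.ι R b * ExteriorAlgebra.ι R a) :=
    eq_neg_of_add_eq_zero_left (ExteriorAlgebra.ι_add_mul_swap a b)
  induction x using ExteriorAlgebra.induction with
  | algebraMap r => exact Algebra.commute_algebraMap_right _ _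
  | ι z =>
    rw [Commute, SemiconjBy, mul_assoc, swap w z, mul_neg, ← mul_assoc, swap v z, neg_mul, neg_neg,
      mul_assoc]
  | mul a b ha hb => exact ha.mul_right hb
  | add a b ha hb => exact ha.add_right hb

theorem ι_eq_sum_omega (v : Fin (n * 2) → ℂ) :
    ExteriorAlgebra.ι ℂ v = ∑ j, v j • omega (n := n) j := by
  simp only [omega, ← map_smul, ← map_sum]
  congr 1
  ext j
  simp [Finset.sum_apply, Pi.single_apply]

/-- `η^* ω̃^p` as a vector of `ℂ²ⁿ`. -/
def pullbackVec (η : Fin n → ℍ[ℝ]) (p : Fin 2) : Fin (n * 2) → ℂ :=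
  fun j => tau (η j.divNat) p j.modNat

theorem pullback_eq_ι (η : Fin n → ℍ[ℝ]) (p : Fin 2) :
    pullback η p = ExteriorAlgebra.ι ℂ (pullbackVec η p) :=
  (ι_eq_sum_omega _).symm

/-- `η ↦ η^* ω̃^p` as a real linear map. -/
def pullbackₗ (n : ℕ) (p : Fin 2) : (Fin n → ℍ[ℝ]) →ₗ[ℝ] Ext n where
  toFun η := pullback η p
  map_add' η ζ := by simp [pullback, tau_add, add_smul, Finset.sum_add_distrib]
  map_smul' c η := by
    simp only [pullback, Pi.smul_apply, tau_smul, Matrix.smul_apply, smul_assoc, Finset.smul_sum,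
      RingHom.id_apply]
    rfl

theorem pullback_add (η ζ : Fin n → ℍ[ℝ]) (p : Fin 2) :
    pullback (η + ζ) p = pullback η p + pullback ζ p :=
  map_add (pullbackₗ n p) η ζ

theorem pullback_sum {ι : Type*} (s : Finset ι) (f : ι → Fin n → ℍ[ℝ]) (p : Fin 2) :
    pullback (∑ i ∈ s, f i) p = ∑ i ∈ s, pullback (f i) p :=
  map_sum (pullbackₗ n p) f s

theorem pullback_real_smul (c : ℝ) (η : Fin n → ℍ[ℝ]) (p : Fin 2) :
    pullback (c • η) p = (c : ℂ) • pullback η p :=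
  map_smul (pullbackₗ n p) c η

theorem pullback_smul (c : ℍ[ℝ]) (η : Fin n → ℍ[ℝ]) (p : Fin 2) :
    pullback (c • η) p = ∑ s, tau c p s • pullback η s := by
  simp only [pullback, Finset.smul_sum, smul_smul]
  rw [Finset.sum_comm]
  simp [tau_mul, Matrix.mul_apply, add_smul]

theorem divNat_finProdFinEquiv (l : Fin n) (s : Fin m) : (finProdFinEquiv (l, s)).divNat = l :=
  congrArg Prod.fst (finProdFinEquiv.symm_apply_apply (l, s))

theorem modNat_finProdFinEquiv (l : Fin n) (s : Fin m) : (finProdFinEquiv (l, s)).modNat = s :=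
  congrArg Prod.snd (finProdFinEquiv.symm_apply_apply (l, s))

theorem pullback_single (l : Fin n) (a : ℍ[ℝ]) (p : Fin 2) :
    pullback (Pi.single l a) p = ∑ s, tau a p s • omega (finProdFinEquiv (l, s)) := by
  simp only [pullback, ← finProdFinEquiv.sum_comp, Fintype.sum_prod_type, divNat_finProdFinEquiv,
    modNat_finProdFinEquiv]
  rw [Fintype.sum_eq_single l fun b hb => ?_, Pi.single_eq_same]
  simp [Pi.single_eq_of_ne hb, tau_zero]

theorem pullback_single_one (l : Fin n) (p : Fin 2) :
    pullback (Pi.single l 1) p = omega (finProdFinEquiv (l, p)) := by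
  rw [pullback_single, tau_one]
  simp [Matrix.one_apply, ite_smul]

/-- The elementary strongly positive `2`-element `η^* ω̃^0 ∧ η^* ω̃^1`; `η = 0` is allowed. -/
def elem (η : Fin n → ℍ[ℝ]) : Ext n := pullback η 0 * pullback η 1

theorem commute_elem (η : Fin n → ℍ[ℝ]) (x : Ext n) : Commute (elem η) x := by
  rw [elem, pullback_eq_ι, pullback_eq_ι]
  exact commute_ι_mul_ι _ _ _

theorem pullback_mul_self (η : Fin n → ℍ[ℝ]) (p : Fin 2) : pullback η p * pullback η p = 0 := by
  rw [pullback_eq_ι, ExteriorAlgebra.ι_sq_zero]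

theorem pullback_mul_elem (η : Fin n → ℍ[ℝ]) (p : Fin 2) : pullback η p * elem η = 0 := by
  fin_cases p
  · change pullback η 0 * _ = 0
    rw [elem, ← mul_assoc, pullback_mul_self, zero_mul]
  · change pullback η 1 * _ = 0
    rw [← (commute_elem η _).eq, elem, mul_assoc, pullback_mul_self, mul_zero]

theorem elem_smul (c : ℍ[ℝ]) (η : Fin n → ℍ[ℝ]) :
    elem (c • η) = ((Quaternion.normSq c : ℝ) : ℂ) • elem η := by
  have hswap : pullback η 1 * pullback η 0 = -(pullback η 0 * pullback η 1) := by
    rw [pullback_eq_ι, pullback_eq_ι]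
    exact eq_neg_of_add_eq_zero_left (ExteriorAlgebra.ι_add_mul_swap _ _)
  rw [← det_tau, Matrix.det_fin_two]
  simp only [elem, pullback_smul, Fin.sum_univ_two, add_mul, mul_add, smul_mul_assoc,
    mul_smul_comm, pullback_mul_self, hswap]
  module

theorem elem_add (η ζ : Fin n → ℍ[ℝ]) :
    elem (η + ζ) = elem η + elem ζ +
      (pullback η 0 * pullback ζ 1 + pullback ζ 0 * pullback η 1) := by
  simp only [elem, pullback_add, add_mul, mul_add]
  abel

theorem beta_eq_sum_elem (n : ℕ) : beta n = ∑ l : Fin n, elem (Pi.single l 1) := by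
  simp [beta, elem, pullback_single_one]

/-! ### The cone of strongly positive elements -/

theorem elem_mul_prod_eq_zero (η : Fin n → ℍ[ℝ]) (ζ : Fin m → Fin n → ℍ[ℝ])
    (h : η ∈ Submodule.span ℍ[ℝ] (range ζ)) :
    elem η * (List.ofFn fun i => elem (ζ i)).prod = 0 := by
  have hζ (i : Fin m) (p : Fin 2) :
      pullback (ζ i) p * (List.ofFn fun i => elem (ζ i)).prod = 0 := by
    obtain ⟨a, b, hab⟩ := List.append_of_mem
      ((List.mem_ofFn' (fun i => elem (ζ i)) _).2 ⟨i, rfl⟩)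
    rw [hab, List.prod_append, List.prod_cons, ← mul_assoc _ (elem _), ← (commute_elem _ _).eq,
      ← mul_assoc, ← mul_assoc, pullback_mul_elem, zero_mul, zero_mul]
  obtain ⟨c, rfl⟩ := (Submodule.mem_span_range_iff_exists_fun _).1 h
  have hsum : pullback (∑ i, c i • ζ i) 1 * (List.ofFn fun i => elem (ζ i)).prod = 0 := by
    simp only [pullback_sum, pullback_smul, Finset.sum_mul, smul_mul_assoc, hζ, smul_zero,
      Finset.sum_const_zero]
  rw [elem, mul_assoc, hsum, mul_zero]

theorem prod_elem_eq_zero (ζ : Fin m → Fin n → ℍ[ℝ]) (h : ¬LinearIndependent ℍ[ℝ] ζ) :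
    (List.ofFn fun i => elem (ζ i)).prod = 0 := by
  induction m with
  | zero => exact absurd linearIndependent_empty_type h
  | succ m ih =>
    rw [List.ofFn_succ, List.prod_cons]
    by_cases htail : LinearIndependent ℍ[ℝ] fun i : Fin m => ζ i.succ
    · refine elem_mul_prod_eq_zero _ _ (not_not.1 fun hmem => h ?_)
      rw [← Fin.cons_self_tail ζ]
      exact linearIndependent_finCons.2 ⟨htail, hmem⟩
    · rw [ih _ htail, mul_zero]

/-- Dependent families may be admitted in the definition of the cone: they contribute `0`. -/
theorem SP_eq_span (n m : ℕ) : SP n m = Submodule.span ℝ≥0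
    (range fun ζ : Fin m → Fin n → ℍ[ℝ] => (List.ofFn fun i => elem (ζ i)).prod) := by
  refine le_antisymm (Submodule.span_mono ?_) (Submodule.span_le.2 ?_)
  · rintro _ ⟨ζ, -, rfl⟩
    exact ⟨ζ, rfl⟩
  · rintro _ ⟨ζ, rfl⟩
    by_cases h : LinearIndependent ℍ[ℝ] ζ
    · exact Submodule.subset_span ⟨ζ, h, rfl⟩
    · simp only [prod_elem_eq_zero ζ h]
      exact zero_mem _

instance : SetLike.GradedMonoid (SP n) where
  one_mem := by
    rw [SP_eq_span]
    exact Submodule.subset_span ⟨Fin.elim0, by simp⟩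
  mul_mem i j v w hv hw := by
    rw [SP_eq_span] at hv hw ⊢
    induction hv, hw using Submodule.span_induction₂ with
    | mem_mem v w hv hw =>
      obtain ⟨ζ, rfl⟩ := hv
      obtain ⟨ξ, rfl⟩ := hw
      refine Submodule.subset_span ⟨Fin.append ζ ξ, ?_⟩
      rw [← List.prod_append, ← List.ofFn_fin_append]
      refine congrArg (fun f => (List.ofFn f).prod) (funext fun l => ?_)
      refine Fin.addCases (fun l => ?_) (fun l => ?_) l <;> simp
    | zero_left => simp
    | zero_right => simp
    | add_left _ _ _ _ _ _ h₁ h₂ => rw [add_mul]; exact add_mem h₁ h₂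
    | add_right _ _ _ _ _ _ h₁ h₂ => rw [mul_add]; exact add_mem h₁ h₂
    | smul_left c _ _ _ _ h => rw [smul_mul_assoc]; exact Submodule.smul_mem _ c h
    | smul_right c _ _ _ _ h => rw [mul_smul_comm]; exact Submodule.smul_mem _ c h

theorem elem_mem_SP (η : Fin n → ℍ[ℝ]) : elem η ∈ SP n 1 := by
  rw [SP_eq_span]
  exact Submodule.subset_span ⟨fun _ => η, by simp⟩

theorem commute_of_mem_SP {v : Ext n} (hv : v ∈ SP n m) (x : Ext n) : Commute v x := by
  rw [SP_eq_span] at hv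
  induction hv using Submodule.span_induction with
  | mem v hv =>
    obtain ⟨ζ, rfl⟩ := hv
    refine Commute.list_prod_left _ _ fun w hw => ?_
    obtain ⟨i, rfl⟩ := (List.mem_ofFn' _ _).1 hw
    exact commute_elem _ x
  | zero => exact Commute.zero_left x
  | add a b _ _ ha hb => exact ha.add_left hb
  | smul c a _ ha => rw [Commute, SemiconjBy, smul_mul_assoc, ha.eq, mul_smul_comm]

theorem smul_mem_SP {c : ℂ} (hc : 0 ≤ c) {w : Ext n} (hw : w ∈ SP n m) : c • w ∈ SP n m := by
  obtain ⟨r, hr, rfl⟩ := RCLike.nonneg_iff_exists_ofReal.1 hc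
  exact (SP n m).smul_mem ⟨r, hr⟩ hw

theorem beta_mem_SP (n : ℕ) : beta n ∈ SP n 1 := by
  rw [beta_eq_sum_elem]
  exact Submodule.sum_mem _ fun l _ => elem_mem_SP _

theorem beta_pow_mem_SP (n m : ℕ) : beta n ^ m ∈ SP n m := by
  simpa using SetLike.pow_mem_graded m (beta_mem_SP n)

/-! ### The basis of the exterior algebra -/

/-- The basis `ω^I` of `∧ ℂ²ⁿ`. -/
def extBasis (n : ℕ) : Module.Basis (Finset (Fin (n * 2))) ℂ (Ext n) :=
  (Pi.basisFun ℂ (Fin (n * 2))).ExteriorAlgebra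

theorem coeff_extBasis (I : Finset (Fin (n * 2))) : coeff n (extBasis n I) = Pi.single I 1 := by
  classical
  ext J
  rw [coeff, extBasis, Module.Basis.equivFun_self, Pi.single_apply]
  simp only [eq_comm]

theorem coeff_symm_eq_sum (φ : Coeff n) : (coeff n).symm φ = ∑ I, φ I • extBasis n I :=
  (Pi.basisFun ℂ (Fin (n * 2))).ExteriorAlgebra.equivFun_symm_apply φ

theorem extBasis_mem_exteriorPower (I : Finset (Fin (n * 2))) :
    extBasis n I ∈ ⋀[ℂ]^I.card (Fin (n * 2) → ℂ) := by
  rw [extBasis, ExteriorAlgebra.basis_eq_coe_basis _ (⟨I, rfl⟩ : Set.powersetCard _ I.card)]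
  exact Subtype.coe_prop _

theorem coeff_eq_zero_of_mem_exteriorPower {p : ℕ} {w : Ext n}
    (hw : w ∈ ⋀[ℂ]^p (Fin (n * 2) → ℂ)) {I : Finset (Fin (n * 2))} (hI : I.card ≠ p) :
    coeff n w I = 0 := by
  rw [← exteriorPower.ιMulti_family_span_fixedDegree_of_span ℂ
    (Pi.basisFun ℂ (Fin (n * 2))).span_eq] at hw
  induction hw using Submodule.span_induction with
  | mem w hw =>
    obtain ⟨s, rfl⟩ := hw
    rw [← ExteriorAlgebra.basis_apply_powersetCard]
    refine (congrFun (coeff_extBasis s.1) I).trans (Pi.single_eq_of_ne ?_ _)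
    rintro rfl
    exact hI s.2
  | zero => simp
  | add a b _ _ ha hb => rw [map_add, Pi.add_apply, ha, hb, add_zero]
  | smul c a _ ha => rw [map_smul, Pi.smul_apply, ha, smul_zero]

theorem extBasis_mul_of_disjoint {I J : Finset (Fin (n * 2))} (h : Disjoint I J) :
    ∃ ε : ℤˣ, extBasis n I * extBasis n J = ((ε : ℤ) : ℂ) • extBasis n (I ∪ J) := by
  have hmul := (ExteriorAlgebra.basis_mul_of_disjoint (Pi.basisFun ℂ (Fin (n * 2)))
    (⟨I, rfl⟩ : Set.powersetCard _ I.card) (⟨J, rfl⟩ : Set.powersetCard _ J.card) h)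
  rw [Units.smul_def, Set.powersetCard.coe_disjUnion, Finset.disjUnion_eq_union,
    ← Int.cast_smul_eq_zsmul ℂ] at hmul
  exact ⟨_, hmul⟩

theorem extBasis_mul_of_not_disjoint {I J : Finset (Fin (n * 2))} (h : ¬Disjoint I J) :
    extBasis n I * extBasis n J = 0 :=
  ExteriorAlgebra.basis_mul_of_not_disjoint (Pi.basisFun ℂ (Fin (n * 2)))
    (⟨I, rfl⟩ : Set.powersetCard _ I.card) (⟨J, rfl⟩ : Set.powersetCard _ J.card) h

/-! ### The coefficient of `Ω_{2n}` -/

/-- The coefficient of `Ω_{2n}` as a linear form. -/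
def topCoeffₗ (n : ℕ) : Ext n →ₗ[ℂ] ℂ := LinearMap.proj Finset.univ ∘ₗ (coeff n).toLinearMap

theorem topCoeffₗ_apply (w : Ext n) : topCoeffₗ n w = topCoeff w := rfl

theorem topCoeff_smul (c : ℂ) (w : Ext n) : topCoeff (c • w) = c * topCoeff w :=
  map_smul (topCoeffₗ n) c w

theorem topCoeff_extBasis (I : Finset (Fin (n * 2))) :
    topCoeff (extBasis n I) = if I = Finset.univ then 1 else 0 := by
  rw [topCoeff, coeff_extBasis, Pi.single_apply]
  simp only [eq_comm]

theorem topCoeff_extBasis_compl_mul {I J : Finset (Fin (n * 2))} (hJ : J ≠ I) :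
    topCoeff (extBasis n Iᶜ * extBasis n J) = 0 := by
  by_cases h : Disjoint Iᶜ J
  · obtain ⟨ε, hε⟩ := extBasis_mul_of_disjoint h
    have hJI : J ⊆ I := by simpa using h.symm.le_compl_right
    have hne : Iᶜ ∪ J ≠ Finset.univ := fun hu => hJ <| hJI.antisymm fun i hi => by
      simpa [hi] using hu.ge (Finset.mem_univ i)
    rw [hε, topCoeff_smul, topCoeff_extBasis, if_neg hne, mul_zero]
  · rw [extBasis_mul_of_not_disjoint h]
    exact map_zero (topCoeffₗ n)

theorem exists_forall_topPairing_eq (I : Finset (Fin (n * 2))) :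
    ∃ ψ : Coeff n, ∀ φ : Coeff n, topPairing n φ ψ = φ I := by
  obtain ⟨ε, hε⟩ := extBasis_mul_of_disjoint (disjoint_compl_left (a := I))
  refine ⟨((ε : ℤ) : ℂ) • coeff n (extBasis n Iᶜ), fun φ => ?_⟩
  rw [map_smul, topPairing_apply, LinearEquiv.symm_apply_apply, coeff_symm_eq_sum, Finset.mul_sum,
    ← topCoeffₗ_apply, map_sum, Finset.sum_eq_single I]
  · rw [mul_smul_comm, hε, topCoeffₗ_apply, topCoeff_smul, topCoeff_smul, topCoeff_extBasis,
      if_pos (by rw [Finset.union_comm, Finset.union_compl]), mul_one, smul_eq_mul, mul_left_comm,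
      ← Int.cast_mul, Int.units_coe_mul_self, Int.cast_one, mul_one]
  · intro J _ hJ
    rw [mul_smul_comm, topCoeffₗ_apply, topCoeff_smul, topCoeff_extBasis_compl_mul hJ, mul_zero]
  · simp

theorem topCoeff_ιMulti (v : Fin (n * 2) → Fin (n * 2) → ℂ) :
    topCoeff (ExteriorAlgebra.ιMulti ℂ (n * 2) v : Ext n) = (Matrix.of v).det := by
  let b := Pi.basisFun ℂ (Fin (n * 2))
  have hid : Set.powersetCard.ofFinEmbEquiv.symm (⟨Finset.univ, by simp⟩ :
      Set.powersetCard (Fin (n * 2)) (n * 2)) = RelEmbedding.refl _ := by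
    rw [Equiv.symm_apply_eq]
    ext j
    exact iff_of_true (Finset.mem_univ j)
      ((Set.powersetCard.mem_ofFinEmbEquiv_iff_mem_range _ j).2 ⟨j, rfl⟩)
  have hb : ExteriorAlgebra.ιMulti ℂ (n * 2) b = extBasis n Finset.univ := by
    rw [extBasis, ExteriorAlgebra.basis_apply_ofCard _ (n := n * 2) (by simp),
      ExteriorAlgebra.ιMulti_family]
    refine congrArg _ (funext fun j => ?_)
    rw [Function.comp_apply, Set.powersetCard.ofCard, hid]
    rfl
  have hdet := congrArg (fun f => f v) (AlternatingMap.eq_smul_basis_det b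
    ((topCoeffₗ n).compAlternatingMap (ExteriorAlgebra.ιMulti ℂ (n * 2))))
  simpa only [LinearMap.compAlternatingMap_apply, AlternatingMap.smul_apply, hb, topCoeffₗ_apply,
    topCoeff_extBasis, if_true, one_smul, b, Pi.basisFun_det_apply] using hdet

theorem prod_elem_eq_ιMulti (η : Fin n → Fin n → ℍ[ℝ]) :
    (List.ofFn fun i => elem (η i)).prod = ExteriorAlgebra.ιMulti ℂ (n * 2)
      (fun j : Fin (n * 2) => pullbackVec (η j.divNat) j.modNat) := by
  rw [ExteriorAlgebra.ιMulti_apply, List.ofFn_mul, List.prod_flatten, List.map_ofFn]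
  refine congrArg (fun f => (List.ofFn f).prod) (funext fun i => ?_)
  have hidx (s : Fin 2) :
      (⟨i.1 * 2 + s.1, by omega⟩ : Fin (n * 2)) = finProdFinEquiv (i, s) :=
    Fin.ext (by simp [finProdFinEquiv]; ring)
  simp only [Function.comp_apply, hidx, divNat_finProdFinEquiv, modNat_finProdFinEquiv]
  simp [elem, pullback_eq_ι]

theorem topCoeff_prod_elem (η : Fin n → Fin n → ℍ[ℝ]) :
    topCoeff (List.ofFn fun i => elem (η i)).prod = (tauMatrix (.of η)).det := by
  rw [prod_elem_eq_ιMulti, topCoeff_ιMulti, ← Matrix.det_submatrix_equiv_self finProdFinEquiv]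
  congr 1
  ext ⟨i, s⟩ ⟨j, t⟩
  simp only [Matrix.submatrix_apply, Matrix.of_apply, pullbackVec, divNat_finProdFinEquiv,
    modNat_finProdFinEquiv, tauMatrix_apply]

theorem topCoeff_nonneg_of_mem_SP {w : Ext n} (hw : w ∈ SP n n) : 0 ≤ topCoeff w := by
  rw [← topCoeffₗ_apply]
  rw [SP_eq_span] at hw
  induction hw using Submodule.span_induction with
  | mem w hw =>
    obtain ⟨η, rfl⟩ := hw
    exact (det_tauMatrix_nonneg (.of η)).trans_eq (topCoeff_prod_elem η).symm
  | zero => simp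
  | add a b _ _ ha hb => rw [map_add]; exact add_nonneg ha hb
  | smul c a _ ha =>
    rw [← algebraMap_smul ℂ c a, map_smul]
    exact mul_nonneg (show (0 : ℂ) ≤ ((c : ℝ) : ℂ) by exact_mod_cast c.2) ha

/-! ### Complex combinations of strongly positive elements -/

/-- The complex span of the strongly positive elements of degree `2m`; it turns out to contain all
elements of that degree. -/
def spanSP (n m : ℕ) : Submodule ℂ (Ext n) := Submodule.span ℂ (SP n m)

theorem polar_mem_spanSP (η ζ : Fin n → ℍ[ℝ]) :
    pullback η 0 * pullback ζ 1 + pullback ζ 0 * pullback η 1 ∈ spanSP n 1 := by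
  have mem (ξ : Fin n → ℍ[ℝ]) : elem ξ ∈ spanSP n 1 := Submodule.subset_span (elem_mem_SP ξ)
  rw [← add_sub_cancel_left (elem η + elem ζ)
    (pullback η 0 * pullback ζ 1 + pullback ζ 0 * pullback η 1), ← elem_add]
  exact sub_mem (mem _) (add_mem (mem _) (mem _))

theorem polar_single_mem_spanSP (l l' : Fin n) (M : Matrix (Fin 2) (Fin 2) ℂ) :
    (∑ s, M 0 s • omega (finProdFinEquiv (l, s))) * omega (finProdFinEquiv (l', 1)) +
      omega (finProdFinEquiv (l', 0)) * ∑ s, M 1 s • omega (finProdFinEquiv (l, s)) ∈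
        spanSP n 1 := by
  have hM : M ∈ Submodule.span ℂ (range tau) := by rw [span_range_tau]; trivial
  induction hM using Submodule.span_induction with
  | mem M hM =>
    obtain ⟨a, rfl⟩ := hM
    rw [← pullback_single, ← pullback_single, ← pullback_single_one, ← pullback_single_one]
    exact polar_mem_spanSP (Pi.single l a) (Pi.single l' 1)
  | zero => simp
  | add A B _ _ hA hB =>
    convert add_mem hA hB using 1
    simp only [Matrix.add_apply, add_smul, Finset.sum_add_distrib, add_mul, mul_add]
    abel
  | smul c A _ hA =>
    convert Submodule.smul_mem _ c hA using 1
    simp only [Matrix.smul_apply, smul_eq_mul, mul_smul, ← Finset.smul_sum, smul_mul_assoc,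
      mul_smul_comm, smul_add]

theorem omega_mul_omega_mem_spanSP (i j : Fin (n * 2)) : omega i * omega j ∈ spanSP n 1 := by
  obtain ⟨⟨l, s⟩, rfl⟩ := finProdFinEquiv.surjective i
  obtain ⟨⟨l', t⟩, rfl⟩ := finProdFinEquiv.surjective j
  have mem_of_left (l l' : Fin n) (t : Fin 2) :
      omega (finProdFinEquiv (l, 0)) * omega (finProdFinEquiv (l', t)) ∈ spanSP n 1 := by
    simpa [Matrix.single_apply, ite_and, ite_smul] using
      polar_single_mem_spanSP l' l (.single 1 t 1)
  have mem_of_right (l l' : Fin n) (s : Fin 2) :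
      omega (finProdFinEquiv (l, s)) * omega (finProdFinEquiv (l', 1)) ∈ spanSP n 1 := by
    simpa [Matrix.single_apply, ite_and, ite_smul] using
      polar_single_mem_spanSP l l' (.single 0 s 1)
  fin_cases s
  · exact mem_of_left l l' t
  fin_cases t
  · have hswap := ExteriorAlgebra.ι_add_mul_swap (R := ℂ)
      (Pi.single (finProdFinEquiv (l, (1 : Fin 2))) 1 : Fin (n * 2) → ℂ)
      (Pi.single (finProdFinEquiv (l', (0 : Fin 2))) 1)
    exact eq_neg_of_add_eq_zero_left hswap ▸ neg_mem (mem_of_left l' l 1)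
  · exact mem_of_right l l' 1

theorem exteriorPower_two_le_spanSP : ⋀[ℂ]^2 (Fin (n * 2) → ℂ) ≤ spanSP n 1 := by
  rw [ExteriorAlgebra.exteriorPower, pow_two, Submodule.mul_le]
  rintro _ ⟨v, rfl⟩ _ ⟨w, rfl⟩
  simp only [ι_eq_sum_omega v, ι_eq_sum_omega w, Finset.sum_mul_sum, smul_mul_smul_comm]
  exact Submodule.sum_mem _ fun i _ => Submodule.sum_mem _ fun j _ =>
    Submodule.smul_mem _ _ (omega_mul_omega_mem_spanSP i j)

theorem exteriorPower_two_mul_le_spanSP (m : ℕ) :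
    ⋀[ℂ]^(2 * m) (Fin (n * 2) → ℂ) ≤ spanSP n m := by
  have spanSP_pow_le : spanSP n 1 ^ m ≤ spanSP n m := by
    induction m with
    | zero =>
      rw [pow_zero, Submodule.one_le]
      exact Submodule.subset_span (SetLike.one_mem_graded (SP n))
    | succ m ih =>
      rw [pow_succ]
      refine (mul_le_mul_left ih _).trans ?_
      rw [spanSP, spanSP, Submodule.span_mul_span]
      exact Submodule.span_mono
        (Set.mul_subset_iff.2 fun v hv w hw => SetLike.mul_mem_graded hv hw)
  rw [ExteriorAlgebra.exteriorPower, pow_mul]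
  exact (pow_le_pow_left' exteriorPower_two_le_spanSP m).trans spanSP_pow_le

/-! ### Degrees -/

/-- The elements of `∧ ℂ²ⁿ` without component of degree `p`. -/
def degCompl (n p : ℕ) : Submodule ℂ (Ext n) := ⨆ q ≠ p, ⋀[ℂ]^q (Fin (n * 2) → ℂ)

theorem ι_mul_mem_degCompl {p : ℕ} (v : Fin (n * 2) → ℂ) {w : Ext n} (hw : w ∈ degCompl n p) :
    ExteriorAlgebra.ι ℂ v * w ∈ degCompl n (p + 1) := by
  suffices degCompl n p ≤ (degCompl n (p + 1)).comap (LinearMap.mulLeft ℂ (.ι ℂ v)) from this hw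
  refine iSup₂_le fun q hq w hw => ?_
  have hv : ExteriorAlgebra.ι ℂ v ∈ ⋀[ℂ]^1 (Fin (n * 2) → ℂ) := by
    rw [ExteriorAlgebra.exteriorPower, pow_one]
    exact ⟨v, rfl⟩
  have hvw : ExteriorAlgebra.ι ℂ v * w ∈ ⋀[ℂ]^(1 + q) (Fin (n * 2) → ℂ) :=
    SetLike.mul_mem_graded hv hw
  exact le_iSup₂ (f := fun q (_ : q ≠ p + 1) => ⋀[ℂ]^q (Fin (n * 2) → ℂ)) (1 + q) (by omega) hvw

theorem mem_degCompl_iff {p : ℕ} {w : Ext n} :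
    w ∈ degCompl n p ↔ ∀ I : Finset (Fin (n * 2)), I.card = p → coeff n w I = 0 := by
  refine ⟨fun hw I hI => ?_, fun h => ?_⟩
  · suffices degCompl n p ≤ LinearMap.ker (LinearMap.proj I ∘ₗ (coeff n).toLinearMap) from this hw
    exact iSup₂_le fun q hq w hw => coeff_eq_zero_of_mem_exteriorPower hw (hI.trans_ne hq.symm)
  · rw [← (coeff n).symm_apply_apply w, coeff_symm_eq_sum]
    refine Submodule.sum_mem _ fun I _ => ?_
    by_cases hI : I.card = p
    · simp [h I hI]
    · exact Submodule.smul_mem _ _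
        (le_iSup₂ (f := fun q (_ : q ≠ p) => ⋀[ℂ]^q (Fin (n * 2) → ℂ)) I.card hI
          (extBasis_mem_exteriorPower I))

theorem topCoeff_eq_zero_of_mem_degCompl {w : Ext n} (hw : w ∈ degCompl n (2 * n)) :
    topCoeff w = 0 :=
  mem_degCompl_iff.1 hw _ (by simp [mul_comm])

/-! ### Quaternionic coordinates -/

/-- The identification of `ℍⁿ ≅ ℝ⁴ⁿ` with the right quaternionic module `ℍ × ⋯ × ℍ`. -/
def quatCoords (n : ℕ) : HSpace n ≃ₗ[ℝ] (Fin n → ℍ[ℝ]) where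
  toFun x l := ⟨x (l, 0), x (l, 1), x (l, 2), x (l, 3)⟩
  invFun := ofQuat
  map_add' _ _ := rfl
  map_smul' _ _ := rfl
  left_inv x := by ext ⟨l, a⟩; fin_cases a <;> rfl
  right_inv _ := rfl

@[simp] theorem quatOf_re (t : EuclideanSpace ℝ (Fin 4)) : (quatOf t).re = t 0 := rfl

@[simp] theorem quatOf_imI (t : EuclideanSpace ℝ (Fin 4)) : (quatOf t).imI = t 1 := rfl

@[simp] theorem quatOf_imJ (t : EuclideanSpace ℝ (Fin 4)) : (quatOf t).imJ = t 2 := rfl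

@[simp] theorem quatOf_imK (t : EuclideanSpace ℝ (Fin 4)) : (quatOf t).imK = t 3 := rfl

theorem quatCoords_apply (x : HSpace n) (l : Fin n) :
    quatCoords n x l = quatOf (WithLp.toLp 2 fun a => x (l, a)) := rfl

/-- The right scalar multiplication `(b, t) ↦ b t` of `ℍⁿ`, as a real bilinear map. -/
def hmulₗ (n : ℕ) : HSpace n →ₗ[ℝ] EuclideanSpace ℝ (Fin 4) →ₗ[ℝ] HSpace n :=
  LinearMap.mk₂ ℝ (fun b t => (quatCoords n).symm fun l => quatCoords n b l * quatOf t)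
    (fun b b' t => by
      rw [← map_add]; congr 1; ext l : 1; simp only [map_add, Pi.add_apply, add_mul])
    (fun c b t => by
      rw [← map_smul]; congr 1; ext l : 1; simp only [map_smul, Pi.smul_apply, smul_mul_assoc])
    (fun b t t' => by
      rw [← map_add]; congr 1; ext l : 1; exact mul_add (quatCoords n b l) (quatOf t) (quatOf t'))
    (fun c b t => by
      rw [← map_smul]; congr 1; ext l : 1; exact mul_smul_comm c (quatCoords n b l) (quatOf t))

theorem quatCoords_hmulₗ (b : HSpace n) (t : EuclideanSpace ℝ (Fin 4)) (l : Fin n) :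
    quatCoords n (hmulₗ n b t) l = quatCoords n b l * quatOf t := rfl

theorem inner_eq_sum_re (x y : HSpace n) :
    inner ℝ x y = ∑ l, (quatCoords n x l * star (quatCoords n y l)).re := by
  rw [PiLp.inner_apply, Fintype.sum_prod_type]
  refine Finset.sum_congr rfl fun l _ => ?_
  simp [Fin.sum_univ_four, quatCoords_apply, mul_comm]

theorem norm_sq_eq_sum_normSq (x : HSpace n) :
    ‖x‖ ^ 2 = ∑ l, Quaternion.normSq (quatCoords n x l) := by
  rw [← real_inner_self_eq_norm_sq, inner_eq_sum_re]
  rfl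

theorem normSq_quatOf (t : EuclideanSpace ℝ (Fin 4)) :
    Quaternion.normSq (quatOf t) = ‖t‖ ^ 2 := by
  rw [EuclideanSpace.norm_sq_eq, Quaternion.normSq_def']
  simp [Fin.sum_univ_four]

theorem norm_hmulₗ (b : HSpace n) (t : EuclideanSpace ℝ (Fin 4)) :
    ‖hmulₗ n b t‖ = ‖b‖ * ‖t‖ := by
  have h : ‖hmulₗ n b t‖ ^ 2 = (‖b‖ * ‖t‖) ^ 2 := by
    simp only [mul_pow, norm_sq_eq_sum_normSq, quatCoords_hmulₗ, map_mul, normSq_quatOf,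
      Finset.sum_mul]
  exact (sq_eq_sq₀ (norm_nonneg _) (by positivity)).1 h

/-- The right scalar multiplication `(b, t) ↦ b t` of `ℍⁿ`, as a continuous bilinear map. -/
def hmul (n : ℕ) : HSpace n →L[ℝ] EuclideanSpace ℝ (Fin 4) →L[ℝ] HSpace n :=
  (hmulₗ n).mkContinuous₂ 1 fun b t => by rw [one_mul, norm_hmulₗ]

theorem quatCoords_hmul (b : HSpace n) (t : EuclideanSpace ℝ (Fin 4)) (l : Fin n) :
    quatCoords n (hmul n b t) l = quatCoords n b l * quatOf t := rfl

theorem norm_hmul (b : HSpace n) (t : EuclideanSpace ℝ (Fin 4)) : ‖hmul n b t‖ = ‖b‖ * ‖t‖ :=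
  norm_hmulₗ b t

theorem rightLine_quatCoords (x b : HSpace n) (t : EuclideanSpace ℝ (Fin 4)) :
    rightLine (quatCoords n x) (quatCoords n b) t = x + hmul n b t := by
  apply (quatCoords n).injective
  rw [map_add]
  rfl

/-! ### Quaternionic Hessians -/

theorem wedgeLeft_apply (a : Ext n) (φ : Coeff n) :
    wedgeLeft a φ = coeff n (a * (coeff n).symm φ) := rfl

theorem wedgeLeft_wedgeLeft (a b : Ext n) (φ : Coeff n) :
    wedgeLeft a (wedgeLeft b φ) = wedgeLeft (a * b) φ := by
  simp [wedgeLeft_apply, mul_assoc]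

theorem wedgeLeft_smul (c : ℂ) (a : Ext n) (φ : Coeff n) :
    wedgeLeft (c • a) φ = c • wedgeLeft a φ := by
  simp [wedgeLeft_apply]

theorem wedgeLeft_sum {ι : Type*} (s : Finset ι) (a : ι → Ext n) (φ : Coeff n) :
    wedgeLeft (∑ i ∈ s, a i) φ = ∑ i ∈ s, wedgeLeft (a i) φ := by
  simp [wedgeLeft_apply, Finset.sum_mul]

/-- The quaternion units `1, i, j, k`. -/
def unitQ (a : Fin 4) : ℍ[ℝ] := quatOf (EuclideanSpace.single a 1)

/-- The right `ℍ`-linear map `q ↦ ē q_l`, `e` being the `a`-th quaternion unit, for `p = (l, a)`.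
Its pull-backs `η^* ω̃^α` collect the coefficients of `∂/∂x_p` in `d_α`. -/
def covec (p : Fin n × Fin 4) : Fin n → ℍ[ℝ] := Pi.single p.1 (star (unitQ p.2))

theorem normSq_unitQ (a : Fin 4) : Quaternion.normSq (unitQ a) = 1 := by
  simp [unitQ, normSq_quatOf]

theorem nablaCoeff_eq_tau (s α : Fin 2) (a : Fin 4) :
    nablaCoeff s α a = tau (star (unitQ a)) α s := by
  fin_cases s <;> fin_cases α <;> fin_cases a <;> simp [nablaCoeff, tau, unitQ]

theorem dForm_eq_sum_fderiv (α : Fin 2) (F : HSpace n → Coeff n) (x : HSpace n) :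
    dForm α F x = ∑ p : Fin n × Fin 4,
      wedgeLeft (pullback (covec p) α) (fderiv ℝ F x (EuclideanSpace.single p 1)) := by
  rw [dForm, ← finProdFinEquiv.sum_comp, Fintype.sum_prod_type, Fintype.sum_prod_type]
  refine Finset.sum_congr rfl fun l _ => ?_
  simp only [nabla, divNat_finProdFinEquiv, modNat_finProdFinEquiv, map_sum, covec,
    pullback_single, wedgeLeft_sum, wedgeLeft_smul, map_smul, nablaCoeff_eq_tau, dir]
  exact Finset.sum_comm

/-- The right `ℍ`-linear map `q ↦ ∑ v̄_l q_l`, `v̄` being the quaternionic conjugate of `v`. -/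
def conjQ (v : Fin n × Fin 4 → ℝ) : Fin n → ℍ[ℝ] := ∑ p, v p • covec p

theorem conjQ_apply (v : Fin n × Fin 4 → ℝ) (l : Fin n) :
    conjQ v l = star (quatCoords n (WithLp.toLp 2 v) l) := by
  simp only [conjQ, covec, Fintype.sum_prod_type, Finset.sum_apply, Pi.smul_apply,
    Pi.single_apply, smul_ite, smul_zero]
  rw [Finset.sum_eq_single l (fun b _ hb => by simp [hb.symm]) (by simp)]
  ext <;> simp [Fin.sum_univ_four, unitQ, quatCoords_apply]

/-- The form `∑ A_{pq} (∇_0 x_p) ∧ (∇_1 x_q)`; for the real Hessian matrix `A` of a function `u`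
this is `△u`. -/
def hessForm : Matrix (Fin n × Fin 4) (Fin n × Fin 4) ℝ →ₗ[ℝ] Ext n where
  toFun A := ∑ p, ∑ q, (A p q : ℂ) • (pullback (covec p) 0 * pullback (covec q) 1)
  map_add' A B := by
    simp only [Matrix.add_apply, Complex.ofReal_add, add_smul, Finset.sum_add_distrib]
  map_smul' c A := by
    simp only [Matrix.smul_apply, smul_eq_mul, Complex.ofReal_mul, mul_smul, Finset.smul_sum,
      RingHom.id_apply, Complex.coe_smul c]

theorem hessForm_apply (A : Matrix (Fin n × Fin 4) (Fin n × Fin 4) ℝ) :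
    hessForm A = ∑ p, ∑ q, (A p q : ℂ) • (pullback (covec p) 0 * pullback (covec q) 1) := rfl

theorem hessForm_vecMulVec (v : Fin n × Fin 4 → ℝ) :
    hessForm (Matrix.vecMulVec v v) = elem (conjQ v) := by
  simp only [elem, conjQ, pullback_sum, pullback_real_smul, Finset.sum_mul, Finset.mul_sum,
    hessForm_apply, smul_mul_smul_comm, Matrix.vecMulVec_apply, Complex.ofReal_mul]
  exact Finset.sum_comm

/-- The matrix of the right multiplication of `ℍⁿ` by the `a`-th quaternion unit. -/
def rmulMatrix (n : ℕ) (a : Fin 4) : Matrix (Fin n × Fin 4) (Fin n × Fin 4) ℝ :=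
  Matrix.of fun p q => hmul n (EuclideanSpace.single q 1) (EuclideanSpace.single a 1) p

theorem rmulMatrix_mulVec (a : Fin 4) (b : Fin n × Fin 4 → ℝ) :
    rmulMatrix n a *ᵥ b = hmul n (WithLp.toLp 2 b) (EuclideanSpace.single a 1) := by
  have hb : WithLp.toLp 2 b = ∑ q, b q • (EuclideanSpace.single q 1 : HSpace n) := by
    ext p; simp [Pi.single_apply]
  ext p
  simp [hb, rmulMatrix, Matrix.mulVec, dotProduct, mul_comm]

theorem toLp_vecMul_rmulMatrix (a : Fin 4) (v : Fin n × Fin 4 → ℝ) :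
    WithLp.toLp 2 (v ᵥ* rmulMatrix n a) = (quatCoords n).symm fun l =>
      quatCoords n (WithLp.toLp 2 v) l * star (unitQ a) := by
  set w := (quatCoords n).symm fun l => quatCoords n (WithLp.toLp 2 v) l * star (unitQ a) with hw
  ext q
  calc (v ᵥ* rmulMatrix n a) q
      = inner ℝ (hmul n (EuclideanSpace.single q 1) (EuclideanSpace.single a 1))
          (WithLp.toLp 2 v) := by
        simp [Matrix.vecMul, dotProduct, rmulMatrix, PiLp.inner_apply]
    _ = inner ℝ (EuclideanSpace.single q 1) w := by
        simp only [inner_eq_sum_re, hw, quatCoords_hmul, LinearEquiv.apply_symm_apply, star_mul,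
          star_star, mul_assoc, unitQ]
    _ = w q := by simp [EuclideanSpace.inner_single_left]

theorem conjQ_vecMul_rmulMatrix (a : Fin 4) (v : Fin n × Fin 4 → ℝ) :
    conjQ (v ᵥ* rmulMatrix n a) = unitQ a • conjQ v := by
  ext l : 1
  rw [Pi.smul_apply, conjQ_apply, conjQ_apply, toLp_vecMul_rmulMatrix,
    LinearEquiv.apply_symm_apply, star_mul, star_star, smul_eq_mul]

theorem mem_span_vecMulVec_self_of_isSymm {ι R : Type*} [Finite ι] [CommRing R]
    [Invertible (2 : R)] {A : Matrix ι ι R} (hA : A.IsSymm) :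
    A ∈ Submodule.span R (Set.range fun v : ι → R => Matrix.vecMulVec v v) := by
  classical
  have := Fintype.ofFinite ι
  have hmem (v : ι → R) : Matrix.vecMulVec v v ∈
      Submodule.span R (Set.range fun v : ι → R => Matrix.vecMulVec v v) :=
    Submodule.subset_span (mem_range_self v)
  have hpolar (p q : ι) : Matrix.single p q (1 : R) + Matrix.single q p 1 =
      Matrix.vecMulVec (Pi.single p 1 + Pi.single q 1) (Pi.single p 1 + Pi.single q 1) -
        Matrix.vecMulVec (Pi.single p 1) (Pi.single p 1) -
        Matrix.vecMulVec (Pi.single q 1) (Pi.single q 1) := by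
    simp only [Matrix.add_vecMulVec, Matrix.vecMulVec_add,
      ← Matrix.single_eq_single_vecMulVec_single]
    abel
  have hsum : A = ⅟(2 : R) • ∑ p, ∑ q, A p q • (Matrix.single p q 1 + Matrix.single q p 1) := by
    have h : ∑ p, ∑ q, A p q • Matrix.single p q (1 : R) = A := by
      simpa [Matrix.smul_single] using (Matrix.matrix_eq_sum_single A).symm
    have h' : ∑ p, ∑ q, A p q • Matrix.single q p (1 : R) = A := by
      rw [Finset.sum_comm]; simpa only [hA.apply] using h
    simp only [smul_add, Finset.sum_add_distrib, h, h']
    rw [← smul_add, ← two_smul R A, smul_smul, invOf_mul_self, one_smul]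
  rw [hsum]
  refine Submodule.smul_mem _ _ (Submodule.sum_mem _ fun p _ => Submodule.sum_mem _ fun q _ =>
    Submodule.smul_mem _ _ ?_)
  rw [hpolar]
  exact sub_mem (sub_mem (hmem _) (hmem _)) (hmem _)

theorem hessForm_transpose_mul_mul {A : Matrix (Fin n × Fin 4) (Fin n × Fin 4) ℝ} (hA : A.IsSymm)
    (a : Fin 4) : hessForm ((rmulMatrix n a)ᵀ * A * rmulMatrix n a) = hessForm A := by
  have hspan := mem_span_vecMulVec_self_of_isSymm hA
  clear hA
  induction hspan using Submodule.span_induction with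
  | mem _ h =>
    obtain ⟨v, rfl⟩ := h
    rw [Matrix.mul_vecMulVec, Matrix.vecMulVec_mul, Matrix.mulVec_transpose, hessForm_vecMulVec,
      hessForm_vecMulVec, conjQ_vecMul_rmulMatrix, elem_smul, normSq_unitQ, Complex.ofReal_one,
      one_smul]
  | zero => simp
  | add A B _ _ hA hB => rw [Matrix.mul_add, Matrix.add_mul, map_add, map_add, hA, hB]
  | smul c A _ hA => rw [Matrix.mul_smul, Matrix.smul_mul, map_smul, map_smul, hA]

open scoped MatrixOrder in
theorem hessForm_mem_SP_of_posSemidef {A : Matrix (Fin n × Fin 4) (Fin n × Fin 4) ℝ}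
    (hA : A.PosSemidef) : hessForm A ∈ SP n 1 := by
  obtain ⟨B, rfl⟩ := CStarAlgebra.nonneg_iff_eq_star_mul_self.1 hA.nonneg
  have h : star B * B = ∑ i, Matrix.vecMulVec (B i) (B i) := by
    ext p q
    simp [Matrix.mul_apply, Matrix.sum_apply, Matrix.vecMulVec_apply]
  rw [h, map_sum]
  exact Submodule.sum_mem _ fun i _ => hessForm_vecMulVec (B i) ▸ elem_mem_SP _

/-- The form attached to `A` only depends on the sum of the transforms of `A` under the right
multiplications by the units `1, i, j, k`, so only this sum has to be positive. -/
theorem hessForm_mem_SP {A : Matrix (Fin n × Fin 4) (Fin n × Fin 4) ℝ} (hA : A.IsSymm)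
    (h : ∀ b, 0 ≤ ∑ a, (rmulMatrix n a *ᵥ b) ⬝ᵥ A *ᵥ (rmulMatrix n a *ᵥ b)) :
    hessForm A ∈ SP n 1 := by
  set Q := ∑ a, (rmulMatrix n a)ᵀ * A * rmulMatrix n a with hQ
  have hQA : hessForm Q = (4 : ℂ) • hessForm A := by
    simp [hQ, hessForm_transpose_mul_mul hA, ← Nat.cast_smul_eq_nsmul ℂ]
  have hQpos : Q.PosSemidef := by
    refine Matrix.PosSemidef.of_dotProduct_mulVec_nonneg ?_ fun b => (h b).trans_eq ?_
    · simp [Matrix.IsHermitian, hQ, Matrix.transpose_sum, Matrix.transpose_mul, hA.eq,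
        Matrix.mul_assoc]
    · rw [hQ, Matrix.sum_mulVec, dotProduct_sum]
      refine Finset.sum_congr rfl fun a _ => ?_
      rw [star_trivial, ← Matrix.mulVec_mulVec, ← Matrix.mulVec_mulVec,
        Matrix.dotProduct_mulVec _ _ (A *ᵥ _), Matrix.vecMul_transpose]
  have h4 := smul_mem_SP (c := 1 / 4) (by positivity) (hessForm_mem_SP_of_posSemidef hQpos)
  rwa [hQA, smul_smul, one_div_mul_cancel four_ne_zero, one_smul] at h4

theorem conjQ_single (p : Fin n × Fin 4) : conjQ (Pi.single p 1) = covec p := by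
  rw [conjQ, Finset.sum_eq_single p (fun q _ hq => by simp [hq]) (by simp)]
  simp

theorem hessForm_one :
    hessForm (1 : Matrix (Fin n × Fin 4) (Fin n × Fin 4) ℝ) = (4 : ℂ) • beta n := by
  have h : (1 : Matrix (Fin n × Fin 4) (Fin n × Fin 4) ℝ) =
      ∑ p, Matrix.vecMulVec (Pi.single p 1) (Pi.single p 1) := by
    simp only [← Matrix.single_eq_single_vecMulVec_single]
    ext p q
    simp [Matrix.sum_apply, Matrix.one_apply, Matrix.single_apply, ite_and]
  have hcovec (p : Fin n × Fin 4) : elem (covec p) = elem (Pi.single p.1 1) := by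
    have : covec p = star (unitQ p.2) • (Pi.single p.1 1 : Fin n → ℍ[ℝ]) := by
      rw [← Pi.single_smul, smul_eq_mul, mul_one, covec]
    rw [this, elem_smul, Quaternion.normSq_star, normSq_unitQ, Complex.ofReal_one, one_smul]
  rw [h, map_sum, beta_eq_sum_elem, Fintype.sum_prod_type, Finset.smul_sum]
  simp [hessForm_vecMulVec, conjQ_single, hcovec, ← Nat.cast_smul_eq_nsmul ℂ]

variable {Ω : Opens (HSpace n)}

/-! ### Partial derivatives and test forms -/

section PartialDerivatives

variable {ι E F : Type*} [DecidableEq ι] [NormedAddCommGroup E] [NormedSpace ℝ E]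
  [NormedAddCommGroup F] [NormedSpace ℝ F]

/-- The partial derivative of `f` with respect to the coordinate `x_p`. -/
def pd (p : ι) (f : EuclideanSpace ℝ ι → E) (x : EuclideanSpace ℝ ι) : E :=
  fderiv ℝ f x (EuclideanSpace.single p 1)

theorem pd_congr {f g : EuclideanSpace ℝ ι → E} {x : EuclideanSpace ℝ ι} (h : f =ᶠ[𝓝 x] g)
    (p : ι) : pd p f =ᶠ[𝓝 x] pd p g := by
  filter_upwards [h.fderiv (𝕜 := ℝ)] with y hy
  rw [pd, pd, hy]

section Finite

variable [Finite ι]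

theorem pd_smul [NormedSpace ℂ E] [IsScalarTower ℝ ℂ E] {g : EuclideanSpace ℝ ι → ℂ}
    {f : EuclideanSpace ℝ ι → E} {x : EuclideanSpace ℝ ι} (hg : DifferentiableAt ℝ g x)
    (hf : DifferentiableAt ℝ f x) (p : ι) :
    pd p (fun y => g y • f y) x = pd p g x • f x + g x • pd p f x := by
  have := Fintype.ofFinite ι
  simp [pd, fderiv_fun_smul hg hf, add_comm]

theorem pd_clm (L : E →L[ℝ] F) {f : EuclideanSpace ℝ ι → E} {x : EuclideanSpace ℝ ι}
    (hf : DifferentiableAt ℝ f x) (p : ι) : pd p (fun y => L (f y)) x = L (pd p f x) := by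
  have := Fintype.ofFinite ι
  simp [pd, fderiv_fun_comp x L.differentiableAt hf]

theorem pd_sum {κ : Type*} {s : Finset κ} {f : κ → EuclideanSpace ℝ ι → E}
    {x : EuclideanSpace ℝ ι} (hf : ∀ i ∈ s, DifferentiableAt ℝ (f i) x) (p : ι) :
    pd p (fun y => ∑ i ∈ s, f i y) x = ∑ i ∈ s, pd p (f i) x := by
  have := Fintype.ofFinite ι
  simp [pd, fderiv_fun_sum hf]

theorem pd_ofReal {u : EuclideanSpace ℝ ι → ℝ} (hu : Differentiable ℝ u) (p : ι) :
    pd p (fun y => (u y : ℂ)) = fun x => ((pd p u x : ℝ) : ℂ) :=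
  funext fun x => pd_clm Complex.ofRealCLM (hu x) p

end Finite

variable [Fintype ι]

theorem contDiffAt_pd {k : ℕ} (p : ι) {f : EuclideanSpace ℝ ι → E} {x : EuclideanSpace ℝ ι}
    (hf : ContDiffAt ℝ (k + 1 : ℕ) f x) : ContDiffAt ℝ k (pd p f) x :=
  (hf.fderiv_right (m := k) (by norm_cast)).clm_apply contDiffAt_const

theorem contDiff_pd (p : ι) {f : EuclideanSpace ℝ ι → E} (hf : ContDiff ℝ ∞ f) :
    ContDiff ℝ ∞ (pd p f) :=
  (hf.fderiv_right (m := ∞) (by simp)).clm_apply contDiff_const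

theorem pd_comm {f : EuclideanSpace ℝ ι → E} {x : EuclideanSpace ℝ ι} (hf : ContDiffAt ℝ 2 f x)
    (p q : ι) : pd p (pd q f) x = pd q (pd p f) x := by
  have hd : DifferentiableAt ℝ (fderiv ℝ f) x :=
    (hf.fderiv_right (m := 1) (by norm_num)).differentiableAt one_ne_zero
  have h (p q : ι) : pd p (pd q f) x =
      fderiv ℝ (fderiv ℝ f) x (EuclideanSpace.single p 1) (EuclideanSpace.single q 1) := by
    change fderiv ℝ (fun y => fderiv ℝ f y (EuclideanSpace.single q 1)) x _ = _
    simp [fderiv_clm_apply hd (differentiableAt_const _)]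
  rw [h, h]
  exact (hf.isSymmSndFDerivAt (by simp)).eq _ _

theorem integral_pd_eq_zero {f : EuclideanSpace ℝ ι → E} (hf : ContDiff ℝ 1 f)
    (hf' : HasCompactSupport f) (p : ι) : ∫ x, pd p f x = 0 := by
  have hcont : Continuous (pd p f) :=
    ((hf.fderiv_right (m := 0) (by norm_num)).clm_apply contDiff_const).continuous
  have hint : Integrable (fun x => (1 : ℝ) • pd p f x) := by
    simp only [one_smul]
    exact hcont.integrable_of_hasCompactSupport (hf'.fderiv_apply ℝ _)
  have h := integral_smul_fderiv_eq_neg_fderiv_smul_of_integrable (𝕜 := ℝ)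
    (f := fun _ => 1) (by simp) hint
    (by simpa only [one_smul] using hf.continuous.integrable_of_hasCompactSupport hf')
    (by simp) fun x _ => hf.differentiable one_ne_zero x
  simpa [pd] using h

end PartialDerivatives

theorem ι_mul_ι_swap {R M : Type*} [CommRing R] [AddCommGroup M] [Module R M] (v w : M) :
    ExteriorAlgebra.ι R v * ExteriorAlgebra.ι R w =
      -(ExteriorAlgebra.ι R w * ExteriorAlgebra.ι R v) :=
  eq_neg_of_add_eq_zero_left (ExteriorAlgebra.ι_add_mul_swap v w)

theorem wedgeLeft_one (φ : Coeff n) : wedgeLeft (1 : Ext n) φ = φ := by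
  simp [wedgeLeft_apply]

theorem wedgeLeft_neg (a : Ext n) (φ : Coeff n) : wedgeLeft (-a) φ = -wedgeLeft a φ := by
  simp [wedgeLeft_apply]

theorem differentiable_wedgeLeft (a : Ext n) : Differentiable ℝ (wedgeLeft a) :=
  ((wedgeLeft a).restrictScalars ℝ).differentiable

theorem pd_wedgeLeft (a : Ext n) {F : HSpace n → Coeff n} {x : HSpace n}
    (hF : DifferentiableAt ℝ F x) (p : Fin n × Fin 4) :
    pd p (fun y => wedgeLeft a (F y)) x = wedgeLeft a (pd p F x) :=
  pd_clm ((wedgeLeft a).restrictScalars ℝ) hF p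

theorem differentiable_testForm (η : TestForm Ω) : Differentiable ℝ η :=
  η.contDiff.differentiable (by simp)

theorem dTest_apply_eq_sum_pd (α : Fin 2) (η : TestForm Ω) (x : HSpace n) :
    dTest Ω α η x = ∑ p, wedgeLeft (pullback (covec p) α) (pd p η x) := by
  rw [dTest_apply, dForm_eq_sum_fderiv]
  rfl

theorem sum_wedgeLeft_pd_sum_wedgeLeft {G : Fin n × Fin 4 → HSpace n → Coeff n} {x : HSpace n}
    (hG : ∀ q, DifferentiableAt ℝ (G q) x) (α γ : Fin 2) :
    ∑ p, wedgeLeft (pullback (covec p) α)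
        (pd p (fun y => ∑ q, wedgeLeft (pullback (covec q) γ) (G q y)) x) =
      ∑ p, ∑ q, wedgeLeft (pullback (covec p) α * pullback (covec q) γ) (pd p (G q) x) := by
  have hd (q : Fin n × Fin 4) :
      DifferentiableAt ℝ (fun y => wedgeLeft (pullback (covec q) γ) (G q y)) x :=
    (differentiable_wedgeLeft _).differentiableAt.comp x (hG q)
  simp only [pd_sum fun q _ => hd q, map_sum, pd_wedgeLeft _ (hG _), wedgeLeft_wedgeLeft]

theorem dTest_dTest_apply (α γ : Fin 2) (η : TestForm Ω) (x : HSpace n) :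
    dTest Ω α (dTest Ω γ η) x = ∑ p, ∑ q,
      wedgeLeft (pullback (covec p) α * pullback (covec q) γ) (pd p (pd q η) x) := by
  rw [dTest_apply_eq_sum_pd, funext (dTest_apply_eq_sum_pd γ η)]
  exact sum_wedgeLeft_pd_sum_wedgeLeft
    (fun q => (contDiff_pd q η.contDiff).differentiable (by simp) x) α γ

theorem dTest_dTest_swap (α γ : Fin 2) (η : TestForm Ω) :
    dTest Ω α (dTest Ω γ η) = -dTest Ω γ (dTest Ω α η) := by
  ext1 x
  simp only [neg_apply, dTest_dTest_apply, ← Finset.sum_neg_distrib]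
  rw [Finset.sum_comm]
  refine Finset.sum_congr rfl fun p _ => Finset.sum_congr rfl fun q _ => ?_
  rw [pd_comm (η.contDiff.contDiffAt.of_le ENat.LEInfty.out), pullback_eq_ι, pullback_eq_ι,
    ι_mul_ι_swap, wedgeLeft_neg]

theorem dTest_dTest_self (α : Fin 2) (η : TestForm Ω) : dTest Ω α (dTest Ω α η) = 0 := by
  ext1 x
  exact self_eq_neg.1 (DFunLike.congr_fun (dTest_dTest_swap α α η) x)

theorem dTest_mem_degCompl {p : ℕ} (α : Fin 2) {η : TestForm Ω}
    (hη : ∀ x, (coeff n).symm (η x) ∈ degCompl n p) (x : HSpace n) :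
    (coeff n).symm (dTest Ω α η x) ∈ degCompl n (p + 1) := by
  rw [dTest_apply_eq_sum_pd, map_sum]
  refine Submodule.sum_mem _ fun q _ => ?_
  rw [wedgeLeft_apply, LinearEquiv.symm_apply_apply, pullback_eq_ι]
  refine ι_mul_mem_degCompl _ (mem_degCompl_iff.2 fun I hI => ?_)
  have hηI : (fun y => η y I) = fun _ => 0 :=
    funext fun y => by simpa using mem_degCompl_iff.1 (hη y) I hI
  have hpd : pd q (fun y => η y I) x = pd q η x I :=
    pd_clm (ContinuousLinearMap.proj (R := ℝ) (φ := fun _ => ℂ) I) (differentiable_testForm η x) q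
  rw [LinearEquiv.apply_symm_apply, ← hpd, hηI]
  simp [pd]

/-! ### Products of test forms with smooth functions -/

/-- The test form `g w ∧ η`, for a smooth function `g` and a constant element `w` of `∧ ℂ²ⁿ`. -/
def mulTest (g : HSpace n → ℂ) (hg : ContDiff ℝ ∞ g) (w : Ext n) (η : TestForm Ω) : TestForm Ω where
  toFun x := g x • wedgeLeft w (η x)
  contDiff' := hg.smul (((wedgeLeft w).restrictScalars ℝ).contDiff.comp η.contDiff)
  hasCompactSupport' := η.hasCompactSupport.mono fun x hx h =>
    hx (show g x • wedgeLeft w (η x) = 0 by rw [h, map_zero, smul_zero])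
  tsupport_subset' := Subset.trans (closure_mono (Function.support_subset_iff'.2 fun x hx => by
    rw [Function.notMem_support.1 hx, map_zero, smul_zero])) η.tsupport_subset

theorem mulTest_apply (g : HSpace n → ℂ) (hg : ContDiff ℝ ∞ g) (w : Ext n) (η : TestForm Ω)
    (x : HSpace n) : mulTest g hg w η x = g x • wedgeLeft w (η x) := rfl

theorem mulTest_neg (g : HSpace n → ℂ) (hg : ContDiff ℝ ∞ g) (w : Ext n) (η : TestForm Ω) :
    mulTest g hg (-w) η = -mulTest g hg w η := by
  ext1 x
  simp only [neg_apply, mulTest_apply, wedgeLeft_neg, smul_neg]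

theorem pd_mulTest {g : HSpace n → ℂ} (hg : ContDiff ℝ ∞ g) (w : Ext n) (η : TestForm Ω)
    (p : Fin n × Fin 4) (x : HSpace n) : pd p (mulTest g hg w η) x =
      pd p g x • wedgeLeft w (η x) + g x • wedgeLeft w (pd p η x) := by
  rw [← pd_wedgeLeft w (differentiable_testForm η x)]
  exact pd_smul (hg.differentiable (by simp) x)
    ((differentiable_wedgeLeft w).differentiableAt.comp x (differentiable_testForm η x)) p

theorem dTest_mulTest_one (α : Fin 2) (g : HSpace n → ℂ) (hg : ContDiff ℝ ∞ g) (η : TestForm Ω) :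
    dTest Ω α (mulTest g hg 1 η) =
      ∑ p, mulTest (pd p g) (contDiff_pd p hg) (pullback (covec p) α) η +
        mulTest g hg 1 (dTest Ω α η) := by
  ext1 x
  simp only [add_apply, sum_apply, mulTest_apply, dTest_apply_eq_sum_pd, pd_mulTest, map_add,
    map_smul, wedgeLeft_one, Finset.smul_sum, Finset.sum_add_distrib]

theorem dTest_mulTest_ι (α : Fin 2) (g : HSpace n → ℂ) (hg : ContDiff ℝ ∞ g)
    (v : Fin (n * 2) → ℂ) (η : TestForm Ω) :
    dTest Ω α (mulTest g hg (ExteriorAlgebra.ι ℂ v) η) =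
      ∑ p, mulTest (pd p g) (contDiff_pd p hg) (pullback (covec p) α * ExteriorAlgebra.ι ℂ v) η -
        mulTest g hg (ExteriorAlgebra.ι ℂ v) (dTest Ω α η) := by
  ext1 x
  simp only [sub_apply, sum_apply, mulTest_apply, dTest_apply_eq_sum_pd, pd_mulTest, map_add,
    map_smul, map_sum, wedgeLeft_wedgeLeft, Finset.smul_sum, ← Finset.sum_sub_distrib]
  refine Finset.sum_congr rfl fun p _ => ?_
  rw [pullback_eq_ι, ι_mul_ι_swap v, wedgeLeft_neg, smul_neg, sub_neg_eq_add]

/-- The real Hessian matrix of `u` at `x`. -/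
def hessMatrix (u : HSpace n → ℝ) (x : HSpace n) : Matrix (Fin n × Fin 4) (Fin n × Fin 4) ℝ :=
  .of fun p q => pd p (pd q u) x

theorem hessMatrix_isSymm {u : HSpace n → ℝ} {x : HSpace n} (hu : ContDiffAt ℝ 2 u x) :
    (hessMatrix u x).IsSymm := by
  ext p q
  exact pd_comm hu q p

theorem contDiff_ofReal_comp {u : HSpace n → ℝ} (hu : ContDiff ℝ ∞ u) :
    ContDiff ℝ ∞ fun x => (u x : ℂ) :=
  Complex.ofRealCLM.contDiff.comp hu

theorem contDiff_hessMatrix {u : HSpace n → ℝ} (hu : ContDiff ℝ ∞ u) (p q : Fin n × Fin 4) :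
    ContDiff ℝ ∞ fun x => hessMatrix u x p q :=
  contDiff_pd p (contDiff_pd q hu)

/-- The test form `△u ∧ η`. -/
def bastonMul (u : HSpace n → ℝ) (hu : ContDiff ℝ ∞ u) (η : TestForm Ω) : TestForm Ω :=
  ∑ p, ∑ q, mulTest (fun x => (hessMatrix u x p q : ℂ))
    (contDiff_ofReal_comp (contDiff_hessMatrix hu p q))
    (pullback (covec p) 0 * pullback (covec q) 1) η

theorem bastonMul_apply (u : HSpace n → ℝ) (hu : ContDiff ℝ ∞ u) (η : TestForm Ω) (x : HSpace n) :
    bastonMul u hu η x = wedgeLeft (hessForm (hessMatrix u x)) (η x) := by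
  simp only [bastonMul, sum_apply, mulTest_apply, hessForm_apply, wedgeLeft_sum, wedgeLeft_smul]

theorem baston_eq_hessForm {u : HSpace n → ℝ} {x : HSpace n} (hu : ContDiffAt ℝ 2 u x) :
    baston u x = hessForm (hessMatrix u x) := by
  let L : ℝ →L[ℝ] Coeff n := ContinuousLinearMap.toSpanSingleton ℝ (coeff n 1)
  have hL (c : ℝ) : L c = (c : ℂ) • coeff n 1 := by
    ext I
    simp [L]
  have hzero : zeroForm u = fun y => L (u y) := by
    ext1 y
    rw [hL, zeroForm, Algebra.algebraMap_eq_smul_one, map_smul]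
  have hd (q : Fin n × Fin 4) : DifferentiableAt ℝ (pd q u) x :=
    (contDiffAt_pd (k := 1) q hu).differentiableAt one_ne_zero
  have hd₁ : dForm 1 (zeroForm u) =ᶠ[𝓝 x] fun y =>
      ∑ q, wedgeLeft (pullback (covec q) 1) (L (pd q u y)) := by
    filter_upwards [hu.eventually (by simp)] with y hy
    rw [dForm_eq_sum_fderiv, hzero]
    exact Finset.sum_congr rfl fun q _ =>
      congrArg _ (pd_clm L (hy.differentiableAt two_ne_zero) q)
  have hd₀ : dForm 0 (dForm 1 (zeroForm u)) x = ∑ p, ∑ q,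
      wedgeLeft (pullback (covec p) 0 * pullback (covec q) 1) (L (pd p (pd q u) x)) := by
    have hLd (q : Fin n × Fin 4) : DifferentiableAt ℝ (fun y => L (pd q u y)) x :=
      L.differentiableAt.comp x (hd q)
    simp only [← pd_clm L (hd _)]
    rw [← sum_wedgeLeft_pd_sum_wedgeLeft hLd, dForm_eq_sum_fderiv]
    exact Finset.sum_congr rfl fun p _ => congrArg _ (pd_congr hd₁ p).eq_of_nhds
  rw [baston, hd₀, LinearEquiv.symm_apply_eq, hessForm_apply]
  simp only [map_sum, hL, map_smul, wedgeLeft_apply, LinearEquiv.symm_apply_apply, mul_one]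
  rfl

/-! ### Closed currents -/

/-- Closed currents: `d_0 T = d_1 T = 0`. -/
def Current.IsClosed (T : Current Ω) : Prop := ∀ (α : Fin 2) (η : TestForm Ω), T (dTest Ω α η) = 0

theorem Current.baston_apply (T : Current Ω) (η : TestForm Ω) :
    T.baston η = T (dTest Ω 0 (dTest Ω 1 η)) := rfl

theorem Current.isClosed_baston (T : Current Ω) : T.baston.IsClosed := by
  intro α η
  rw [Current.baston_apply]
  fin_cases α
  · change T (dTest Ω 0 (dTest Ω 1 (dTest Ω 0 η))) = 0
    rw [dTest_dTest_swap 1 0, map_neg, dTest_dTest_self, neg_zero, map_zero]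
  · change T (dTest Ω 0 (dTest Ω 1 (dTest Ω 1 η))) = 0
    rw [dTest_dTest_self, map_zero, map_zero]

theorem Current.isClosed_one : (Current.one Ω).IsClosed := by
  intro α η
  rw [Current.one, Current.ofMeasure, TestFunction.integralAgainstBilinCLM_eq_integral
    ((locallyIntegrable_const _).locallyIntegrableOn _)]
  let B (p : Fin n × Fin 4) : Coeff n →L[ℝ] ℂ :=
    (((topPairing n).flip (coeff n 1)).comp (wedgeLeft (pullback (covec p) α))).restrictScalars ℝ
  have hcontDiff (p : Fin n × Fin 4) : ContDiff ℝ ∞ fun x => B p (η x) :=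
    (B p).contDiff.comp η.contDiff
  have hsupp (p : Fin n × Fin 4) : HasCompactSupport fun x => B p (η x) :=
    η.hasCompactSupport.comp_left (map_zero (B p))
  have hB (x : HSpace n) :
      topPairing n (dTest Ω α η x) (coeff n 1) = ∑ p, pd p (fun y => B p (η y)) x := by
    rw [dTest_apply_eq_sum_pd, map_sum, sum_apply]
    exact Finset.sum_congr rfl fun p _ => (pd_clm (B p) (differentiable_testForm η x) p).symm
  have hint (p : Fin n × Fin 4) : Integrable (pd p fun y => B p (η y)) :=
    (contDiff_pd p (hcontDiff p)).continuous.integrable_of_hasCompactSupport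
      ((hsupp p).fderiv_apply ℝ _)
  simp only [hB]
  rw [integral_finsetSum _ fun p _ => hint p]
  exact Finset.sum_eq_zero fun p _ =>
    integral_pd_eq_zero ((hcontDiff p).of_le ENat.LEInfty.out) (hsupp p) p

/-- Integrating by parts twice against a closed current moves `△` from `η` to `u`. -/
theorem Current.IsClosed.apply_mul_baston {T : Current Ω} (hT : T.IsClosed) {u : HSpace n → ℝ}
    (hu : ContDiff ℝ ∞ u) (η : TestForm Ω) :
    T (mulTest (fun x => (u x : ℂ)) (contDiff_ofReal_comp hu) 1 (dTest Ω 0 (dTest Ω 1 η))) =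
      T (bastonMul u hu η) := by
  let g : HSpace n → ℂ := fun x => (u x : ℂ)
  have hg : ContDiff ℝ ∞ g := contDiff_ofReal_comp hu
  have hpd₂ (p q : Fin n × Fin 4) : pd q (pd p g) = fun x => (hessMatrix u x p q : ℂ) := by
    simp only [g]
    rw [pd_ofReal (hu.differentiable (by simp)),
      pd_ofReal ((contDiff_pd p hu).differentiable (by simp))]
    exact funext fun x =>
      congrArg _ (pd_comm (hu.contDiffAt.of_le ENat.LEInfty.out) q p)
  have hfirst : T (mulTest g hg 1 (dTest Ω 0 (dTest Ω 1 η))) =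
      -∑ p, T (mulTest (pd p g) (contDiff_pd p hg) (pullback (covec p) 0) (dTest Ω 1 η)) := by
    have h := hT 0 (mulTest g hg 1 (dTest Ω 1 η))
    rwa [dTest_mulTest_one, map_add, map_sum, add_comm, ← eq_neg_iff_add_eq_zero] at h
  have hsecond (p : Fin n × Fin 4) :
      T (mulTest (pd p g) (contDiff_pd p hg) (pullback (covec p) 0) (dTest Ω 1 η)) =
        ∑ q, T (mulTest (pd q (pd p g)) (contDiff_pd q (contDiff_pd p hg))
          (pullback (covec q) 1 * pullback (covec p) 0) η) := by
    have h := hT 1 (mulTest (pd p g) (contDiff_pd p hg) (pullback (covec p) 0) η)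
    rw [pullback_eq_ι, dTest_mulTest_ι, map_sub, map_sum, sub_eq_zero] at h
    rw [pullback_eq_ι, ← h]
  have hswap (p q : Fin n × Fin 4) : pullback (covec q) 1 * pullback (covec p) 0 =
      -(pullback (covec p) 0 * pullback (covec q) 1) := by
    rw [pullback_eq_ι, pullback_eq_ι, ι_mul_ι_swap]
  rw [hfirst]
  simp only [hsecond, hswap, hpd₂, mulTest_neg, map_neg, Finset.sum_neg_distrib, neg_neg,
    bastonMul, map_sum]

/-- Currents which only depend on the component of degree `p` of the test form. -/
def Current.HasDim (p : ℕ) (T : Current Ω) : Prop :=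
  ∀ η : TestForm Ω, (∀ x, (coeff n).symm (η x) ∈ degCompl n p) → T η = 0

/-! ### Lebesgue points of plurisubharmonic functions -/

theorem lintegral_le_lintegral_hmul {t : EuclideanSpace ℝ (Fin 4)} (ht0 : t ≠ 0) (ht1 : ‖t‖ ≤ 1)
    {F : HSpace n → ℝ≥0∞} (hF : Measurable F) : ∫⁻ z, F z ≤ ∫⁻ b, F (hmul n b t) := by
  have ht : 0 < ‖t‖ := norm_pos_iff.2 ht0
  let U : HSpace n ≃ₗᵢ[ℝ] HSpace n := LinearIsometry.toLinearIsometryEquiv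
    ⟨(hmulₗ n).flip (‖t‖⁻¹ • t), fun b => (norm_hmul b _).trans (by
      rw [norm_smul, norm_inv, norm_norm, inv_mul_cancel₀ ht.ne', mul_one])⟩ rfl
  have hU : ∀ b, U (‖t‖ • b) = hmul n b t := fun b => by
    change hmul n (‖t‖ • b) (‖t‖⁻¹ • t) = hmul n b t
    simp only [map_smul, _root_.smul_apply, smul_smul, inv_mul_cancel₀ ht.ne', one_smul]
  have hscale : 1 ≤ ENNReal.ofReal |(‖t‖ ^ Module.finrank ℝ (HSpace n))⁻¹| := by
    rw [ENNReal.one_le_ofReal, abs_of_nonneg (by positivity)]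
    exact (one_le_inv₀ (by positivity)).2 (pow_le_one₀ ht.le ht1)
  calc ∫⁻ z, F z ≤ ENNReal.ofReal |(‖t‖ ^ Module.finrank ℝ (HSpace n))⁻¹| * ∫⁻ z, F z :=
        le_mul_of_one_le_left zero_le hscale
    _ = ENNReal.ofReal |(‖t‖ ^ Module.finrank ℝ (HSpace n))⁻¹| * ∫⁻ b, F (U b) := by
        rw [U.measurePreserving.lintegral_comp hF]
    _ = ∫⁻ b, F (U b) ∂Measure.map (‖t‖ • ·) volume := by
        rw [Measure.map_addHaar_smul _ ht.ne', lintegral_smul_measure, smul_eq_mul]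
    _ = ∫⁻ b, F (hmul n b t) := by
        rw [lintegral_map (f := fun b => F (U b)) (hF.comp U.continuous.measurable)
          (measurable_const_smul _)]
        simp only [hU]

theorem setLIntegral_closedBall_le_hmul {t : EuclideanSpace ℝ (Fin 4)} (ht1 : ‖t‖ ≤ 1)
    (ht2 : 1 / 2 ≤ ‖t‖) {F : HSpace n → ℝ≥0∞} (hF : Measurable F) (x : HSpace n) (r : ℝ) :
    ∫⁻ y in Metric.closedBall x r, F y ≤
      ∫⁻ b in Metric.closedBall (0 : HSpace n) (2 * r), F (x + hmul n b t) := by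
  have ht0 : t ≠ 0 := fun h => by norm_num [h] at ht2
  let G : HSpace n → ℝ≥0∞ := indicator (Metric.closedBall x r) F
  have hG : Measurable G := hF.indicator measurableSet_closedBall
  rw [← lintegral_indicator measurableSet_closedBall,
    ← lintegral_indicator measurableSet_closedBall, ← lintegral_add_left_eq_self _ x]
  refine (lintegral_le_lintegral_hmul ht0 ht1 (hG.comp (measurable_const_add x))).trans
    (lintegral_mono fun b => ?_)
  by_cases hb : x + hmul n b t ∈ Metric.closedBall x r
  · have hb' : b ∈ Metric.closedBall (0 : HSpace n) (2 * r) := by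
      rw [Metric.mem_closedBall, dist_eq_norm, add_sub_cancel_left, norm_hmul] at hb
      rw [mem_closedBall_zero_iff]
      nlinarith [norm_nonneg b]
    simp only [Function.comp_apply, G, indicator_of_mem hb, indicator_of_mem hb', le_refl]
  · simp only [Function.comp_apply, G, indicator_of_notMem hb, zero_le]

theorem lintegral_enorm_le_of_le {α : Type*} [MeasurableSpace α] {ν : Measure α} [IsFiniteMeasure ν]
    {f : α → ℝ} {ε : ℝ} (hf : Integrable f ν) (hle : ∀ᵐ x ∂ν, f x ≤ ε) (hε : 0 ≤ ε)
    (h0 : 0 ≤ ∫ x, f x ∂ν) : ∫⁻ x, ‖f x‖ₑ ∂ν ≤ ENNReal.ofReal (2 * ε) * ν univ := by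
  have habs : ∫ x, ‖f x‖ ∂ν ≤ ∫ x, (2 * ε - f x) ∂ν := by
    refine integral_mono_ae hf.norm ((integrable_const _).sub hf) ?_
    filter_upwards [hle] with x hx
    rw [Real.norm_eq_abs, abs_le]
    constructor <;> linarith
  rw [integral_sub (integrable_const _) hf, integral_const, smul_eq_mul] at habs
  calc ∫⁻ x, ‖f x‖ₑ ∂ν = ENNReal.ofReal (∫ x, ‖f x‖ ∂ν) :=
        (ofReal_integral_norm_eq_lintegral_enorm hf).symm
    _ ≤ ENNReal.ofReal (2 * ε * ν.real univ) := ENNReal.ofReal_le_ofReal (by linarith)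
    _ = ENNReal.ofReal (2 * ε) * ν univ := by
        rw [ENNReal.ofReal_mul (by positivity), ofReal_measureReal]

theorem le_setAverage_iff {α : Type*} [MeasurableSpace α] {ν : Measure α} {s : Set α}
    (hs0 : ν s ≠ 0) (hs : ν s ≠ ⊤) {f : α → ℝ} {c : ℝ} :
    c ≤ ⨍ x in s, f x ∂ν ↔ c * ν.real s ≤ ∫ x in s, f x ∂ν := by
  rw [setAverage_eq, smul_eq_mul, ← div_eq_inv_mul, le_div_iff₀]
  exact ENNReal.toReal_pos hs0 hs

theorem volume_closedBall_mul {ι : Type*} [Fintype ι] (x y : EuclideanSpace ℝ ι) {s : ℝ}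
    (hs : 0 < s) (r : ℝ) : volume (Metric.closedBall x (s * r)) =
      ENNReal.ofReal (s ^ Fintype.card ι) * volume (Metric.closedBall y r) := by
  rw [Measure.addHaar_closedBall_mul_of_pos _ _ hs, ← Measure.addHaar_closedBall_center _ y,
    finrank_euclideanSpace]

namespace IsPSH

variable {u : HSpace n → ℝ} {x b : HSpace n} {r : ℝ}

theorem integrableOn_line (hu : IsPSH Ω u) (hb : ‖b‖ ≤ r) (hx : Metric.closedBall x r ⊆ Ω) :
    IntegrableOn (fun t => u (x + hmul n b t)) (Metric.closedBall 0 1) ∧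
      u x ≤ ⨍ t in Metric.closedBall 0 1, u (x + hmul n b t) := by
  have hsub : Metric.closedBall (0 : EuclideanSpace ℝ (Fin 4)) 1 ⊆
      {t | rightLine (quatCoords n x) (quatCoords n b) t ∈ Ω} := by
    intro t ht
    rw [mem_closedBall_zero_iff] at ht
    refine hx ?_
    rw [rightLine_quatCoords, Metric.mem_closedBall, dist_eq_norm, add_sub_cancel_left, norm_hmul]
    exact (mul_le_of_le_one_right (norm_nonneg b) ht).trans hb
  have h := hu.subharmonic (quatCoords n x) (quatCoords n b)
  have hint := h.integrableOn 0 1 one_pos hsub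
  have hle := h.le_average 0 1 one_pos hsub
  simp only [rightLine_quatCoords, map_zero, add_zero] at hint hle
  exact ⟨hint, hle⟩

theorem lintegral_line_le (hu : IsPSH Ω u) (hb : ‖b‖ ≤ r) (hx : Metric.closedBall x r ⊆ Ω) {ε : ℝ}
    (hε : 0 ≤ ε) (hle : ∀ y ∈ Metric.closedBall x r, u y ≤ u x + ε) :
    ∫⁻ t in Metric.closedBall 0 1, ‖u (x + hmul n b t) - u x‖ₑ ≤
      ENNReal.ofReal (2 * ε) * volume (Metric.closedBall (0 : EuclideanSpace ℝ (Fin 4)) 1) := by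
  obtain ⟨hint, hmean⟩ := hu.integrableOn_line hb hx
  rw [le_setAverage_iff (Metric.measure_closedBall_pos _ _ one_pos).ne'
    measure_closedBall_lt_top.ne] at hmean
  rw [← Measure.restrict_apply_univ]
  have : IsFiniteMeasure
      (volume.restrict (Metric.closedBall (0 : EuclideanSpace ℝ (Fin 4)) 1)) :=
    isFiniteMeasure_restrict.2 measure_closedBall_lt_top.ne
  refine lintegral_enorm_le_of_le (hint.sub (integrable_const _)) ?_ hε ?_
  · filter_upwards [ae_restrict_mem measurableSet_closedBall] with t ht
    rw [mem_closedBall_zero_iff] at ht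
    refine sub_le_iff_le_add'.2 (hle _ ?_)
    rw [Metric.mem_closedBall, dist_eq_norm, add_sub_cancel_left, norm_hmul]
    exact (mul_le_of_le_one_right (norm_nonneg b) ht).trans hb
  · rw [integral_sub hint (integrable_const _), setIntegral_const, smul_eq_mul, mul_comm]
    linarith

/-- Averaging the estimate on the lines `t ↦ x + b t` over `b` gives one on balls around `x`: for
`t` in the ball of centre `3/4` and radius `1/4`, the map `b ↦ x + b t` does not increase
volumes, and its image of the ball of radius `2r` covers the ball of radius `r`. -/
theorem lintegral_closedBall_le (hu : IsPSH Ω u) (hm : Measurable u)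
    (hx : Metric.closedBall x (2 * r) ⊆ Ω) {ε : ℝ} (hε : 0 ≤ ε)
    (hle : ∀ y ∈ Metric.closedBall x (2 * r), u y ≤ u x + ε) :
    ∫⁻ y in Metric.closedBall x r, ‖u y - u x‖ₑ ≤
      ENNReal.ofReal (4 ^ 4 * 2 ^ Fintype.card (Fin n × Fin 4) * (2 * ε)) *
        volume (Metric.closedBall x r) := by
  let c : EuclideanSpace ℝ (Fin 4) := EuclideanSpace.single 0 (3 / 4)
  have hc : ‖c‖ = 3 / 4 := by simp [c]
  have hA : ∀ t ∈ Metric.closedBall c (1 / 4), ‖t‖ ≤ 1 ∧ 1 / 2 ≤ ‖t‖ := fun t ht => by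
    rw [mem_closedBall_iff_norm] at ht
    constructor
    · linarith [norm_sub_norm_le t c]
    · linarith [norm_sub_norm_le c t, norm_sub_rev t c]
  have hAB : Metric.closedBall c (1 / 4) ⊆ Metric.closedBall 0 1 := fun t ht =>
    mem_closedBall_zero_iff.2 (hA t ht).1
  have hF : Measurable fun y => ‖u y - u x‖ₑ := (hm.sub_const _).enorm
  have hB : volume (Metric.closedBall (0 : EuclideanSpace ℝ (Fin 4)) 1) =
      ENNReal.ofReal (4 ^ 4) * volume (Metric.closedBall c (1 / 4)) := by
    have h := volume_closedBall_mul 0 c (by norm_num : (0 : ℝ) < 4) (1 / 4)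
    rwa [Fintype.card_fin, mul_one_div_cancel four_ne_zero] at h
  refine (ENNReal.mul_le_mul_iff_left (Metric.measure_closedBall_pos volume c (by norm_num)).ne'
    (measure_closedBall_lt_top (x := c) (r := 1 / 4)).ne).1 ?_
  calc (∫⁻ y in Metric.closedBall x r, ‖u y - u x‖ₑ) * volume (Metric.closedBall c (1 / 4))
      = ∫⁻ _ in Metric.closedBall c (1 / 4), ∫⁻ y in Metric.closedBall x r, ‖u y - u x‖ₑ :=
        (setLIntegral_const _ _).symm
    _ ≤ ∫⁻ t in Metric.closedBall c (1 / 4), ∫⁻ b in Metric.closedBall (0 : HSpace n) (2 * r),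
          ‖u (x + hmul n b t) - u x‖ₑ :=
        setLIntegral_mono' measurableSet_closedBall fun t ht =>
          setLIntegral_closedBall_le_hmul (hA t ht).1 (hA t ht).2 hF x r
    _ ≤ ∫⁻ t in Metric.closedBall 0 1, ∫⁻ b in Metric.closedBall (0 : HSpace n) (2 * r),
          ‖u (x + hmul n b t) - u x‖ₑ := lintegral_mono_set hAB
    _ = ∫⁻ b in Metric.closedBall (0 : HSpace n) (2 * r), ∫⁻ t in Metric.closedBall 0 1,
          ‖u (x + hmul n b t) - u x‖ₑ := by
        refine (lintegral_lintegral_swap ?_).symm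
        exact (hF.comp ((hmul n).continuous₂.measurable.const_add x)).aemeasurable
    _ ≤ ∫⁻ _ in Metric.closedBall (0 : HSpace n) (2 * r),
          ENNReal.ofReal (2 * ε) * volume (Metric.closedBall (0 : EuclideanSpace ℝ (Fin 4)) 1) :=
        setLIntegral_mono' measurableSet_closedBall fun b hb =>
          hu.lintegral_line_le (mem_closedBall_zero_iff.1 hb) hx hε hle
    _ = _ := by
        rw [setLIntegral_const, hB, volume_closedBall_mul 0 x two_pos,
          ENNReal.ofReal_mul (q := 2 * ε) (by positivity),
          ENNReal.ofReal_mul (q := 2 ^ Fintype.card (Fin n × Fin 4)) (by positivity)]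
        ring_nf

theorem tendsto_setAverage (hu : IsPSH Ω u) (hm : Measurable u) (hx : x ∈ Ω) :
    Filter.Tendsto (fun r => ⨍ y in Metric.closedBall x r, ‖u y - u x‖) (𝓝[>] 0) (𝓝 0) := by
  let C : ℝ := 4 ^ 4 * 2 ^ Fintype.card (Fin n × Fin 4) * 2
  have hC : 0 < C := by positivity
  rw [Metric.tendsto_nhds]
  intro ε hε
  have hlt : ∀ᶠ y in 𝓝 x, y ∈ Ω ∧ u y < u x + ε / (2 * C) := by
    have husc := hu.usc x hx (u x + ε / (2 * C))
      (lt_add_of_pos_right _ (div_pos hε (mul_pos two_pos hC)))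
    rw [Ω.isOpen.nhdsWithin_eq hx] at husc
    exact (Filter.Eventually.and (Ω.isOpen.mem_nhds hx) husc)
  obtain ⟨R, hR, hball⟩ := Metric.nhds_basis_closedBall.eventually_iff.1 hlt
  filter_upwards [Ioc_mem_nhdsGT (half_pos hR)] with r hr
  have hsub : Metric.closedBall x (2 * r) ⊆ Metric.closedBall x R :=
    Metric.closedBall_subset_closedBall (by linarith [hr.2])
  have hL1 := hu.lintegral_closedBall_le hm (fun y hy => (hball (hsub hy)).1)
    (by positivity : 0 ≤ ε / (2 * C)) fun y hy => (hball (hsub hy)).2.le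
  have hV : 0 < volume.real (Metric.closedBall x r) :=
    ENNReal.toReal_pos (Metric.measure_closedBall_pos _ _ hr.1).ne' measure_closedBall_lt_top.ne
  have hint : ∫ y in Metric.closedBall x r, ‖u y - u x‖ ≤
      ε / 2 * volume.real (Metric.closedBall x r) := by
    rw [integral_norm_eq_lintegral_enorm (hm.sub_const _).aestronglyMeasurable]
    refine ENNReal.toReal_le_of_le_ofReal (by positivity) (hL1.trans_eq ?_)
    have hε2 : 4 ^ 4 * 2 ^ Fintype.card (Fin n × Fin 4) * (2 * (ε / (2 * C))) = ε / 2 := by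
      simp only [C]
      field_simp
    rw [hε2, ENNReal.ofReal_mul (p := ε / 2) (by positivity),
      ofReal_measureReal measure_closedBall_lt_top.ne]
  rw [dist_zero_right, setAverage_eq, smul_eq_mul, ← div_eq_inv_mul, Real.norm_of_nonneg
    (div_nonneg (integral_nonneg fun _ => norm_nonneg _) hV.le), div_lt_iff₀ hV]
  exact hint.trans_lt ((mul_lt_mul_iff_left₀ hV).2 (half_lt_self hε))

end IsPSH

/-! ### Second order consequences of the sub-mean value inequality -/

theorem taylor_two_isLittleO {E F : Type*} [NormedAddCommGroup E] [NormedSpace ℝ E]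
    [NormedAddCommGroup F] [NormedSpace ℝ F] {f : E → F} {x : E} (hf : ContDiffAt ℝ 2 f x) :
    (fun y => f y - f x - fderiv ℝ f x (y - x) -
        (1 / 2 : ℝ) • fderiv ℝ (fderiv ℝ f) x (y - x) (y - x)) =o[𝓝 x] fun y => ‖y - x‖ ^ 2 := by
  set D := fderiv ℝ (fderiv ℝ f) x
  have hsymm : ∀ v w, D v w = D w v := (hf.isSymmSndFDerivAt (by simp)).eq
  have hD : HasFDerivAt (fderiv ℝ f) D x :=
    ((hf.fderiv_right (m := 1) (by norm_num)).differentiableAt one_ne_zero).hasFDerivAt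
  have hdiff : ∀ᶠ y in 𝓝 x, DifferentiableAt ℝ f y :=
    (hf.eventually (by simp)).mono fun y hy => hy.differentiableAt two_ne_zero
  obtain ⟨δ, hδ, hball⟩ := Metric.eventually_nhds_iff_ball.1 hdiff
  let g : E → F := fun y => f y - fderiv ℝ f x (y - x) - (1 / 2 : ℝ) • D (y - x) (y - x)
  have hg : ∀ y ∈ Metric.ball x δ, HasFDerivWithinAt g
      (fderiv ℝ f y - fderiv ℝ f x - D (y - x)) (Metric.ball x δ) y := by
    intro y hy
    have hsub : HasFDerivAt (fun y : E => y - x) (ContinuousLinearMap.id ℝ E) y :=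
      (hasFDerivAt_id y).sub_const x
    have hlin := (fderiv ℝ f x).hasFDerivAt.comp y hsub
    have hquad := ((D.hasFDerivAt.comp y hsub).clm_apply hsub).const_smul (1 / 2 : ℝ)
    refine ((((hball y hy).hasFDerivAt.sub hlin).sub hquad).congr_fderiv ?_).hasFDerivWithinAt
    ext w
    have hw : D w (y - x) = D (y - x) w := hsymm _ _
    simp only [ContinuousLinearMap.comp_id, Function.comp_apply, _root_.sub_apply,
      _root_.smul_apply, _root_.add_apply, ContinuousLinearMap.flip_apply, hw, ← two_smul ℝ,
      smul_smul]
    norm_num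
  have h := (convex_ball x δ).isLittleO_pow_succ (Metric.mem_ball_self hδ) hg (n := 1) (by
    simpa only [pow_one] using (hD.isLittleO.mono nhdsWithin_le_nhds).norm_right)
  rw [Metric.isOpen_ball.nhdsWithin_eq (Metric.mem_ball_self hδ)] at h
  refine h.congr_left fun y => ?_
  simp only [g, sub_self, map_zero, smul_zero, sub_zero]
  abel

section BallMoments

variable {ι : Type*} [Fintype ι]

theorem setIntegral_closedBall_comp {F : Type*} [NormedAddCommGroup F] [NormedSpace ℝ F]
    (T : EuclideanSpace ℝ ι ≃ₗᵢ[ℝ] EuclideanSpace ℝ ι) (r : ℝ) (f : EuclideanSpace ℝ ι → F) :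
    ∫ t in Metric.closedBall 0 r, f (T t) = ∫ t in Metric.closedBall 0 r, f t := by
  have h := T.measurePreserving.setIntegral_preimage_emb T.toHomeomorph.measurableEmbedding f
    (Metric.closedBall 0 r)
  rwa [T.preimage_closedBall, map_zero] at h

theorem setIntegral_closedBall_linear (ℓ : EuclideanSpace ℝ ι →L[ℝ] ℝ) (r : ℝ) :
    ∫ t in Metric.closedBall 0 r, ℓ t = 0 := by
  have h := setIntegral_closedBall_comp (.neg ℝ (E := EuclideanSpace ℝ ι)) r ℓ
  simp only [LinearIsometryEquiv.coe_neg, map_neg, integral_neg] at h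
  exact self_eq_neg.1 h.symm

theorem setIntegral_closedBall_norm_sq_pos [Nonempty ι] {r : ℝ} (hr : 0 < r) :
    0 < ∫ t : EuclideanSpace ℝ ι in Metric.closedBall 0 r, ‖t‖ ^ 2 := by
  refine (setIntegral_pos_iff_support_of_nonneg_ae
    (Filter.Eventually.of_forall fun t => sq_nonneg ‖t‖)
    ((continuous_norm.pow 2).continuousOn.integrableOn_compact (isCompact_closedBall 0 r))).2 ?_
  have hsupp : (Function.support fun t : EuclideanSpace ℝ ι => ‖t‖ ^ 2) = {0}ᶜ := by
    ext t
    simp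
  rw [hsupp, inter_comm, ← sdiff_eq, measure_sdiff_null (measure_singleton 0)]
  exact Metric.measure_closedBall_pos _ _ hr

theorem setIntegral_closedBall_mul_of_ne {i j : ι} (hij : i ≠ j) (r : ℝ) :
    ∫ t : EuclideanSpace ℝ ι in Metric.closedBall 0 r, t i * t j = 0 := by
  classical
  let T : EuclideanSpace ℝ ι ≃ₗᵢ[ℝ] EuclideanSpace ℝ ι :=
    LinearIsometryEquiv.piLpCongrRight 2 fun k =>
      if k = i then LinearIsometryEquiv.neg ℝ else LinearIsometryEquiv.refl ℝ ℝ
  have hT (t : EuclideanSpace ℝ ι) : T t i * T t j = -(t i * t j) := by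
    simp [T, hij.symm]
  have h := setIntegral_closedBall_comp T r fun t => t i * t j
  simp only [hT, integral_neg] at h
  exact self_eq_neg.1 h.symm

theorem setIntegral_closedBall_mul_self_eq (i j : ι) (r : ℝ) :
    ∫ t : EuclideanSpace ℝ ι in Metric.closedBall 0 r, t i * t i =
      ∫ t : EuclideanSpace ℝ ι in Metric.closedBall 0 r, t j * t j := by
  classical
  let T : EuclideanSpace ℝ ι ≃ₗᵢ[ℝ] EuclideanSpace ℝ ι :=
    LinearIsometryEquiv.piLpCongrLeft 2 ℝ ℝ (Equiv.swap i j)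
  have hT (t : EuclideanSpace ℝ ι) : T t j = t i := by
    simp [T, LinearIsometryEquiv.piLpCongrLeft_apply, Equiv.piCongrLeft'_apply]
  simpa only [hT] using setIntegral_closedBall_comp T r fun t => t j * t j

theorem card_mul_setIntegral_closedBall_bilin [DecidableEq ι]
    (Q : EuclideanSpace ℝ ι →L[ℝ] EuclideanSpace ℝ ι →L[ℝ] ℝ) (r : ℝ) :
    Fintype.card ι * ∫ t in Metric.closedBall 0 r, Q t t =
      (∫ t : EuclideanSpace ℝ ι in Metric.closedBall 0 r, ‖t‖ ^ 2) *
        ∑ i, Q (EuclideanSpace.single i 1) (EuclideanSpace.single i 1) := by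
  have hint (i j : ι) : IntegrableOn (fun t : EuclideanSpace ℝ ι => t i * t j)
      (Metric.closedBall 0 r) :=
    (by fun_prop : Continuous fun t : EuclideanSpace ℝ ι => t i * t j).continuousOn
      |>.integrableOn_compact (isCompact_closedBall 0 r)
  have hQ (t : EuclideanSpace ℝ ι) : Q t t = ∑ i, ∑ j, t i * t j *
      Q (EuclideanSpace.single i 1) (EuclideanSpace.single j 1) := by
    have ht : t = ∑ i, t i • EuclideanSpace.single i (1 : ℝ) := by
      ext j; simp [Finset.sum_apply, Pi.single_apply]
    conv_lhs => rw [ht]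
    simp only [map_sum, map_smul, _root_.sum_apply, _root_.smul_apply, smul_eq_mul,
      Finset.mul_sum]
    rw [Finset.sum_comm]
    exact Finset.sum_congr rfl fun i _ => Finset.sum_congr rfl fun j _ => by ring
  have hnorm (i : ι) : ∫ t : EuclideanSpace ℝ ι in Metric.closedBall 0 r, ‖t‖ ^ 2 =
      Fintype.card ι * ∫ t : EuclideanSpace ℝ ι in Metric.closedBall 0 r, t i * t i := by
    simp only [EuclideanSpace.real_norm_sq_eq]
    simp only [sq]
    rw [integral_finsetSum _ fun j _ => hint j j,
      Finset.sum_congr rfl fun j _ => setIntegral_closedBall_mul_self_eq j i r, Finset.sum_const,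
      Finset.card_univ, nsmul_eq_mul]
  rw [integral_congr_ae (.of_forall hQ),
    integral_finsetSum _ fun i _ => integrable_finsetSum _ fun j _ => (hint i j).mul_const _,
    Finset.mul_sum, Finset.mul_sum]
  refine Finset.sum_congr rfl fun i _ => ?_
  rw [integral_finsetSum _ fun j _ => (hint i j).mul_const _, Finset.sum_eq_single i]
  · rw [integral_mul_const, hnorm i, mul_assoc]
  · intro j _ hj
    rw [integral_mul_const, setIntegral_closedBall_mul_of_ne hj.symm, zero_mul]
  · simp

theorem eventually_forall_closedBall_le_of_isLittleO {E : Type*} [NormedAddCommGroup E]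
    [NormedSpace ℝ E] {g : E → ℝ} {ℓ : E →L[ℝ] ℝ} {Q : E →L[ℝ] E →L[ℝ] ℝ}
    (hg : (fun t => g t - g 0 - ℓ t - 1 / 2 * Q t t) =o[𝓝 0] fun t => ‖t‖ ^ 2) {ε : ℝ}
    (hε : 0 < ε) :
    ∀ᶠ s : ℝ in 𝓝[>] 0, ∀ t ∈ Metric.closedBall 0 1,
      g (s • t) ≤ (g 0 + s ^ 2 * ε) + (s * ℓ t + s ^ 2 * (1 / 2) * Q t t) := by
  obtain ⟨δ, hδ, hball⟩ := Metric.nhds_basis_closedBall.eventually_iff.1 (hg.def hε)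
  filter_upwards [Ioc_mem_nhdsGT hδ] with s ⟨hs, hsδ⟩ t ht
  have hst : ‖s • t‖ ≤ s := by
    rw [norm_smul, Real.norm_of_nonneg hs.le]
    exact mul_le_of_le_one_right hs.le (mem_closedBall_zero_iff.1 ht)
  have htaylor := hball (mem_closedBall_zero_iff.2 (hst.trans hsδ))
  rw [Real.norm_of_nonneg (sq_nonneg ‖s • t‖)] at htaylor
  have hsq : ε * ‖s • t‖ ^ 2 ≤ ε * s ^ 2 := by gcongr
  have hup := (le_abs_self _).trans (htaylor.trans hsq)
  simp only [map_smul, _root_.smul_apply, smul_eq_mul] at hup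
  linarith

theorem sum_bilin_nonneg_of_le_average [DecidableEq ι] [Nonempty ι]
    {g : EuclideanSpace ℝ ι → ℝ}
    {ℓ : EuclideanSpace ℝ ι →L[ℝ] ℝ} {Q : EuclideanSpace ℝ ι →L[ℝ] EuclideanSpace ℝ ι →L[ℝ] ℝ}
    (hg : (fun t => g t - g 0 - ℓ t - 1 / 2 * Q t t) =o[𝓝 0] fun t => ‖t‖ ^ 2)
    (h : ∀ᶠ s : ℝ in 𝓝[>] 0, IntegrableOn (fun t => g (s • t)) (Metric.closedBall 0 1) ∧
      g 0 ≤ ⨍ t in Metric.closedBall 0 1, g (s • t)) :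
    0 ≤ ∑ i, Q (EuclideanSpace.single i 1) (EuclideanSpace.single i 1) := by
  let B : Set (EuclideanSpace ℝ ι) := Metric.closedBall 0 1
  have hB : IsCompact B := isCompact_closedBall 0 1
  have hV : 0 < volume B := Metric.measure_closedBall_pos _ _ one_pos
  have hℓi (s : ℝ) : IntegrableOn (fun t => s * ℓ t) B :=
    (continuous_const.mul ℓ.continuous).continuousOn.integrableOn_compact hB
  have hQi (s : ℝ) : IntegrableOn (fun t => s * Q t t) B :=
    (by fun_prop : Continuous fun t => s * Q t t).continuousOn.integrableOn_compact hB
  have hci (a : ℝ) : IntegrableOn (fun _ : EuclideanSpace ℝ ι => a) B :=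
    integrableOn_const hB.measure_lt_top.ne
  have hε : ∀ ε > 0, 0 ≤ (1 / 2) * (∫ t in B, Q t t) + ε * volume.real B := by
    intro ε hε
    obtain ⟨s, ⟨⟨hi, hle⟩, hpt⟩, hs : 0 < s⟩ := ((h.and
      (eventually_forall_closedBall_le_of_isLittleO hg hε)).and self_mem_nhdsWithin).exists
    have hG : IntegrableOn (fun t => s * ℓ t + s ^ 2 * (1 / 2) * Q t t) B := (hℓi s).add (hQi _)
    have hint : ∫ t in B, g (s • t) ≤
        ∫ t in B, ((g 0 + s ^ 2 * ε) + (s * ℓ t + s ^ 2 * (1 / 2) * Q t t)) :=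
      setIntegral_mono_on hi ((hci _).add hG) measurableSet_closedBall hpt
    rw [integral_add (hci _) hG, integral_add (hℓi s) (hQi _),
      integral_const_mul, integral_const_mul, setIntegral_closedBall_linear, setIntegral_const,
      smul_eq_mul] at hint
    rw [le_setAverage_iff hV.ne' hB.measure_lt_top.ne] at hle
    refine nonneg_of_mul_nonneg_right (a := s ^ 2) ?_ (by positivity)
    linarith
  have hnonneg : 0 ≤ ∫ t in B, Q t t := by
    by_contra! hneg
    have hVr : 0 < volume.real B := ENNReal.toReal_pos hV.ne' hB.measure_lt_top.ne
    have := hε (-(∫ t in B, Q t t) / (4 * volume.real B))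
      (div_pos (neg_pos.2 hneg) (mul_pos four_pos hVr))
    field_simp at this
    linarith
  refine nonneg_of_mul_nonneg_right ?_ (setIntegral_closedBall_norm_sq_pos (ι := ι) one_pos)
  rw [← card_mul_setIntegral_closedBall_bilin]
  positivity

end BallMoments

theorem dotProduct_hessMatrix_mulVec {f : HSpace n → ℝ} {x : HSpace n} (hf : ContDiffAt ℝ 2 f x)
    (v w : HSpace n) :
    (v : Fin n × Fin 4 → ℝ) ⬝ᵥ hessMatrix f x *ᵥ w = fderiv ℝ (fderiv ℝ f) x v w := by
  have hD : DifferentiableAt ℝ (fderiv ℝ f) x :=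
    (hf.fderiv_right (m := 1) (by norm_num)).differentiableAt one_ne_zero
  have hess (p q) : hessMatrix f x p q = fderiv ℝ (fderiv ℝ f) x (EuclideanSpace.single p 1)
      (EuclideanSpace.single q 1) := by
    change fderiv ℝ (fun y => fderiv ℝ f y (EuclideanSpace.single q 1)) x _ = _
    rw [(hD.hasFDerivAt.clm_apply (hasFDerivAt_const _ x)).fderiv]
    simp
  have hb (b : HSpace n) : b = ∑ p, b p • EuclideanSpace.single p (1 : ℝ) := by
    ext j; simp [Finset.sum_apply, Pi.single_apply]
  conv_rhs => rw [hb v, hb w]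
  simp only [map_sum, map_smul, _root_.sum_apply, _root_.smul_apply, smul_eq_mul, ← hess,
    Matrix.mulVec, dotProduct, Finset.mul_sum]
  rw [Finset.sum_comm]
  exact Finset.sum_congr rfl fun i _ => Finset.sum_congr rfl fun j _ => by ring

theorem hessForm_mem_SP_of_le_average {f : HSpace n → ℝ} {x : HSpace n} (hf : ContDiffAt ℝ 2 f x)
    (h : ∀ b : HSpace n, ∀ᶠ s : ℝ in 𝓝[>] 0,
      IntegrableOn (fun t => f (x + hmul n (s • b) t)) (Metric.closedBall 0 1) ∧
        f x ≤ ⨍ t in Metric.closedBall 0 1, f (x + hmul n (s • b) t)) :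
    hessForm (hessMatrix f x) ∈ SP n 1 := by
  refine hessForm_mem_SP (hessMatrix_isSymm hf) fun b => ?_
  simp only [rmulMatrix_mulVec, dotProduct_hessMatrix_mulVec hf]
  set b' : HSpace n := WithLp.toLp 2 b
  refine sum_bilin_nonneg_of_le_average (g := fun t => f (x + hmul n b' t))
    (ℓ := (fderiv ℝ f x).comp (hmul n b'))
    (Q := (fderiv ℝ (fderiv ℝ f) x).bilinearComp (hmul n b') (hmul n b')) ?_ ?_
  · have hx : Filter.Tendsto (fun t => x + hmul n b' t) (𝓝 0) (𝓝 x) := by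
      have hcont : Continuous fun t => x + hmul n b' t := by fun_prop
      simpa only [map_zero, add_zero] using hcont.tendsto 0
    have hO : (fun t => ‖x + hmul n b' t - x‖ ^ 2) =O[𝓝 0] fun t => ‖t‖ ^ 2 :=
      .of_bound (‖b'‖ ^ 2) (.of_forall fun t => by simp [norm_hmul, mul_pow])
    have htaylor := ((taylor_two_isLittleO hf).comp_tendsto hx).trans_isBigO hO
    simpa only [Function.comp_def, add_sub_cancel_left, map_zero, add_zero,
      ContinuousLinearMap.comp_apply, ContinuousLinearMap.bilinearComp_apply, smul_eq_mul]
      using htaylor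
  · simpa [map_smul] using h b'

/-! ### Mollification -/

section Mollify

open scoped Convolution

variable {ι : Type*}

theorem eventually_norm_smul_lt {E : Type*} [NormedAddCommGroup E] [NormedSpace ℝ E] (b : E)
    {r : ℝ} (hr : 0 < r) : ∀ᶠ s : ℝ in 𝓝[>] 0, ‖s • b‖ < r := by
  have hcont : Continuous fun s : ℝ => ‖s • b‖ := by fun_prop
  refine nhdsWithin_le_nhds (hcont.tendsto' 0 0 ?_ |>.eventually (gt_mem_nhds hr))
  rw [zero_smul, norm_zero]

variable (ι) in
/-- The bump functions used as mollifiers; their supports shrink to the origin as `j → ∞`. -/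
def bump (j : ℕ) : ContDiffBump (0 : EuclideanSpace ℝ ι) where
  rIn := 1 / ((j : ℝ) + 1) / 2
  rOut := 1 / ((j : ℝ) + 1)
  rIn_pos := by positivity
  rIn_lt_rOut := half_lt_self (by positivity)

variable (ι) in
theorem tendsto_rOut_bump : Filter.Tendsto (fun j => (bump ι j).rOut) Filter.atTop (𝓝 0) :=
  tendsto_one_div_add_atTop_nhds_zero_nat

variable [Fintype ι] {f : EuclideanSpace ℝ ι → ℝ} {x : EuclideanSpace ℝ ι} {M : ℝ}

variable (ι) in
theorem integrable_normed_bump (j : ℕ) : Integrable ((bump ι j).normed volume) :=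
  (bump ι j).continuous_normed.integrable_of_hasCompactSupport (bump ι j).hasCompactSupport_normed

/-- The convolution of `f` with the normalized `j`-th bump function. -/
def mollify (j : ℕ) (f : EuclideanSpace ℝ ι → ℝ) : EuclideanSpace ℝ ι → ℝ :=
  (bump ι j).normed volume ⋆[ContinuousLinearMap.lsmul ℝ ℝ, volume] f

theorem mollify_apply (j : ℕ) (f : EuclideanSpace ℝ ι → ℝ) (x : EuclideanSpace ℝ ι) :
    mollify j f x = ∫ s, (bump ι j).normed volume s * f (x - s) := rfl

theorem contDiff_mollify (j : ℕ) (hf : LocallyIntegrable f) : ContDiff ℝ ∞ (mollify j f) :=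
  (bump ι j).hasCompactSupport_normed.contDiff_convolution_left _ (bump ι j).contDiff_normed hf

theorem abs_mollify_le (j : ℕ) (hM : ∀ᵐ y, |f y| ≤ M) (x : EuclideanSpace ℝ ι) :
    |mollify j f x| ≤ M := by
  have hM' : ∀ᵐ s, |f (x - s)| ≤ M :=
    (Measure.measurePreserving_sub_left volume x).quasiMeasurePreserving.ae hM
  rw [mollify_apply, ← Real.norm_eq_abs]
  refine (norm_integral_le_of_norm_le ((integrable_normed_bump ι j).mul_const M) ?_).trans_eq ?_
  · filter_upwards [hM'] with s hs
    rw [norm_mul, Real.norm_of_nonneg ((bump ι j).nonneg_normed s)]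
    exact mul_le_mul_of_nonneg_left hs ((bump ι j).nonneg_normed s)
  · rw [integral_mul_const, ContDiffBump.integral_normed, one_mul]

theorem tendsto_mollify_of_continuous (hf : Continuous f) (x : EuclideanSpace ℝ ι) :
    Filter.Tendsto (fun j => mollify j f x) Filter.atTop (𝓝 (f x)) :=
  ContDiffBump.convolution_tendsto_right_of_continuous (tendsto_rOut_bump ι) hf x

theorem tendsto_mollify_of_average (hf : LocallyIntegrable f)
    (h : Filter.Tendsto (fun r => ⨍ y in Metric.closedBall x r, ‖f y - f x‖) (𝓝[>] 0) (𝓝 0)) :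
    Filter.Tendsto (fun j => mollify j f x) Filter.atTop (𝓝 (f x)) := by
  have hr : Filter.Tendsto (fun j => (bump ι j).rOut) Filter.atTop (𝓝[>] 0) :=
    tendsto_nhdsWithin_iff.2 ⟨tendsto_rOut_bump ι, .of_forall fun j => (bump ι j).rOut_pos⟩
  simp only [mollify, convolution_eq_swap, ContinuousLinearMap.lsmul_apply]
  refine tendsto_integral_smul_of_tendsto_average_norm_sub
    (2 ^ Module.finrank ℝ (EuclideanSpace ℝ ι)) (h.comp hr)
    (.of_forall fun j => hf.integrableOn_isCompact (isCompact_closedBall _ _))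
    (tendsto_const_nhds.congr fun j => ?_) (.of_forall fun j y hy => ?_) (.of_forall fun j y => ?_)
  · rw [integral_sub_left_eq_self ((bump ι j).normed volume), ContDiffBump.integral_normed]
  · have hy' : x - y ∈ Function.support ((bump ι j).normed volume) := hy
    rw [ContDiffBump.support_normed_eq, mem_ball_zero_iff] at hy'
    rw [Metric.mem_closedBall, dist_eq_norm']
    exact hy'.le
  · rw [abs_of_nonneg ((bump ι j).nonneg_normed _), Measure.addHaar_real_closedBall_center]
    refine (bump ι j).normed_le_div_measure_closedBall_rOut _ _ ?_ _
    simp only [bump]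
    linarith

theorem pd_mollify [DecidableEq ι] (j : ℕ) (hf : ContDiff ℝ 1 f) (hc : HasCompactSupport f)
    (p : ι) : pd p (mollify j f) = mollify j (pd p f) := by
  have hφ : LocallyIntegrable ((bump ι j).normed volume) :=
    (integrable_normed_bump ι j).locallyIntegrable
  funext x
  have hderiv := hc.hasFDerivAt_convolution_right (ContinuousLinearMap.lsmul ℝ ℝ) hφ hf x
  have hconv := (hc.fderiv ℝ).convolutionExists_right
    ((ContinuousLinearMap.lsmul ℝ ℝ).precompR (EuclideanSpace ℝ ι)) hφ
    (hf.continuous_fderiv one_ne_zero) x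
  rw [pd, mollify, hderiv.fderiv, convolution, ContinuousLinearMap.integral_apply hconv]
  rfl

theorem integrable_mul_integral_and_integral_swap {α β : Type*} [MeasurableSpace α]
    [MeasurableSpace β] {μ : Measure α} {ν : Measure β} [SFinite μ] [IsFiniteMeasure ν]
    {φ : α → ℝ} {g : α × β → ℝ} (hφ : Integrable φ μ) (hg : Measurable g)
    (hM : ∀ p, |g p| ≤ M) :
    Integrable (fun s => φ s * ∫ t, g (s, t) ∂ν) μ ∧
      ∫ s, φ s * ∫ t, g (s, t) ∂ν ∂μ = ∫ t, ∫ s, φ s * g (s, t) ∂μ ∂ν := by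
  have hprod : Integrable (fun p => φ p.1 * g p) (μ.prod ν) :=
    (hφ.comp_fst ν).mul_bdd (c := M) hg.aestronglyMeasurable (.of_forall hM)
  simp only [← integral_const_mul]
  exact ⟨hprod.integral_prod_left, integral_integral_swap hprod⟩

end Mollify

/-! ### Regularization of plurisubharmonic functions -/

theorem upperSemicontinuousOn_congr {α β : Type*} [TopologicalSpace α] [Preorder β] {u v : α → β}
    {s : Set α} (hu : UpperSemicontinuousOn u s) (h : EqOn v u s) :
    UpperSemicontinuousOn v s := by
  intro x hx y hy
  rw [h hx] at hy
  filter_upwards [hu x hx y hy, self_mem_nhdsWithin] with z hz hzs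
  rwa [h hzs]

theorem measurable_indicator_of_upperSemicontinuousOn {α : Type*} [TopologicalSpace α]
    [MeasurableSpace α] [OpensMeasurableSpace α] {u : α → ℝ} {s : Set α} (hs : MeasurableSet s)
    (hu : UpperSemicontinuousOn u s) : Measurable (indicator s u) := by
  refine measurable_of_restrict_of_restrict_compl hs ?_ ?_
  · exact (upperSemicontinuousOn_iff_restrict.2
      (upperSemicontinuousOn_congr hu fun x hx => indicator_of_mem hx u)).measurable
  · convert (measurable_const : Measurable fun _ : ↥sᶜ => (0 : ℝ)) with x
    exact indicator_of_notMem x.2 u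

theorem supNorm_nonneg (K : Set (HSpace n)) (u : HSpace n → ℝ) : 0 ≤ supNorm K u :=
  ENNReal.toReal_nonneg

theorem ae_abs_indicator_interior_le_supNorm {u : HSpace n → ℝ} {K : Set (HSpace n)}
    (hK : MeasurableSet K) (hu : eLpNorm u ⊤ (volume.restrict K) ≠ ⊤) :
    ∀ᵐ y, |indicator (interior K) u y| ≤ supNorm K u := by
  have hae : ∀ᵐ y ∂volume.restrict K, |u y| ≤ supNorm K u := by
    filter_upwards [ae_le_eLpNormEssSup (f := u) (μ := volume.restrict K)] with y hy
    rw [← eLpNorm_exponent_top] at hy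
    simpa only [toReal_enorm, supNorm, ← Real.norm_eq_abs] using ENNReal.toReal_mono hu hy
  filter_upwards [(ae_restrict_iff' hK).1 hae] with y hy
  by_cases h : y ∈ interior K
  · simpa only [indicator_of_mem h] using hy (interior_subset h)
  · simpa only [indicator_of_notMem h, abs_zero] using supNorm_nonneg K u

namespace IsPSH

variable {u : HSpace n → ℝ} {K : Set (HSpace n)} {M : ℝ}

theorem congr_mono {W : Opens (HSpace n)} {v : HSpace n → ℝ} (hu : IsPSH Ω u) (hW : W ≤ Ω)
    (h : ∀ x ∈ W, v x = u x) : IsPSH W v := by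
  refine ⟨upperSemicontinuousOn_congr (hu.usc.mono hW) h, fun a b => ?_⟩
  have hline := hu.subharmonic a b
  refine ⟨upperSemicontinuousOn_congr (hline.usc.mono fun t ht => hW ht) fun t ht => h _ ht,
    fun x r hr hx => ?_, fun x r hr hx => ?_⟩
  · exact (hline.integrableOn x r hr fun t ht => hW (hx ht)).congr_fun
      (fun t ht => (h _ (hx ht)).symm) measurableSet_closedBall
  · rw [h _ (hx (Metric.mem_closedBall_self hr.le)),
      setAverage_congr_fun measurableSet_closedBall (.of_forall fun t ht => h _ (hx ht))]
    exact hline.le_average x r hr fun t ht => hW (hx ht)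

theorem tendsto_mollify (hu : IsPSH Ω u) (hm : Measurable u) (hli : LocallyIntegrable u)
    {x : HSpace n} (hx : x ∈ Ω) :
    Filter.Tendsto (fun j => mollify j u x) Filter.atTop (𝓝 (u x)) :=
  tendsto_mollify_of_average hli (hu.tendsto_setAverage hm hx)

theorem mollify_le_average (hu : IsPSH Ω u) (hm : Measurable u) (hM : ∀ y, |u y| ≤ M) {j : ℕ}
    {x b : HSpace n} {ρ : ℝ}
    (hx : Metric.closedBall x ((bump (Fin n × Fin 4) j).rOut + ρ) ⊆ Ω) (hb : ‖b‖ ≤ ρ) :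
    mollify j u x ≤ ⨍ t in Metric.closedBall 0 1, mollify j u (x + hmul n b t) := by
  let B : Set (EuclideanSpace ℝ (Fin 4)) := Metric.closedBall 0 1
  have hB : volume B ≠ ⊤ := measure_closedBall_lt_top.ne
  have hB0 : volume B ≠ 0 := (Metric.measure_closedBall_pos _ _ one_pos).ne'
  have : IsFiniteMeasure (volume.restrict B) := isFiniteMeasure_restrict.2 hB
  have hi := integrable_normed_bump (Fin n × Fin 4) j
  obtain ⟨hint, hswap⟩ := integrable_mul_integral_and_integral_swap (ν := volume.restrict B)
    (g := fun p : HSpace n × EuclideanSpace ℝ (Fin 4) => u (x - p.1 + hmul n b p.2)) hi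
    (hm.comp (by fun_prop)) fun p => hM _
  have hint' : Integrable fun s => (bump (Fin n × Fin 4) j).normed volume s * u (x - s) :=
    hi.mul_bdd (c := M) (hm.comp (measurable_id.const_sub x)).aestronglyMeasurable
      (.of_forall fun s => hM _)
  rw [le_setAverage_iff hB0 hB]
  simp only [mollify_apply, add_sub_right_comm]
  rw [← hswap, ← integral_mul_const]
  refine integral_mono (hint'.mul_const _) hint fun s => ?_
  simp only [mul_assoc]
  by_cases hs : s ∈ Function.support ((bump (Fin n × Fin 4) j).normed volume)
  · have hsub : Metric.closedBall (x - s) ρ ⊆ Ω := by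
      rw [ContDiffBump.support_normed_eq, mem_ball_zero_iff] at hs
      refine (Metric.closedBall_subset_closedBall' ?_).trans hx
      rw [dist_eq_norm, sub_sub_cancel_left, norm_neg]
      linarith
    exact mul_le_mul_of_nonneg_left ((le_setAverage_iff hB0 hB).1 (hu.integrableOn_line hb hsub).2)
      ((bump _ j).nonneg_normed s)
  · rw [Function.notMem_support.1 hs, zero_mul, zero_mul]

theorem eventually_hessForm_mollify_mem_SP (hu : IsPSH Ω u) (hm : Measurable u)
    (hM : ∀ y, |u y| ≤ M) (hK : IsCompact K) (hKΩ : K ⊆ Ω) :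
    ∀ᶠ j in Filter.atTop, ∀ x ∈ K, hessForm (hessMatrix (mollify j u) x) ∈ SP n 1 := by
  have hsmooth (j : ℕ) : ContDiff ℝ ∞ (mollify j u) := contDiff_mollify j
    ((locallyIntegrable_const M).mono hm.aestronglyMeasurable
      (.of_forall fun y => (hM y).trans (le_abs_self M)))
  obtain ⟨δ, hδ, hsub⟩ := hK.exists_cthickening_subset_open Ω.isOpen hKΩ
  filter_upwards [(tendsto_rOut_bump (Fin n × Fin 4)).eventually (gt_mem_nhds (half_pos hδ))]
    with j hj x hx
  refine hessForm_mem_SP_of_le_average ((hsmooth j).contDiffAt.of_le ENat.LEInfty.out)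
    fun b => ?_
  filter_upwards [eventually_norm_smul_lt b (half_pos hδ)] with s hs
  have hcont : Continuous fun t => mollify j u (x + hmul n (s • b) t) :=
    (hsmooth j).continuous.comp (by fun_prop)
  refine ⟨hcont.continuousOn.integrableOn_compact (isCompact_closedBall _ _),
    hu.mollify_le_average hm hM (ρ := δ / 2) (Subset.trans ?_ hsub) hs.le⟩
  exact (Metric.closedBall_subset_closedBall (by linarith)).trans
    (Metric.closedBall_subset_cthickening hx δ)

theorem measurable_indicator_interior (hu : IsPSH Ω u) (hKΩ : K ⊆ Ω) :
    Measurable (indicator (interior K) u) :=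
  measurable_indicator_of_upperSemicontinuousOn isOpen_interior.measurableSet
    (hu.usc.mono (interior_subset.trans hKΩ))

theorem indicator_interior (hu : IsPSH Ω u) (hKΩ : K ⊆ Ω) :
    IsPSH ⟨interior K, isOpen_interior⟩ (indicator (interior K) u) :=
  hu.congr_mono (interior_subset.trans hKΩ) fun _ hy => indicator_of_mem hy u

theorem abs_le_supNorm (hu : IsPSH Ω u) (hb : IsLocallyBounded Ω u) (hK : IsCompact K)
    (hKΩ : K ⊆ Ω) {x : HSpace n} (hx : x ∈ interior K) : |u x| ≤ supNorm K u := by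
  have hm := hu.measurable_indicator_interior hKΩ
  have hae := ae_abs_indicator_interior_le_supNorm hK.measurableSet (hb K hK hKΩ).2.ne
  have hli : LocallyIntegrable (indicator (interior K) u) :=
    (locallyIntegrable_const (supNorm K u)).mono hm.aestronglyMeasurable
      (hae.mono fun y hy => hy.trans (le_abs_self _))
  have ht := (hu.indicator_interior hKΩ).tendsto_mollify hm hli hx
  rw [indicator_of_mem hx] at ht
  exact le_of_tendsto ht.abs (.of_forall fun j => abs_mollify_le j hae x)

theorem exists_regularization (hu : IsPSH Ω u) (hb : IsLocallyBounded Ω u) (hK : IsCompact K)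
    (hKΩ : K ⊆ Ω) :
    ∃ v : ℕ → HSpace n → ℝ, (∀ j, ContDiff ℝ ∞ (v j)) ∧ (∀ j x, |v j x| ≤ supNorm K u) ∧
      (∀ x ∈ interior K, Filter.Tendsto (fun j => v j x) Filter.atTop (𝓝 (u x))) ∧
      ∀ K' : Set (HSpace n), IsCompact K' → K' ⊆ interior K →
        ∀ᶠ j in Filter.atTop, ∀ x ∈ K', hessForm (hessMatrix (v j) x) ∈ SP n 1 := by
  let f : HSpace n → ℝ := indicator (interior K) u
  have hf := hu.indicator_interior hKΩ
  have hm : Measurable f := hu.measurable_indicator_interior hKΩ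
  have hM (y : HSpace n) : |f y| ≤ supNorm K u := by
    by_cases h : y ∈ interior K
    · simpa only [f, indicator_of_mem h] using hu.abs_le_supNorm hb hK hKΩ h
    · simpa only [f, indicator_of_notMem h, abs_zero] using supNorm_nonneg K u
  have hli : LocallyIntegrable f := (locallyIntegrable_const (supNorm K u)).mono
    hm.aestronglyMeasurable (.of_forall fun y => (hM y).trans (le_abs_self _))
  refine ⟨fun j => mollify j f, fun j => contDiff_mollify j hli,
    fun j => abs_mollify_le j (.of_forall hM), fun x hx => ?_,
    fun K' hK' hKK' => hf.eventually_hessForm_mollify_mem_SP hm hM hK' hKK'⟩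
  simpa only [f, indicator_of_mem hx] using hf.tendsto_mollify hm hli hx

end IsPSH

/-! ### Regularization of `C²` functions -/

open scoped Manifold in
theorem exists_cutoff {E : Type*} [NormedAddCommGroup E] [NormedSpace ℝ E]
    [FiniteDimensional ℝ E] {K U : Set E} (hK : IsCompact K) (hU : IsOpen U) (hKU : K ⊆ U) :
    ∃ χ : E → ℝ, ContDiff ℝ ∞ χ ∧ HasCompactSupport χ ∧ tsupport χ ⊆ U ∧
      (∀ x, 0 ≤ χ x) ∧ (∀ x, χ x ≤ 1) ∧ ∀ x ∈ K, χ =ᶠ[𝓝 x] 1 := by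
  obtain ⟨S, hS, hKS, hSU⟩ := exists_compact_between hK hU hKU
  obtain ⟨χ, hone, hzero, hχ⟩ := exists_contMDiffMap_one_nhds_of_subset_interior 𝓘(ℝ, E)
    (n := (⊤ : ℕ∞)) hK.isClosed hKS
  have hsupp : tsupport χ ⊆ S :=
    closure_minimal (fun x hx => by_contra fun h => hx (hzero x h)) hS.isClosed
  exact ⟨χ, χ.contMDiff.contDiff, .of_support_subset_isCompact hS (subset_closure.trans hsupp),
    hsupp.trans hSU, fun x => (hχ x).1, fun x => (hχ x).2, mem_nhdsSet_iff_forall.1 hone⟩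

theorem exists_contDiff_hasCompactSupport_eventuallyEq {E : Type*} [NormedAddCommGroup E]
    [NormedSpace ℝ E] [FiniteDimensional ℝ E] {K U : Set E} {k : ℕ∞} {u : E → ℝ}
    (hu : ContDiffOn ℝ k u U) (hK : IsCompact K) (hU : IsOpen U) (hKU : K ⊆ U) :
    ∃ f : E → ℝ, ContDiff ℝ k f ∧ HasCompactSupport f ∧ ∀ x ∈ K, f =ᶠ[𝓝 x] u := by
  obtain ⟨χ, hχ, hχc, hχU, -, -, hχ1⟩ := exists_cutoff hK hU hKU
  refine ⟨fun x => χ x * u x, contDiff_iff_contDiffAt.2 fun x => ?_, hχc.mul_right,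
    fun x hx => (hχ1 x hx).mono fun y hy => by simp [hy]⟩
  by_cases hx : x ∈ tsupport fun x => χ x * u x
  · have hxU : x ∈ U := hχU (closure_mono (Function.support_mul_subset_left χ u) hx)
    exact (hχ.of_le (by exact_mod_cast le_top)).contDiffAt.mul (hu.contDiffAt (hU.mem_nhds hxU))
  · exact contDiffAt_const.congr_of_eventuallyEq (notMem_tsupport_iff_eventuallyEq.1 hx)

theorem hessMatrix_congr {f g : HSpace n → ℝ} {x : HSpace n} (h : f =ᶠ[𝓝 x] g) :
    hessMatrix f x = hessMatrix g x := by
  ext p q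
  exact (pd_congr (pd_congr h q) p).eq_of_nhds

theorem hasCompactSupport_pd {ι : Type*} [DecidableEq ι] {f : EuclideanSpace ℝ ι → ℝ}
    (hf : HasCompactSupport f) (p : ι) : HasCompactSupport (pd p f) :=
  (hf.fderiv ℝ).comp_left (g := fun L : EuclideanSpace ℝ ι →L[ℝ] ℝ => L (.single p 1)) rfl

section

variable {ι : Type*} [Fintype ι] [DecidableEq ι] {f : EuclideanSpace ℝ ι → ℝ}

theorem contDiff_pd_of_succ_le {k m : WithTop ℕ∞} (hf : ContDiff ℝ m f) (h : k + 1 ≤ m) (p : ι) :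
    ContDiff ℝ k (pd p f) :=
  (hf.fderiv_right h).clm_apply contDiff_const

theorem pd_pd_mollify (j : ℕ) (hf : ContDiff ℝ 2 f) (hc : HasCompactSupport f) (p q : ι) :
    pd p (pd q (mollify j f)) = mollify j (pd p (pd q f)) := by
  rw [pd_mollify j (hf.of_le one_le_two) hc,
    pd_mollify j (contDiff_pd_of_succ_le hf one_add_one_eq_two.le q) (hasCompactSupport_pd hc q)]

end

theorem exists_contDiff_two_regularization {u : HSpace n → ℝ} (hu : ContDiffOn ℝ 2 u Ω)
    {K : Set (HSpace n)} (hK : IsCompact K) (hKΩ : K ⊆ Ω) :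
    ∃ (v : ℕ → HSpace n → ℝ) (M : ℝ), (∀ j, ContDiff ℝ ∞ (v j)) ∧ (∀ j x, |v j x| ≤ M) ∧
      (∀ j x p q, |hessMatrix (v j) x p q| ≤ M) ∧
      ∀ x ∈ K, Filter.Tendsto (fun j => v j x) Filter.atTop (𝓝 (u x)) ∧
        ∀ p q, Filter.Tendsto (fun j => hessMatrix (v j) x p q) Filter.atTop
          (𝓝 (hessMatrix u x p q)) := by
  obtain ⟨f, hf, hc, hfu⟩ :=
    exists_contDiff_hasCompactSupport_eventuallyEq (k := 2) hu hK Ω.isOpen hKΩ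
  have hpq (p q) : Continuous (pd p (pd q f)) :=
    (contDiff_pd_of_succ_le (k := 0) (contDiff_pd_of_succ_le (k := 1) hf
      one_add_one_eq_two.le q) (zero_add 1).le p).continuous
  have hess (j x p q) : hessMatrix (mollify j f) x p q = mollify j (pd p (pd q f)) x :=
    congrFun (pd_pd_mollify j hf hc p q) x
  obtain ⟨M₀, hM₀⟩ := hc.exists_bound_of_continuous hf.continuous
  choose C hC using fun r : (Fin n × Fin 4) × (Fin n × Fin 4) =>
    (hasCompactSupport_pd (hasCompactSupport_pd hc r.2) r.1).exists_bound_of_continuous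
      (hpq r.1 r.2)
  have hC0 (r) : 0 ≤ C r := (norm_nonneg _).trans (hC r 0)
  refine ⟨fun j => mollify j f, M₀ + ∑ r, C r,
    fun j => contDiff_mollify j hf.continuous.locallyIntegrable, fun j x => ?_, fun j x p q => ?_,
    fun x hx => ⟨?_, fun p q => ?_⟩⟩
  · exact (abs_mollify_le j (.of_forall hM₀) x).trans
      (le_add_of_nonneg_right (Finset.sum_nonneg fun r _ => hC0 r))
  · rw [hess]
    exact (abs_mollify_le j (.of_forall (hC (p, q))) x).trans
      ((Finset.single_le_sum (fun r _ => hC0 r) (Finset.mem_univ _)).trans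
        (le_add_of_nonneg_left ((norm_nonneg _).trans (hM₀ 0))))
  · rw [← (hfu x hx).eq_of_nhds]
    exact tendsto_mollify_of_continuous hf.continuous x
  · simp only [hess, ← hessMatrix_congr (hfu x hx)]
    exact tendsto_mollify_of_continuous (hpq p q) x

theorem IsPSH.hessForm_mem_SP {u : HSpace n → ℝ} (hu : IsPSH Ω u) (hc : ContDiffOn ℝ 2 u Ω)
    {x : HSpace n} (hx : x ∈ Ω) : hessForm (hessMatrix u x) ∈ SP n 1 := by
  obtain ⟨r, hr, hsub⟩ := Metric.nhds_basis_closedBall.mem_iff.1 (Ω.isOpen.mem_nhds hx)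
  exact hessForm_mem_SP_of_le_average (hc.contDiffAt (Ω.isOpen.mem_nhds hx)) fun b =>
    (eventually_norm_smul_lt b hr).mono fun s hs => hu.integrableOn_line hs.le hsub

theorem isLocallyBounded_of_continuousOn {u : HSpace n → ℝ} (hu : ContinuousOn u Ω) :
    IsLocallyBounded Ω u := by
  intro K hK hKΩ
  obtain ⟨C, hC⟩ := hK.exists_bound_of_continuousOn (hu.mono hKΩ)
  exact memLp_top_of_bound ((hu.mono hKΩ).aestronglyMeasurable hK.measurableSet) C
    ((ae_restrict_mem hK.measurableSet).mono hC)

theorem isCompact_preimage_val {X : Type*} [TopologicalSpace X] {s K : Set X} (hK : IsCompact K)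
    (hKs : K ⊆ s) : IsCompact ((Subtype.val : s → X) ⁻¹' K) :=
  Topology.IsInducing.subtypeVal.isCompact_preimage_iff (by simpa using hKs) |>.2 hK

theorem integrable_of_tsupport_subset {X F : Type*} [TopologicalSpace X] [MeasurableSpace X]
    [OpensMeasurableSpace X] [NormedAddCommGroup F] {U : Set X} {ν : Measure X}
    (hν : ∀ K : Set X, IsCompact K → K ⊆ U → ν K < ⊤) {f : X → F}
    (hf : Continuous f) (hc : HasCompactSupport f) (hs : tsupport f ⊆ U) : Integrable f ν := by
  rw [← integrableOn_iff_integrable_of_support_subset (subset_tsupport f)]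
  exact hf.continuousOn.integrableOn_of_subset_isCompact hc (isClosed_tsupport f).measurableSet
    Subset.rfl (hν _ hc hs).ne

section RieszRepresentation

open scoped CompactlySupported

variable {E : Type*} [NormedAddCommGroup E] [NormedSpace ℝ E] {U : Opens E}

/-! ### Positive functionals on test functions -/

/-- The inclusion of the real test functions in the complex ones. -/
def ofRealTest : 𝓓(U, ℝ) →ₗ[ℝ] 𝓓(U, ℂ) :=
  (TestFunction.postcompCLM (n := ⊤) (Ω := U) Complex.ofRealCLM).toLinearMap

theorem ofRealTest_apply (f : 𝓓(U, ℝ)) (x : E) : ofRealTest f x = (f x : ℂ) := rfl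

theorem testFunction_eq_zero_of_notMem {F : Type*} [NormedAddCommGroup F] [NormedSpace ℝ F]
    (f : 𝓓(U, F)) {x : E} (hx : x ∉ U) : f x = 0 :=
  image_eq_zero_of_notMem_tsupport fun h => hx (f.tsupport_subset h)

theorem testFunction_nonneg {f : 𝓓(U, ℝ)} (hf : ∀ x ∈ U, 0 ≤ f x) (x : E) : 0 ≤ f x := by
  by_cases hx : x ∈ U
  · exact hf x hx
  · exact (testFunction_eq_zero_of_notMem f hx).ge

/-- A real test function, as a compactly supported continuous function on `U`. -/
def restrictTest : 𝓓(U, ℝ) →ₗ[ℝ] C_c(U, ℝ) where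
  toFun f :=
    { toFun := fun x => f x
      continuous_toFun := f.contDiff.continuous.comp continuous_subtype_val
      hasCompactSupport' :=
        .intro (isCompact_preimage_val f.hasCompactSupport f.tsupport_subset) fun _ hx =>
          image_eq_zero_of_notMem_tsupport hx }
  map_add' _ _ := rfl
  map_smul' _ _ := rfl

theorem restrictTest_injective : Function.Injective (restrictTest (U := U)) := by
  intro f g h
  ext1 x
  by_cases hx : x ∈ U
  · exact DFunLike.congr_fun h ⟨x, hx⟩
  · rw [testFunction_eq_zero_of_notMem f hx, testFunction_eq_zero_of_notMem g hx]

variable [FiniteDimensional ℝ E]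

theorem exists_cutoffTest {K : Set E} (hK : IsCompact K) (hKU : K ⊆ U) :
    ∃ χ : 𝓓(U, ℝ), (∀ x, 0 ≤ χ x) ∧ (∀ x, χ x ≤ 1) ∧ ∀ x ∈ K, χ x = 1 := by
  obtain ⟨χ, hχ, hc, hU, h0, h1, hK1⟩ := exists_cutoff hK U.isOpen hKU
  exact ⟨⟨χ, hχ, hc, hU⟩, h0, h1, fun x hx => (hK1 x hx).eq_of_nhds⟩

theorem exists_testFunction_add_nonneg (g : C_c(U, ℝ)) :
    ∃ χ : 𝓓(U, ℝ), (∀ x, 0 ≤ χ x) ∧ ∀ x : U, 0 ≤ χ x + g x := by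
  obtain ⟨C, hC⟩ := g.hasCompactSupport.exists_bound_of_continuous g.continuous
  obtain ⟨χ, hχ0, -, hχ1⟩ := exists_cutoffTest (U := U)
    (g.hasCompactSupport.isCompact.image continuous_subtype_val)
    (Subtype.coe_image_subset _ _)
  have hχ (x) : 0 ≤ (|C| • χ) x := mul_nonneg (abs_nonneg C) (hχ0 x)
  refine ⟨|C| • χ, hχ, fun x => ?_⟩
  by_cases hx : x ∈ tsupport g
  · have hCx : (|C| • χ) x = |C| := (congrArg (|C| * ·) (hχ1 x ⟨x, hx, rfl⟩)).trans (mul_one _)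
    rw [hCx]
    linarith [(abs_le.1 (hC x)).1, le_abs_self C]
  · rw [image_eq_zero_of_notMem_tsupport hx, add_zero]
    exact hχ x

theorem exists_positiveLinearMap_extension (Λ : 𝓓(U, ℝ) →ₗ[ℝ] ℝ)
    (hΛ : ∀ f : 𝓓(U, ℝ), (∀ x, 0 ≤ f x) → 0 ≤ Λ f) :
    ∃ G : C_c(U, ℝ) →ₚ[ℝ] ℝ, ∀ f, G (restrictTest f) = Λ f := by
  let e := LinearEquiv.ofInjective (restrictTest (U := U)) restrictTest_injective
  let P : C_c(U, ℝ) →ₗ.[ℝ] ℝ := ⟨LinearMap.range restrictTest, Λ ∘ₗ e.symm.toLinearMap⟩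
  have hP (f : 𝓓(U, ℝ)) : P (e f) = Λ f := congrArg Λ (e.symm_apply_apply f)
  let S : PointedCone ℝ C_c(U, ℝ) :=
    { carrier := {g | ∀ x, 0 ≤ g x}
      add_mem' := fun ha hb x => add_nonneg (ha x) (hb x)
      zero_mem' := fun _ => le_rfl
      smul_mem' := fun c _ ha x => mul_nonneg c.2 (ha x) }
  have hpos : ∀ f : P.domain, (f : C_c(U, ℝ)) ∈ S → 0 ≤ P f := by
    rintro ⟨_, f, rfl⟩ hf
    exact (hΛ f (testFunction_nonneg fun x hx => hf ⟨x, hx⟩)).trans_eq (hP f).symm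
  have hcofinal (g : C_c(U, ℝ)) : ∃ f : P.domain, (f : C_c(U, ℝ)) + g ∈ S :=
    let ⟨χ, _, hχ⟩ := exists_testFunction_add_nonneg g
    ⟨e χ, hχ⟩
  obtain ⟨G, hGP, hG⟩ := riesz_extension S P hpos hcofinal
  exact ⟨.mk₀ G hG, fun f => (hGP (e f)).trans (hP f)⟩

theorem im_eq_zero_of_nonneg {Λ : 𝓓(U, ℝ) →ₗ[ℝ] ℂ}
    (hΛ : ∀ f : 𝓓(U, ℝ), (∀ x, 0 ≤ f x) → 0 ≤ Λ f) (f : 𝓓(U, ℝ)) : (Λ f).im = 0 := by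
  obtain ⟨χ, hχ, hχf⟩ := exists_testFunction_add_nonneg (restrictTest f)
  have hsum := hΛ (χ + f) (testFunction_nonneg fun x hx => hχf ⟨x, hx⟩)
  have him := (Complex.nonneg_iff.1 hsum).2
  rwa [map_add, Complex.add_im, ← (Complex.nonneg_iff.1 (hΛ χ hχ)).2, zero_add, eq_comm] at him

variable [MeasurableSpace E] {ν : Measure E}

theorem sigmaFinite_of_finite_on_compacts
    (hν : ∀ K : Set E, IsCompact K → K ⊆ U → ν K < ⊤) (hU : ν (U : Set E)ᶜ = 0) :
    SigmaFinite ν := by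
  have : LocallyCompactSpace U := U.isOpen.locallyCompactSpace
  have : SigmaCompactSpace U := sigmaCompactSpace_of_locallyCompact_secondCountable
  refine Measure.sigmaFinite_of_countable (S := insert (U : Set E)ᶜ
    (range fun k => Subtype.val '' compactCovering U k)) ((countable_range _).insert _) ?_ ?_
  · rintro s (rfl | ⟨k, rfl⟩)
    · exact hU.trans_lt ENNReal.zero_lt_top
    · exact hν _ ((isCompact_compactCovering U k).image continuous_subtype_val)
        (Subtype.coe_image_subset _ _)
  · rw [sUnion_insert, sUnion_range, ← image_iUnion, iUnion_compactCovering, image_univ,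
      Subtype.range_coe_subtype]
    exact compl_union_self _

variable [BorelSpace E]

theorem exists_measure_of_nonneg_real (Λ : 𝓓(U, ℝ) →ₗ[ℝ] ℝ)
    (hΛ : ∀ f : 𝓓(U, ℝ), (∀ x, 0 ≤ f x) → 0 ≤ Λ f) :
    ∃ ν : Measure E, (∀ K : Set E, IsCompact K → K ⊆ U → ν K < ⊤) ∧ ν (U : Set E)ᶜ = 0 ∧
      ∀ f : 𝓓(U, ℝ), Λ f = ∫ x, f x ∂ν := by
  have : LocallyCompactSpace U := U.isOpen.locallyCompactSpace
  obtain ⟨G, hG⟩ := exists_positiveLinearMap_extension Λ hΛ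
  refine ⟨(RealRMK.rieszMeasure G).map Subtype.val, fun K hK hKU => ?_, ?_, fun f => ?_⟩
  · rw [Measure.map_apply measurable_subtype_coe hK.measurableSet]
    exact (isCompact_preimage_val hK hKU).measure_lt_top
  · rw [Measure.map_apply measurable_subtype_coe U.isOpen.measurableSet.compl]
    convert measure_empty (μ := RealRMK.rieszMeasure G)
    ext x
    simp
  · have hval : MeasurableEmbedding (Subtype.val : U → E) := .subtype_coe U.isOpen.measurableSet
    rw [hval.integral_map, ← hG]
    exact (RealRMK.integral_rieszMeasure G (restrictTest f)).symm

theorem exists_measure_of_nonneg (Λ : 𝓓(U, ℂ) →ₗ[ℂ] ℂ)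
    (hΛ : ∀ f : 𝓓(U, ℂ), (∀ x, 0 ≤ f x) → 0 ≤ Λ f) :
    ∃ ν : Measure E, (∀ K : Set E, IsCompact K → K ⊆ U → ν K < ⊤) ∧ ν (U : Set E)ᶜ = 0 ∧
      ∀ f : 𝓓(U, ℂ), Λ f = ∫ x, f x ∂ν := by
  let Λr : 𝓓(U, ℝ) →ₗ[ℝ] ℂ := Λ.restrictScalars ℝ ∘ₗ ofRealTest
  have hpos (f : 𝓓(U, ℝ)) (hf : ∀ x, 0 ≤ f x) : 0 ≤ Λr f :=
    hΛ _ fun x => by rw [ofRealTest_apply]; exact_mod_cast hf x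
  obtain ⟨ν, hfin, hν, hint⟩ := exists_measure_of_nonneg_real (Complex.reLm ∘ₗ Λr) fun f hf =>
    (Complex.nonneg_iff.1 (hpos f hf)).1
  have hreal (f : 𝓓(U, ℝ)) : Λ (ofRealTest f) = (∫ x, f x ∂ν : ℝ) :=
    Complex.ext (hint f) (im_eq_zero_of_nonneg hpos f)
  refine ⟨ν, hfin, hν, fun f => ?_⟩
  let fr : 𝓓(U, ℝ) := TestFunction.postcompCLM (n := ⊤) (Ω := U) Complex.reCLM f
  let fi : 𝓓(U, ℝ) := TestFunction.postcompCLM (n := ⊤) (Ω := U) Complex.imCLM f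
  have hf : f = ofRealTest fr + Complex.I • ofRealTest fi := by
    ext1 x
    change f x = ((f x).re : ℂ) + Complex.I * ((f x).im : ℂ)
    rw [mul_comm, Complex.re_add_im]
  have hi : Integrable f ν := integrable_of_tsupport_subset hfin f.contDiff.continuous
    f.hasCompactSupport f.tsupport_subset
  calc Λ f = (∫ x, fr x ∂ν : ℝ) + (∫ x, fi x ∂ν : ℝ) * Complex.I := by
        rw [hf, map_add, map_smul, hreal, hreal, smul_eq_mul, mul_comm]
    _ = ∫ x, f x ∂ν := integral_re_add_im (𝕜 := ℂ) hi

end RieszRepresentation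

/-! ### Currents with measure coefficients -/

theorem integrable_topPairing {μ : Measure (HSpace n)} {h : HSpace n → Coeff n}
    (hh : LocallyIntegrableOn h Ω μ) (η : TestForm Ω) :
    Integrable (fun x => topPairing n (η x) (h x)) μ := by
  have hsupp : Function.support (fun x => topPairing n (η x) (h x)) ⊆ tsupport η :=
    fun x hx => subset_tsupport η fun h0 => hx (by simp [h0])
  have hη := hh.integrableOn_compact_subset η.tsupport_subset η.hasCompactSupport
  obtain ⟨C, hC⟩ := η.hasCompactSupport.exists_bound_of_continuous η.contDiff.continuous
  rw [← integrableOn_iff_integrable_of_support_subset hsupp]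
  rw [IntegrableOn, ← memLp_one_iff_integrable] at hη ⊢
  exact (topPairing n).memLp_of_bilin 1
    (memLp_top_of_bound η.contDiff.continuous.aestronglyMeasurable C (.of_forall hC)) hη

theorem Current.ofMeasure_apply {μ : Measure (HSpace n)} {h : HSpace n → Coeff n}
    (hh : LocallyIntegrableOn h Ω μ) (η : TestForm Ω) :
    Current.ofMeasure Ω μ h η = ∫ x, topPairing n (η x) (h x) ∂μ :=
  TestFunction.integralAgainstBilinCLM_eq_integral hh

theorem locallyIntegrableOn_ofReal_smul {X F : Type*} [TopologicalSpace X] [T2Space X]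
    [LocallyCompactSpace X] [MeasurableSpace X] [OpensMeasurableSpace X]
    [NormedAddCommGroup F] [NormedSpace ℂ F] {U : Set X} (hU : IsOpen U) {μ : Measure X} {h : X → F}
    (hh : LocallyIntegrableOn h U μ) {u : X → ℝ} (hu : Measurable (indicator U u))
    (hb : ∀ K : Set X, IsCompact K → K ⊆ U → ∃ C, ∀ x ∈ K, |u x| ≤ C) :
    LocallyIntegrableOn (fun x => (u x : ℂ) • h x) U μ := by
  rw [locallyIntegrableOn_iff hU.isLocallyClosed] at hh ⊢
  intro K hKU hK
  obtain ⟨C, hC⟩ := hb K hK hKU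
  have hmeas : AEStronglyMeasurable (fun x => (u x : ℂ)) (μ.restrict K) :=
    (Complex.measurable_ofReal.comp hu).aestronglyMeasurable.congr <|
      (ae_restrict_mem hK.measurableSet).mono fun x hx =>
        congrArg Complex.ofReal (indicator_of_mem (hKU hx) u)
  exact (hh K hKU hK).bdd_smul C hmeas <| (ae_restrict_mem hK.measurableSet).mono fun x hx =>
    (Complex.norm_real _).trans_le (hC x hx)

theorem tendsto_integral_ofReal_mul {X : Type*} [MeasurableSpace X] {μ : Measure X} {φ : X → ℂ}
    (hφ : Integrable φ μ) {g : X → ℝ} {v : ℕ → X → ℝ} (hv : ∀ j, AEMeasurable (v j) μ) {M : ℝ}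
    (hM : ∀ j x, |v j x| ≤ M)
    (hlim : ∀ x, φ x ≠ 0 → Filter.Tendsto (fun j => v j x) Filter.atTop (𝓝 (g x))) :
    Filter.Tendsto (fun j => ∫ x, (v j x : ℂ) * φ x ∂μ) Filter.atTop
      (𝓝 (∫ x, (g x : ℂ) * φ x ∂μ)) := by
  refine tendsto_integral_of_dominated_convergence (fun x => M * ‖φ x‖)
    (fun j => (hv j).complex_ofReal.aestronglyMeasurable.mul hφ.1) (hφ.norm.const_mul M)
    (fun j => .of_forall fun x => ?_) (.of_forall fun x => ?_)
  · rw [norm_mul, Complex.norm_real]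
    exact mul_le_mul_of_nonneg_right (hM j x) (norm_nonneg _)
  · by_cases hx : φ x = 0
    · simp [hx]
    · exact ((Complex.continuous_ofReal.tendsto _).comp (hlim x hx)).mul_const _

theorem mem_tsupport_of_topPairing_ne_zero {η : HSpace n → Coeff n} {ψ : Coeff n} {x : HSpace n}
    (h : topPairing n (η x) ψ ≠ 0) : x ∈ tsupport η :=
  subset_tsupport η fun h0 => h (by simp [h0])

theorem Current.HasMeasureCoeff.tendsto_mulFun {T : Current Ω} (hT : T.HasMeasureCoeff)
    {u : HSpace n → ℝ} (hu : Measurable (indicator (Ω : Set (HSpace n)) u))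
    (hb : ∀ K : Set (HSpace n), IsCompact K → K ⊆ Ω → ∃ C, ∀ x ∈ K, |u x| ≤ C)
    {v : ℕ → HSpace n → ℝ} (hv : ∀ j, ContDiff ℝ ∞ fun x => (v j x : ℂ)) {M : ℝ}
    (hM : ∀ j x, |v j x| ≤ M) (η : TestForm Ω)
    (hlim : ∀ x ∈ tsupport η, Filter.Tendsto (fun j => v j x) Filter.atTop (𝓝 (u x))) :
    Filter.Tendsto (fun j => T (mulTest (fun x => (v j x : ℂ)) (hv j) 1 η)) Filter.atTop
      (𝓝 (T.mulFun u η)) := by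
  obtain ⟨hh, hrep⟩ := hT.choose_spec.choose_spec
  set μ := hT.choose
  set h := hT.choose_spec.choose
  have hmulFun : T.mulFun u η = ∫ x, (u x : ℂ) * topPairing n (η x) (h x) ∂μ := by
    rw [Current.mulFun, dif_pos hT,
      Current.ofMeasure_apply (locallyIntegrableOn_ofReal_smul Ω.isOpen hh hu hb)]
    simp only [map_smul, smul_eq_mul]
    rfl
  have hmulTest (j) : T (mulTest (fun x => (v j x : ℂ)) (hv j) 1 η) =
      ∫ x, (v j x : ℂ) * topPairing n (η x) (h x) ∂μ := by
    conv_lhs => rw [hrep]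
    rw [Current.ofMeasure_apply hh]
    simp only [mulTest_apply, wedgeLeft_one, map_smul, _root_.smul_apply, smul_eq_mul]
    rfl
  simp only [hmulFun, hmulTest]
  exact tendsto_integral_ofReal_mul (integrable_topPairing hh η)
    (fun j => (Complex.continuous_re.comp (hv j).continuous).aemeasurable) hM
    fun x hx => hlim x (mem_tsupport_of_topPairing_ne_zero hx)

/-! ### Positive currents -/

theorem Current.IsPositive.exists_measure {k : ℕ} {T : Current Ω} (hT : T.IsPositive k) {w : Ext n}
    (hw : w ∈ SP n (n - k)) :
    ∃ ν : Measure (HSpace n), (∀ K : Set (HSpace n), IsCompact K → K ⊆ Ω → ν K < ⊤) ∧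
      ν (Ω : Set (HSpace n))ᶜ = 0 ∧ ∀ f : 𝓓(Ω, ℂ), T (constTestForm w f) = ∫ x, f x ∂ν := by
  let Λ : 𝓓(Ω, ℂ) →ₗ[ℂ] ℂ := (T ∘L TestFunction.postcompCLM
    (ContinuousLinearMap.smulRight (1 : ℂ →L[ℂ] ℂ) (coeff n w))).toLinearMap
  refine exists_measure_of_nonneg Λ fun f hf => hT _ fun x => ?_
  change (coeff n).symm (f x • coeff n w) ∈ _
  rw [map_smul, LinearEquiv.symm_apply_apply]
  exact smul_mem_SP (hf x) hw

theorem exists_finset_SP_sub_sum_mem_degCompl (n m : ℕ) :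
    ∃ (S : Finset (Ext n)) (ψ : S → Coeff n), (∀ w ∈ S, w ∈ SP n m) ∧
      ∀ φ : Coeff n, (coeff n).symm φ - ∑ w : S, topPairing n φ (ψ w) • (w : Ext n) ∈
        degCompl n (2 * m) := by
  have : Module.Finite ℂ (Ext n) := Module.Finite.of_basis (extBasis n)
  obtain ⟨S, hS, hspan⟩ := (Submodule.fg_span_iff_fg_span_finset_subset (R := ℂ)
    (SP n m : Set (Ext n))).1 (IsNoetherian.noetherian _)
  have hbasis (I : {I : Finset (Fin (n * 2)) // I.card = 2 * m}) :
      ∃ c : S → ℂ, ∑ w : S, c w • (w : Ext n) = extBasis n I := by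
    have hI := exteriorPower_two_mul_le_spanSP m (I.2 ▸ extBasis_mem_exteriorPower I.1)
    rwa [spanSP, hspan, Submodule.mem_span_finset'] at hI
  choose c hc using hbasis
  choose ε hε using exists_forall_topPairing_eq (n := n)
  refine ⟨S, fun w => ∑ I, c I w • ε I, hS, fun φ => mem_degCompl_iff.2 fun J hJ => ?_⟩
  have hsum : ∑ w : S, topPairing n φ (∑ I, c I w • ε I) • (w : Ext n) =
      ∑ I : {I : Finset (Fin (n * 2)) // I.card = 2 * m}, φ I • extBasis n I := by
    simp only [map_sum, map_smul, hε, smul_eq_mul, Finset.sum_smul]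
    rw [Finset.sum_comm]
    simp only [← hc, Finset.smul_sum, smul_smul, mul_comm (c _ _)]
  rw [hsum, map_sub, LinearEquiv.apply_symm_apply, map_sum, Pi.sub_apply, Finset.sum_apply,
    Finset.sum_eq_single ⟨J, hJ⟩ _ (by simp)]
  · simp [coeff_extBasis]
  · intro I _ hI
    have : J ≠ I := fun h => hI (Subtype.ext h.symm)
    simp [coeff_extBasis, this]

theorem Current.HasDim.eq_sum_constTestForm {m : ℕ} {T : Current Ω} (hT : T.HasDim (2 * m))
    {S : Finset (Ext n)} {ψ : S → Coeff n}
    (hψ : ∀ φ : Coeff n, (coeff n).symm φ - ∑ w : S, topPairing n φ (ψ w) • (w : Ext n) ∈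
      degCompl n (2 * m)) (η : TestForm Ω) :
    T η = ∑ w : S, T (constTestForm (w : Ext n)
      (TestFunction.postcompCLM ((topPairing n).flip (ψ w)) η)) := by
  rw [← map_sum, ← sub_eq_zero, ← map_sub]
  refine hT _ fun x => ?_
  convert hψ (η x)
  rw [_root_.sub_apply, _root_.sum_apply, map_sub, map_sum]
  congr! 2 with w
  change (coeff n).symm (topPairing n (η x) (ψ w) • coeff n w) = _
  rw [map_smul, LinearEquiv.symm_apply_apply]

theorem locallyIntegrableOn_rnDeriv {X : Type*} [TopologicalSpace X] [LocallyCompactSpace X]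
    [MeasurableSpace X] {U : Set X} (hU : IsOpen U) {ν μ : Measure X}
    (hν : ∀ K : Set X, IsCompact K → K ⊆ U → ν K < ⊤) :
    LocallyIntegrableOn (fun x => (ν.rnDeriv μ x).toReal) U μ := by
  rw [locallyIntegrableOn_iff hU.isLocallyClosed]
  exact fun K hKU hK => integrable_toReal_of_lintegral_ne_top
    (Measure.measurable_rnDeriv _ _).aemeasurable
    ((Measure.setLIntegral_rnDeriv_le K).trans_lt (hν K hK hKU)).ne

theorem Current.IsPositive.hasMeasureCoeff {k : ℕ} {T : Current Ω} (hT : T.IsPositive k)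
    (hd : T.HasDim (2 * (n - k))) : T.HasMeasureCoeff := by
  obtain ⟨S, ψ, hS, hψ⟩ := exists_finset_SP_sub_sum_mem_degCompl n (n - k)
  choose ν hfin hΩ hint using fun w : S => hT.exists_measure (hS w w.2)
  have (w : S) : SigmaFinite (ν w) := sigmaFinite_of_finite_on_compacts (hfin w) (hΩ w)
  let μ : Measure (HSpace n) := Measure.sum ν
  have hac (w : S) : ν w ≪ μ := Measure.absolutelyContinuous_of_le (Measure.le_sum ν w)
  let r (w : S) (x : HSpace n) : ℝ := ((ν w).rnDeriv μ x).toReal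
  have hterm (w : S) : LocallyIntegrableOn (fun x => r w x • ψ w) Ω μ :=
    (locallyIntegrableOn_iff Ω.isOpen.isLocallyClosed).2 fun K hKΩ hK =>
      ((locallyIntegrableOn_rnDeriv Ω.isOpen (hfin w)).integrableOn_compact_subset
        hKΩ hK).smul_const (ψ w)
  have hsum : LocallyIntegrableOn (fun x => ∑ w, r w x • ψ w) Ω μ :=
    (locallyIntegrableOn_iff Ω.isOpen.isLocallyClosed).2 fun K hKΩ hK =>
      integrable_finsetSum _ fun w _ => (hterm w).integrableOn_compact_subset hKΩ hK
  refine ⟨μ, fun x => ∑ w, r w x • ψ w, hsum, ?_⟩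
  ext1 η
  rw [hd.eq_sum_constTestForm hψ, Current.ofMeasure_apply hsum]
  simp only [map_sum]
  rw [integral_finsetSum _ fun w _ => integrable_topPairing (hterm w) η]
  refine Finset.sum_congr rfl fun w _ => ?_
  rw [hint, ← integral_rnDeriv_smul (hac w)]
  refine integral_congr_ae (.of_forall fun x => ?_)
  simp only [← Complex.coe_smul, map_smul]
  rfl

theorem Current.IsPositive.exists_isMassMeasure {k : ℕ} {T : Current Ω} (hT : T.IsPositive k) :
    ∃ ν : Measure (HSpace n), T.IsMassMeasure (n - k) ν :=
  let ⟨ν, hfin, _, hint⟩ := hT.exists_measure (beta_pow_mem_SP n (n - k))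
  ⟨ν, hfin, hint⟩

/-! ### Products `△u₁ ∧ … ∧ △u_k` of bounded functions -/

theorem tsupport_dTest_subset (α : Fin 2) (η : TestForm Ω) :
    tsupport (dTest Ω α η) ⊆ tsupport η := by
  refine closure_minimal (Function.support_subset_iff'.2 fun x hx => ?_) (isClosed_tsupport η)
  have hη : ⇑η =ᶠ[𝓝 x] fun _ => 0 := notMem_tsupport_iff_eventuallyEq.1 hx
  rw [dTest_apply_eq_sum_pd]
  refine Finset.sum_eq_zero fun p _ => ?_
  rw [(pd_congr hη p).eq_of_nhds]
  simp [pd]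

theorem IsPSH.exists_abs_le {u : HSpace n → ℝ} (hu : IsPSH Ω u) (hb : IsLocallyBounded Ω u)
    (K : Set (HSpace n)) (hK : IsCompact K) (hKΩ : K ⊆ Ω) : ∃ C, ∀ x ∈ K, |u x| ≤ C := by
  obtain ⟨K', hK', hKK', hK'Ω⟩ := exists_compact_between hK Ω.isOpen hKΩ
  exact ⟨supNorm K' u, fun x hx => hu.abs_le_supNorm hb hK' hK'Ω (hKK' hx)⟩

theorem Current.HasMeasureCoeff.tendsto_baston_mulFun {T : Current Ω} (hT : T.HasMeasureCoeff)
    {u : HSpace n → ℝ} (hu : IsPSH Ω u) (hb : IsLocallyBounded Ω u) {v : ℕ → HSpace n → ℝ}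
    (hv : ∀ j, ContDiff ℝ ∞ (v j)) {M : ℝ} (hM : ∀ j x, |v j x| ≤ M) (η : TestForm Ω)
    (hlim : ∀ x ∈ tsupport η, Filter.Tendsto (fun j => v j x) Filter.atTop (𝓝 (u x))) :
    Filter.Tendsto (fun j => T (mulTest (fun x => (v j x : ℂ)) (contDiff_ofReal_comp (hv j)) 1
      (dTest Ω 0 (dTest Ω 1 η)))) Filter.atTop (𝓝 ((T.mulFun u).baston η)) :=
  hT.tendsto_mulFun (measurable_indicator_of_upperSemicontinuousOn Ω.isOpen.measurableSet hu.usc)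
    (hu.exists_abs_le hb) (fun j => contDiff_ofReal_comp (hv j)) hM _ fun x hx =>
      hlim x (tsupport_dTest_subset 1 η (tsupport_dTest_subset 0 _ hx))

theorem Current.HasMeasureCoeff.tendsto_bastonMul {T : Current Ω} (hT : T.HasMeasureCoeff)
    (hc : T.IsClosed) {u : HSpace n → ℝ} (hu : IsPSH Ω u) (hb : IsLocallyBounded Ω u)
    {v : ℕ → HSpace n → ℝ} (hv : ∀ j, ContDiff ℝ ∞ (v j)) {M : ℝ} (hM : ∀ j x, |v j x| ≤ M)
    (η : TestForm Ω)
    (hlim : ∀ x ∈ tsupport η, Filter.Tendsto (fun j => v j x) Filter.atTop (𝓝 (u x))) :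
    Filter.Tendsto (fun j => T (bastonMul (v j) (hv j) η)) Filter.atTop
      (𝓝 ((T.mulFun u).baston η)) :=
  (hT.tendsto_baston_mulFun hu hb hv hM η hlim).congr fun j => hc.apply_mul_baston (hv j) η

/-- Closed positive `2k`-currents. -/
structure Current.IsClosedPositive (k : ℕ) (T : Current Ω) : Prop where
  isClosed : T.IsClosed
  isPositive : T.IsPositive k
  hasDim : T.HasDim (2 * (n - k))

namespace Current.IsClosedPositive

variable {k : ℕ} {T : Current Ω} {u : HSpace n → ℝ}

theorem hasMeasureCoeff (hT : T.IsClosedPositive k) : T.HasMeasureCoeff :=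
  hT.isPositive.hasMeasureCoeff hT.hasDim

theorem isPositive_baston_mulFun (hT : T.IsClosedPositive k) (hk : k < n) (hu : IsPSH Ω u)
    (hb : IsLocallyBounded Ω u) : (T.mulFun u).baston.IsPositive (k + 1) := by
  intro η hη
  obtain ⟨K, hK, hηK, hKΩ⟩ := exists_compact_between η.hasCompactSupport Ω.isOpen η.tsupport_subset
  obtain ⟨v, hv, hM, hlim, hSP⟩ := hu.exists_regularization hb hK hKΩ
  refine ge_of_tendsto (hT.hasMeasureCoeff.tendsto_bastonMul hT.isClosed hu hb hv hM η
    fun x hx => hlim x (hηK hx)) ?_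
  filter_upwards [hSP _ η.hasCompactSupport hηK] with j hj
  refine hT.isPositive _ fun x => ?_
  rw [bastonMul_apply]
  by_cases hx : x ∈ tsupport η
  · rw [wedgeLeft_apply, LinearEquiv.symm_apply_apply, show n - k = 1 + (n - (k + 1)) by omega]
    exact SetLike.mul_mem_graded (hj x hx) (hη x)
  · rw [image_eq_zero_of_notMem_tsupport hx, map_zero, map_zero]
    exact zero_mem _

theorem hasDim_baston_mulFun (hT : T.IsClosedPositive k) (hk : k < n) (hu : IsPSH Ω u)
    (hb : IsLocallyBounded Ω u) : (T.mulFun u).baston.HasDim (2 * (n - (k + 1))) := by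
  intro η hη
  obtain ⟨K, hK, hηK, hKΩ⟩ := exists_compact_between η.hasCompactSupport Ω.isOpen η.tsupport_subset
  obtain ⟨v, hv, hM, hlim, -⟩ := hu.exists_regularization hb hK hKΩ
  have hzero (j : ℕ) : T (mulTest (fun x => (v j x : ℂ)) (contDiff_ofReal_comp (hv j)) 1
      (dTest Ω 0 (dTest Ω 1 η))) = 0 := hT.hasDim _ fun x => by
    rw [mulTest_apply, wedgeLeft_one, map_smul,
      show 2 * (n - k) = 2 * (n - (k + 1)) + 1 + 1 by omega]
    exact Submodule.smul_mem _ _ (dTest_mem_degCompl 0 (dTest_mem_degCompl 1 hη) x)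
  refine tendsto_nhds_unique (hT.hasMeasureCoeff.tendsto_baston_mulFun hu hb hv hM η
    fun x hx => hlim x (hηK hx)) ?_
  simp only [hzero, tendsto_const_nhds]

theorem baston_mulFun (hT : T.IsClosedPositive k) (hk : k < n) (hu : IsPSH Ω u)
    (hb : IsLocallyBounded Ω u) : (T.mulFun u).baston.IsClosedPositive (k + 1) :=
  ⟨isClosed_baston _, hT.isPositive_baston_mulFun hk hu hb, hT.hasDim_baston_mulFun hk hu hb⟩

end Current.IsClosedPositive

theorem Current.one_apply (η : TestForm Ω) :
    Current.one Ω η = ∫ x, topCoeff ((coeff n).symm (η x)) := by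
  rw [Current.one, Current.ofMeasure_apply ((locallyIntegrable_const _).locallyIntegrableOn _)]
  simp only [topPairing_apply, LinearEquiv.symm_apply_apply, one_mul]

theorem Current.isClosedPositive_one : (Current.one Ω).IsClosedPositive 0 where
  isClosed := isClosed_one
  isPositive η hη := by
    rw [one_apply]
    exact integral_nonneg fun x => topCoeff_nonneg_of_mem_SP (hη x)
  hasDim η hη := by
    rw [one_apply]
    simp only [topCoeff_eq_zero_of_mem_degCompl (hη _), integral_zero]

theorem isClosedPositive_bastonProduct (us : List (HSpace n → ℝ)) (hlen : us.length ≤ n)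
    (hu : ∀ u ∈ us, IsPSH Ω u) (hb : ∀ u ∈ us, IsLocallyBounded Ω u) :
    (bastonProduct Ω us).IsClosedPositive us.length := by
  induction us with
  | nil => exact Current.isClosedPositive_one
  | cons u us ih =>
    rw [List.forall_mem_cons] at hu hb
    exact (ih (Nat.le_of_succ_le hlen) hu.2 hb.2).baston_mulFun hlen hu.1 hb.1

/-! ### Chern–Levine–Nirenberg estimates -/

/-- The test form `χ w` on `Ω`, for a cutoff function `χ` supported in a smaller open set `W`. It
has the dummy value `0` unless `W ⊆ Ω`. -/
def cutoffForm (Ω : Opens (HSpace n)) {W : Opens (HSpace n)} (χ : 𝓓(W, ℝ)) (w : Ext n) :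
    TestForm Ω :=
  constTestForm w (ofRealTest (TestFunction.monoCLM ℝ χ))

theorem cutoffForm_apply {W : Opens (HSpace n)} (hW : W ≤ Ω) (χ : 𝓓(W, ℝ)) (w : Ext n)
    (x : HSpace n) : cutoffForm Ω χ w x = (χ x : ℂ) • coeff n w := by
  change ((TestFunction.monoCLM ℝ χ : 𝓓(Ω, ℝ)) x : ℂ) • coeff n w = _
  rw [TestFunction.monoCLM_apply, if_pos ⟨le_rfl, hW⟩]

theorem dTest_dTest_cutoffForm {W : Opens (HSpace n)} (hW : W ≤ Ω) (χ : 𝓓(W, ℝ)) (w : Ext n)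
    (x : HSpace n) :
    dTest Ω 0 (dTest Ω 1 (cutoffForm Ω χ w)) x = coeff n (hessForm (hessMatrix χ x) * w) := by
  have hpd (p q : Fin n × Fin 4) : pd p (pd q (cutoffForm Ω χ w)) x =
      (hessMatrix χ x p q : ℂ) • coeff n w := by
    let L : ℝ →L[ℝ] Coeff n := Complex.ofRealCLM.smulRight (coeff n w)
    have hL : ⇑(cutoffForm Ω χ w) = fun y => L (χ y) := funext (cutoffForm_apply hW χ w)
    have hq : pd q (fun y => L (χ y)) = fun y => L (pd q χ y) :=
      funext fun y => pd_clm L (χ.contDiff.contDiffAt.differentiableAt (by simp)) q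
    rw [hL, hq, pd_clm L ((contDiff_pd q χ.contDiff).contDiffAt.differentiableAt (by simp)) p]
    rfl
  simp only [dTest_dTest_apply, hpd, hessForm_apply, Finset.sum_mul, map_sum, smul_mul_assoc,
    map_smul, wedgeLeft_apply, LinearEquiv.symm_apply_apply]

section PosSemidef

variable {ι : Type*} [Fintype ι]

theorem abs_dotProduct_mulVec_le (A : Matrix ι ι ℝ) (b : ι → ℝ) :
    |b ⬝ᵥ A *ᵥ b| ≤ (∑ p, ∑ q, |A p q|) * (b ⬝ᵥ b) := by
  have hle (i : ι) : b i * b i ≤ b ⬝ᵥ b :=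
    Finset.single_le_sum (f := fun i => b i * b i) (fun i _ => mul_self_nonneg (b i))
      (Finset.mem_univ i)
  have hmul (p q : ι) : |b p * b q| ≤ b ⬝ᵥ b := abs_le.2
    ⟨by nlinarith [hle p, hle q, sq_nonneg (b p + b q)],
      by nlinarith [hle p, hle q, sq_nonneg (b p - b q)]⟩
  calc |b ⬝ᵥ A *ᵥ b| = |∑ p, ∑ q, A p q * (b p * b q)| := by
        simp only [dotProduct, Matrix.mulVec, Finset.mul_sum, mul_left_comm]
    _ ≤ ∑ p, ∑ q, |A p q * (b p * b q)| :=
        (Finset.abs_sum_le_sum_abs _ _).trans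
          (Finset.sum_le_sum fun p _ => Finset.abs_sum_le_sum_abs _ _)
    _ ≤ ∑ p, ∑ q, |A p q| * (b ⬝ᵥ b) :=
        Finset.sum_le_sum fun p _ => Finset.sum_le_sum fun q _ =>
          (abs_mul _ _).trans_le (mul_le_mul_of_nonneg_left (hmul p q) (abs_nonneg _))
    _ = (∑ p, ∑ q, |A p q|) * (b ⬝ᵥ b) := by simp only [Finset.sum_mul]

theorem posSemidef_smul_one_add [DecidableEq ι] {A : Matrix ι ι ℝ} (hA : A.IsSymm) {c : ℝ}
    (hc : ∑ p, ∑ q, |A p q| ≤ c) : (c • (1 : Matrix ι ι ℝ) + A).PosSemidef := by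
  refine .of_dotProduct_mulVec_nonneg ?_ fun b => ?_
  · rw [Matrix.IsHermitian, Matrix.conjTranspose_eq_transpose_of_trivial, Matrix.transpose_add,
      Matrix.transpose_smul, Matrix.transpose_one, hA.eq]
  · have hb : 0 ≤ b ⬝ᵥ b := Finset.sum_nonneg fun i _ => mul_self_nonneg (b i)
    have hA := neg_le_of_abs_le (abs_dotProduct_mulVec_le A b)
    rw [star_trivial, Matrix.add_mulVec, Matrix.smul_mulVec, Matrix.one_mulVec, dotProduct_add,
      dotProduct_smul, smul_eq_mul]
    linarith [mul_le_mul_of_nonneg_right hc hb]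

end PosSemidef

theorem hessMatrix_eq_zero_of_notMem_tsupport {u : HSpace n → ℝ} {x : HSpace n}
    (hx : x ∉ tsupport u) : hessMatrix u x = 0 := by
  have hu : u =ᶠ[𝓝 x] fun _ => 0 := notMem_tsupport_iff_eventuallyEq.1 hx
  have hpd (q : Fin n × Fin 4) : pd q (fun _ : HSpace n => (0 : ℝ)) = fun _ => 0 :=
    funext fun y => by simp [pd]
  rw [hessMatrix_congr hu]
  ext p q
  simp [hessMatrix, hpd]

theorem exists_sum_abs_hessMatrix_le {χ : HSpace n → ℝ} (hχ : ContDiff ℝ ∞ χ)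
    (hc : HasCompactSupport χ) : ∃ c, ∀ x, ∑ p, ∑ q, |hessMatrix χ x p q| ≤ c := by
  have hbd (p q : Fin n × Fin 4) : ∃ C, ∀ x, |hessMatrix χ x p q| ≤ C :=
    (hasCompactSupport_pd (hasCompactSupport_pd hc q) p).exists_bound_of_continuous
      (contDiff_hessMatrix hχ p q).continuous
  choose C hC using hbd
  exact ⟨∑ p, ∑ q, C p q, fun x =>
    Finset.sum_le_sum fun p _ => Finset.sum_le_sum fun q _ => hC p q x⟩

/-- The form `χ' β_n` dominates `±△χ` pointwise, in the order given by the cone `SP n 1`. -/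
def Dominates (χ' χ : HSpace n → ℝ) : Prop :=
  ∀ x, (χ' x : ℂ) • beta n + hessForm (hessMatrix χ x) ∈ SP n 1 ∧
    (χ' x : ℂ) • beta n - hessForm (hessMatrix χ x) ∈ SP n 1

theorem smul_beta_add_hessForm_mem_SP {A : Matrix (Fin n × Fin 4) (Fin n × Fin 4) ℝ}
    (hA : A.IsSymm) {c : ℝ} (hc : ∑ p, ∑ q, |A p q| ≤ c) :
    ((4 * c : ℝ) : ℂ) • beta n + hessForm A ∈ SP n 1 := by
  have h : hessForm (c • (1 : Matrix (Fin n × Fin 4) _ ℝ)) = ((4 * c : ℝ) : ℂ) • beta n := by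
    rw [map_smul, hessForm_one]
    refine (Complex.coe_smul c _).symm.trans ?_
    rw [smul_smul, mul_comm (c : ℂ), Complex.ofReal_mul, Complex.ofReal_ofNat]
  rw [← h, ← map_add]
  exact hessForm_mem_SP_of_posSemidef (posSemidef_smul_one_add hA hc)

theorem exists_dominates {W : Opens (HSpace n)} (χ : 𝓓(W, ℝ)) :
    ∃ χ' : 𝓓(W, ℝ), Dominates χ' χ := by
  obtain ⟨χ₀, hχ₀, -, hχ₀1⟩ := exists_cutoffTest χ.hasCompactSupport χ.tsupport_subset
  obtain ⟨c, hc⟩ := exists_sum_abs_hessMatrix_le χ.contDiff χ.hasCompactSupport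
  have hc0 : 0 ≤ c :=
    (Finset.sum_nonneg fun p _ => Finset.sum_nonneg fun q _ => abs_nonneg _).trans (hc 0)
  refine ⟨(4 * c) • χ₀, fun x => ?_⟩
  rw [show ((4 * c) • χ₀) x = 4 * c * χ₀ x from rfl]
  by_cases hx : x ∈ tsupport χ
  · have hsymm : (hessMatrix χ x).IsSymm :=
      hessMatrix_isSymm (χ.contDiff.contDiffAt.of_le ENat.LEInfty.out)
    rw [hχ₀1 x hx, mul_one, sub_eq_add_neg, ← map_neg]
    exact ⟨smul_beta_add_hessForm_mem_SP hsymm (hc x),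
      smul_beta_add_hessForm_mem_SP hsymm.neg (by simpa using hc x)⟩
  · rw [hessMatrix_eq_zero_of_notMem_tsupport hx, map_zero, add_zero, sub_zero, and_self]
    have hχ₀x := hχ₀ x
    exact smul_mem_SP (by exact_mod_cast (by positivity : 0 ≤ 4 * c * χ₀ x)) (beta_mem_SP n)

theorem smul_beta_sub_smul_hessForm_mem_SP {χ' χ : HSpace n → ℝ} (hd : Dominates χ' χ) {a M : ℝ}
    (ha : |a| ≤ M) (x : HSpace n) :
    ((M * χ' x : ℝ) : ℂ) • beta n - (a : ℂ) • hessForm (hessMatrix χ x) ∈ SP n 1 := by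
  obtain ⟨hMa, haM⟩ := abs_le.1 ha
  obtain ⟨hadd, hsub⟩ := hd x
  have hmem := add_mem
    (smul_mem_SP (by exact_mod_cast (by linarith : 0 ≤ (M + a) / 2) : 0 ≤ (((M + a) / 2 : ℝ) : ℂ))
      hsub)
    (smul_mem_SP (by exact_mod_cast (by linarith : 0 ≤ (M - a) / 2) : 0 ≤ (((M - a) / 2 : ℝ) : ℂ))
      hadd)
  convert hmem using 1
  push_cast
  module

/-- Integration by parts moves `△` onto the cutoff `χ`, where it is dominated by `χ' β_n`. -/
theorem mulFun_baston_cutoffForm_le {k : ℕ} (hk : k < n) {T : Current Ω} (hm : T.HasMeasureCoeff)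
    (hp : T.IsPositive k) {u : HSpace n → ℝ} (hu : IsPSH Ω u) (hb : IsLocallyBounded Ω u)
    {K : Set (HSpace n)} (hK : IsCompact K) (hKΩ : K ⊆ Ω) {χ χ' : 𝓓(Opens.interior K, ℝ)}
    (hd : Dominates χ' χ) :
    (T.mulFun u).baston (cutoffForm Ω χ (beta n ^ (n - (k + 1)))) ≤
      (supNorm K u : ℂ) * T (cutoffForm Ω χ' (beta n ^ (n - k))) := by
  have hW : Opens.interior K ≤ Ω := interior_subset.trans hKΩ
  obtain ⟨v, hv, hM, hlim, -⟩ := hu.exists_regularization hb hK hKΩ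
  set η := cutoffForm Ω χ (beta n ^ (n - (k + 1)))
  have hη : tsupport η ⊆ interior K := by
    have hsupp : Function.support η ⊆ Function.support χ := fun x hx hχ => hx <| by
      rw [cutoffForm_apply hW, hχ, Complex.ofReal_zero, zero_smul]
    exact (closure_mono hsupp).trans χ.tsupport_subset
  refine le_of_tendsto' (hm.tendsto_baston_mulFun hu hb hv hM η fun x hx => hlim x (hη hx))
    fun j => ?_
  rw [← sub_nonneg, ← smul_eq_mul, ← map_smul, ← map_sub]
  refine hp _ fun x => ?_
  have hval : (coeff n).symm (((supNorm K u : ℂ) • cutoffForm Ω χ' (beta n ^ (n - k)) -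
      mulTest (fun x => (v j x : ℂ)) (contDiff_ofReal_comp (hv j)) 1
        (dTest Ω 0 (dTest Ω 1 η))) x) =
      (((supNorm K u * χ' x : ℝ) : ℂ) • beta n - (v j x : ℂ) • hessForm (hessMatrix χ x)) *
        beta n ^ (n - (k + 1)) := by
    rw [_root_.sub_apply, _root_.smul_apply, mulTest_apply, wedgeLeft_one,
      dTest_dTest_cutoffForm hW, cutoffForm_apply hW, show n - k = n - (k + 1) + 1 by omega,
      pow_succ']
    simp only [map_sub, map_smul, LinearEquiv.symm_apply_apply, sub_mul, smul_mul_assoc, smul_smul,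
      Complex.ofReal_mul]
  rw [hval, show n - k = 1 + (n - (k + 1)) by omega]
  exact SetLike.mul_mem_graded (smul_beta_sub_smul_hessForm_mem_SP hd (hM j x) x)
    (beta_pow_mem_SP n _)

theorem Current.one_cutoffForm {W : Opens (HSpace n)} (hW : W ≤ Ω) (χ : 𝓓(W, ℝ)) (w : Ext n) :
    Current.one Ω (cutoffForm Ω χ w) = (∫ x, χ x : ℝ) * topCoeff w := by
  simp only [one_apply, cutoffForm_apply hW, map_smul, LinearEquiv.symm_apply_apply, topCoeff_smul,
    integral_mul_const, integral_complex_ofReal]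

theorem exists_bastonProduct_cutoffForm_le {K : Set (HSpace n)} (hK : IsCompact K) {k : ℕ}
    (hk : k ≤ n) (χ : 𝓓(Opens.interior K, ℝ)) :
    ∃ C : ℝ, 0 ≤ C ∧ ∀ Ω : Opens (HSpace n), K ⊆ Ω → ∀ us : List (HSpace n → ℝ), us.length = k →
      (∀ u ∈ us, IsPSH Ω u) → (∀ u ∈ us, IsLocallyBounded Ω u) →
      bastonProduct Ω us (cutoffForm Ω χ (beta n ^ (n - k))) ≤
        (C * (us.map (supNorm K)).prod : ℝ) := by
  induction k generalizing χ with
  | zero =>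
    have htop := topCoeff_nonneg_of_mem_SP (beta_pow_mem_SP n n)
    have hreal := Complex.eq_re_of_ofReal_le htop
    refine ⟨|∫ x, χ x| * (topCoeff (beta n ^ n)).re, mul_nonneg (abs_nonneg _)
      (Complex.nonneg_iff.1 htop).1, fun Ω hKΩ us hlen _ _ => ?_⟩
    obtain rfl := List.length_eq_zero_iff.1 hlen
    rw [show bastonProduct Ω [] = Current.one Ω from rfl,
      Current.one_cutoffForm (interior_subset.trans hKΩ), Nat.sub_zero, List.map_nil, List.prod_nil,
      mul_one, Complex.ofReal_mul, ← hreal]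
    exact mul_le_mul_of_nonneg_right (by exact_mod_cast le_abs_self _) htop
  | succ k ih =>
    obtain ⟨χ', hd⟩ := exists_dominates χ
    obtain ⟨C, hC, h⟩ := ih (Nat.le_of_succ_le hk) χ'
    refine ⟨C, hC, fun Ω hKΩ us hlen hu hb => ?_⟩
    obtain ⟨u, us, rfl⟩ := List.exists_cons_of_length_eq_add_one hlen
    obtain rfl : us.length = k := Nat.succ.inj hlen
    rw [List.forall_mem_cons] at hu hb
    have hT := isClosedPositive_bastonProduct us (Nat.le_of_succ_le hk) hu.2 hb.2
    calc bastonProduct Ω (u :: us) (cutoffForm Ω χ (beta n ^ (n - (us.length + 1))))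
      _ ≤ supNorm K u * bastonProduct Ω us (cutoffForm Ω χ' (beta n ^ (n - us.length))) :=
        mulFun_baston_cutoffForm_le hk hT.hasMeasureCoeff hT.isPositive hu.1 hb.1 hK hKΩ hd
      _ ≤ supNorm K u * (C * (us.map (supNorm K)).prod : ℝ) :=
        mul_le_mul_of_nonneg_left (h Ω hKΩ us rfl hu.2 hb.2)
          (by exact_mod_cast supNorm_nonneg K u)
      _ = (C * ((u :: us).map (supNorm K)).prod : ℝ) := by
        rw [← Complex.ofReal_mul, List.map_cons, List.prod_cons, mul_left_comm]

theorem exists_forall_bastonProduct_cutoffForm_le {K : Set (HSpace n)} (hK : IsCompact K)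
    (χ : 𝓓(Opens.interior K, ℝ)) :
    ∃ C : ℝ, 0 < C ∧ ∀ Ω : Opens (HSpace n), K ⊆ Ω → ∀ k ≤ n, ∀ u : Fin k → HSpace n → ℝ,
      (∀ i, IsPSH Ω (u i)) → (∀ i, IsLocallyBounded Ω (u i)) →
      bastonProduct Ω (List.ofFn u) (cutoffForm Ω χ (beta n ^ (n - k))) ≤
        (C * ∏ i, supNorm K (u i) : ℝ) := by
  choose C hC h using fun k : Fin (n + 1) =>
    exists_bastonProduct_cutoffForm_le hK (Nat.le_of_lt_succ k.2) χ
  refine ⟨∑ k, C k + 1, add_pos_of_nonneg_of_pos (Finset.sum_nonneg fun k _ => hC k) one_pos,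
    fun Ω hKΩ k hk u hu hb => ?_⟩
  have hCk : C ⟨k, Nat.lt_succ_of_le hk⟩ ≤ ∑ k, C k + 1 :=
    (Finset.single_le_sum (fun k _ => hC k) (Finset.mem_univ _)).trans (le_add_of_nonneg_right
      zero_le_one)
  refine (h ⟨k, Nat.lt_succ_of_le hk⟩ Ω hKΩ (List.ofFn u) List.length_ofFn
    (List.forall_mem_ofFn_iff.2 hu) (List.forall_mem_ofFn_iff.2 hb)).trans ?_
  rw [List.map_ofFn, List.prod_ofFn]
  exact_mod_cast mul_le_mul_of_nonneg_right hCk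
    (Finset.prod_nonneg fun i _ => supNorm_nonneg K (u i))

/-! ### Products of `C²` functions -/

theorem continuousOn_hessMatrix {u : HSpace n → ℝ} (hu : ContDiffOn ℝ 2 u Ω)
    (p q : Fin n × Fin 4) : ContinuousOn (fun x => hessMatrix u x p q) Ω := by
  have hpd {f : HSpace n → ℝ} {k m : WithTop ℕ∞} (hf : ContDiffOn ℝ m f Ω) (h : k + 1 ≤ m)
      (p : Fin n × Fin 4) : ContDiffOn ℝ k (pd p f) Ω :=
    (hf.fderiv_of_isOpen Ω.isOpen h).clm_apply contDiffOn_const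
  exact (hpd (k := 0) (hpd (k := 1) hu one_add_one_eq_two.le q) (zero_add 1).le p).continuousOn

theorem baston_eq_hessForm_of_mem {u : HSpace n → ℝ} (hu : ContDiffOn ℝ 2 u Ω) {x : HSpace n}
    (hx : x ∈ Ω) : baston u x = hessForm (hessMatrix u x) :=
  baston_eq_hessForm (hu.contDiffAt (Ω.isOpen.mem_nhds hx))

theorem IsPSH.baston_mem_SP {u : HSpace n → ℝ} (hu : IsPSH Ω u) (hc : ContDiffOn ℝ 2 u Ω)
    {x : HSpace n} (hx : x ∈ Ω) : baston u x ∈ SP n 1 := by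
  rw [baston_eq_hessForm_of_mem hc hx]
  exact hu.hessForm_mem_SP hc hx

theorem wedgeLeft_hessForm (A : Matrix (Fin n × Fin 4) (Fin n × Fin 4) ℝ) (φ : Coeff n) :
    wedgeLeft (hessForm A) φ =
      ∑ p, ∑ q, (A p q : ℂ) • wedgeLeft (pullback (covec p) 0 * pullback (covec q) 1) φ := by
  simp only [hessForm_apply, wedgeLeft_sum, wedgeLeft_smul]

theorem topPairing_wedgeLeft {v : Ext n} (hv : v ∈ SP n 1) (φ ψ : Coeff n) :
    topPairing n φ (wedgeLeft v ψ) = topPairing n (wedgeLeft v φ) ψ := by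
  simp only [topPairing_apply, wedgeLeft_apply, LinearEquiv.symm_apply_apply]
  rw [(commute_of_mem_SP hv _).eq, mul_assoc]

theorem continuousOn_wedgeLeft_baston {u : HSpace n → ℝ} (hu : ContDiffOn ℝ 2 u Ω)
    {F : HSpace n → Coeff n} (hF : ContinuousOn F Ω) :
    ContinuousOn (fun x => wedgeLeft (baston u x) (F x)) Ω := by
  have hsum : ContinuousOn (fun x => ∑ p, ∑ q, (hessMatrix u x p q : ℂ) •
      wedgeLeft (pullback (covec p) 0 * pullback (covec q) 1) (F x)) Ω :=
    continuousOn_finsetSum _ fun p _ => continuousOn_finsetSum _ fun q _ =>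
      (Complex.continuous_ofReal.comp_continuousOn (continuousOn_hessMatrix hu p q)).smul
        ((wedgeLeft _).continuous.comp_continuousOn hF)
  refine hsum.congr fun x hx => ?_
  rw [baston_eq_hessForm_of_mem hu hx, wedgeLeft_hessForm]

theorem tendsto_integral_topPairing_hessForm {μ : Measure (HSpace n)} {F : HSpace n → Coeff n}
    (hF : LocallyIntegrableOn F Ω μ) (η : TestForm Ω)
    {A : ℕ → HSpace n → Matrix (Fin n × Fin 4) (Fin n × Fin 4) ℝ}
    {B : HSpace n → Matrix (Fin n × Fin 4) (Fin n × Fin 4) ℝ}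
    (hA : ∀ j p q, Measurable fun x => A j x p q) {M : ℝ} (hM : ∀ j x p q, |A j x p q| ≤ M)
    (hlim : ∀ x ∈ tsupport η, ∀ p q,
      Filter.Tendsto (fun j => A j x p q) Filter.atTop (𝓝 (B x p q))) :
    Filter.Tendsto (fun j => ∫ x, topPairing n (wedgeLeft (hessForm (A j x)) (η x)) (F x) ∂μ)
      Filter.atTop (𝓝 (∫ x, topPairing n (wedgeLeft (hessForm (B x)) (η x)) (F x) ∂μ)) := by
  set φ : Fin n × Fin 4 → Fin n × Fin 4 → HSpace n → ℂ := fun p q x =>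
    topPairing n (wedgeLeft (pullback (covec p) 0 * pullback (covec q) 1) (η x)) (F x) with hφ
  have hφi (p q) : Integrable (φ p q) μ :=
    integrable_topPairing hF (TestFunction.postcompCLM (wedgeLeft _) η)
  have hsum (C : Matrix (Fin n × Fin 4) (Fin n × Fin 4) ℝ) (x : HSpace n) :
      topPairing n (wedgeLeft (hessForm C) (η x)) (F x) = ∑ p, ∑ q, (C p q : ℂ) * φ p q x := by
    simp only [wedgeLeft_hessForm, map_sum, map_smul, sum_apply, smul_apply, smul_eq_mul, hφ]
  simp only [hsum]
  refine tendsto_integral_of_dominated_convergence (fun x => ∑ p, ∑ q, M * ‖φ p q x‖)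
    (fun j => Finset.aestronglyMeasurable_fun_sum _ fun p _ =>
      Finset.aestronglyMeasurable_fun_sum _ fun q _ =>
        (hA j p q).complex_ofReal.aestronglyMeasurable.mul (hφi p q).1)
    (integrable_finsetSum _ fun p _ => integrable_finsetSum _ fun q _ =>
      (hφi p q).norm.const_mul M)
    (fun j => .of_forall fun x => ?_) (.of_forall fun x => ?_)
  · refine norm_sum_le_of_le _ fun p _ => norm_sum_le_of_le _ fun q _ => ?_
    rw [norm_mul, Complex.norm_real]
    exact mul_le_mul_of_nonneg_right (hM j x p q) (norm_nonneg _)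
  · by_cases hx : x ∈ tsupport η
    · exact tendsto_finsetSum _ fun p _ => tendsto_finsetSum _ fun q _ =>
        ((Complex.continuous_ofReal.tendsto _).comp (hlim x hx p q)).mul_const _
    · simp only [hφ, image_eq_zero_of_notMem_tsupport hx, map_zero, zero_apply, mul_zero,
        Finset.sum_const_zero, tendsto_const_nhds]

theorem baston_mulFun_ofMeasure {F : HSpace n → Coeff n} (hF : ContinuousOn F Ω)
    (hcl : (Current.ofMeasure Ω volume F).IsClosed) {u : HSpace n → ℝ} (hu : IsPSH Ω u)
    (hc : ContDiffOn ℝ 2 u Ω) :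
    ((Current.ofMeasure Ω volume F).mulFun u).baston =
      Current.ofMeasure Ω volume fun x => wedgeLeft (baston u x) (F x) := by
  have hloc {G : HSpace n → Coeff n} (hG : ContinuousOn G Ω) : LocallyIntegrableOn G Ω volume :=
    hG.locallyIntegrableOn Ω.isOpen.measurableSet
  ext1 η
  obtain ⟨v, M, hv, hM, hM2, hlim⟩ :=
    exists_contDiff_two_regularization hc η.hasCompactSupport η.tsupport_subset
  have hleft := Current.HasMeasureCoeff.tendsto_bastonMul ⟨volume, F, hloc hF, rfl⟩ hcl hu
    (isLocallyBounded_of_continuousOn hc.continuousOn) hv hM η fun x hx => (hlim x hx).1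
  have hright := tendsto_integral_topPairing_hessForm (hloc hF) η
    (fun j p q => (contDiff_hessMatrix (hv j) p q).continuous.measurable) hM2
    fun x hx => (hlim x hx).2
  simp only [Current.ofMeasure_apply (hloc hF), bastonMul_apply] at hleft
  rw [tendsto_nhds_unique hleft hright,
    Current.ofMeasure_apply (hloc (continuousOn_wedgeLeft_baston hc hF))]
  refine integral_congr_ae (.of_forall fun x => ?_)
  by_cases hx : x ∈ tsupport η
  · have hxΩ := η.tsupport_subset hx
    simp only [topPairing_wedgeLeft (hu.baston_mem_SP hc hxΩ), ← baston_eq_hessForm_of_mem hc hxΩ]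
  · simp only [image_eq_zero_of_notMem_tsupport hx, map_zero, zero_apply]

/-- The coefficients of the form `△u₁ ∧ … ∧ △u_k`, as the density of a current. -/
def bastonCoeff (us : List (HSpace n → ℝ)) (x : HSpace n) : Coeff n :=
  coeff n ((us.map fun u => baston u x).prod)

theorem bastonCoeff_cons (u : HSpace n → ℝ) (us : List (HSpace n → ℝ)) :
    bastonCoeff (u :: us) = fun x => wedgeLeft (baston u x) (bastonCoeff us x) := by
  ext1 x
  rw [bastonCoeff, List.map_cons, List.prod_cons, wedgeLeft_apply, bastonCoeff,
    LinearEquiv.symm_apply_apply]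

theorem bastonCoeff_ofFn {k : ℕ} (u : Fin k → HSpace n → ℝ) (x : HSpace n) :
    bastonCoeff (List.ofFn u) x = coeff n (bastonWedge u x) := by
  rw [bastonCoeff, List.map_ofFn]
  rfl

theorem continuousOn_bastonCoeff (us : List (HSpace n → ℝ)) (hc : ∀ u ∈ us, ContDiffOn ℝ 2 u Ω) :
    ContinuousOn (bastonCoeff us) Ω := by
  induction us with
  | nil => exact continuousOn_const (c := coeff n 1)
  | cons u us ih =>
    rw [List.forall_mem_cons] at hc
    rw [bastonCoeff_cons]
    exact continuousOn_wedgeLeft_baston hc.1 (ih hc.2)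

theorem bastonProduct_eq_ofMeasure (us : List (HSpace n → ℝ)) (hlen : us.length ≤ n)
    (hu : ∀ u ∈ us, IsPSH Ω u) (hc : ∀ u ∈ us, ContDiffOn ℝ 2 u Ω) :
    bastonProduct Ω us = Current.ofMeasure Ω volume (bastonCoeff us) := by
  induction us with
  | nil => rfl
  | cons u us ih =>
    rw [List.forall_mem_cons] at hu hc
    have ih := ih (Nat.le_of_succ_le hlen) hu.2 hc.2
    have hcl := (isClosedPositive_bastonProduct us (Nat.le_of_succ_le hlen) hu.2
      fun w hw => isLocallyBounded_of_continuousOn (hc.2 w hw).continuousOn).isClosed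
    rw [bastonProduct, bastonCoeff_cons, ih]
    exact baston_mulFun_ofMeasure (continuousOn_bastonCoeff us hc.2) (ih ▸ hcl) hu.1 hc.1

section Mass

variable {k : ℕ} {u : Fin k → HSpace n → ℝ} {L : Set (HSpace n)}

theorem topCoeff_bastonWedge_nonneg (hk : k ≤ n) (hu : ∀ i, IsPSH Ω (u i))
    (hc : ∀ i, ContDiffOn ℝ 2 (u i) Ω) {x : HSpace n} (hx : x ∈ Ω) :
    0 ≤ topCoeff (bastonWedge u x * beta n ^ (n - k)) := by
  have hwedge : bastonWedge u x ∈ SP n k := by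
    have h := SetLike.list_prod_ofFn_mem_graded (A := SP n) (fun _ : Fin k => 1)
      (fun i => baston (u i) x) fun i => (hu i).baston_mem_SP (hc i) hx
    simpa only [bastonWedge, List.ofFn_const, List.sum_replicate, smul_eq_mul, mul_one] using h
  refine topCoeff_nonneg_of_mem_SP ?_
  have h := SetLike.mul_mem_graded hwedge (beta_pow_mem_SP n (n - k))
  rwa [Nat.add_sub_cancel' hk] at h

theorem formMass_bastonWedge_nonneg (hk : k ≤ n) (hu : ∀ i, IsPSH Ω (u i))
    (hc : ∀ i, ContDiffOn ℝ 2 (u i) Ω) (hL : IsCompact L) (hLΩ : L ⊆ Ω) :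
    0 ≤ formMass L (n - k) (bastonWedge u) :=
  integral_nonneg_of_ae (ae_restrict_of_forall_mem hL.measurableSet fun _ hx =>
    topCoeff_bastonWedge_nonneg hk hu hc (hLΩ hx))

theorem formMass_bastonWedge_le (hk : k ≤ n) (hu : ∀ i, IsPSH Ω (u i))
    (hc : ∀ i, ContDiffOn ℝ 2 (u i) Ω) (hL : IsCompact L) {W : Opens (HSpace n)} (hW : W ≤ Ω)
    {χ : 𝓓(W, ℝ)} (hχ : ∀ x, 0 ≤ χ x) (hχL : ∀ x ∈ L, χ x = 1) :
    formMass L (n - k) (bastonWedge u) ≤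
      bastonProduct Ω (List.ofFn u) (cutoffForm Ω χ (beta n ^ (n - k))) := by
  have hcs : ∀ w ∈ List.ofFn u, ContDiffOn ℝ 2 w Ω := List.forall_mem_ofFn_iff.2 hc
  have hloc : LocallyIntegrableOn (bastonCoeff (List.ofFn u)) Ω volume :=
    (continuousOn_bastonCoeff _ hcs).locallyIntegrableOn Ω.isOpen.measurableSet
  set g : HSpace n → ℂ := fun x => χ x * topCoeff (bastonWedge u x * beta n ^ (n - k))
  have hpair (x : HSpace n) : topPairing n (cutoffForm Ω χ (beta n ^ (n - k)) x)
      (bastonCoeff (List.ofFn u) x) = g x := by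
    rw [cutoffForm_apply hW, map_smul, smul_apply, topPairing_apply, bastonCoeff_ofFn,
      LinearEquiv.symm_apply_apply, LinearEquiv.symm_apply_apply, smul_eq_mul]
  have hg : Integrable g := by
    simpa only [hpair] using integrable_topPairing hloc (cutoffForm Ω χ (beta n ^ (n - k)))
  have hg0 (x : HSpace n) : 0 ≤ g x := by
    by_cases hx : x ∈ tsupport χ
    · exact mul_nonneg (by exact_mod_cast hχ x)
        (topCoeff_bastonWedge_nonneg hk hu hc (hW (χ.tsupport_subset hx)))
    · simp only [g, image_eq_zero_of_notMem_tsupport hx, Complex.ofReal_zero, zero_mul, le_refl]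
  calc formMass L (n - k) (bastonWedge u)
    _ = ∫ x in L, g x := setIntegral_congr_fun hL.measurableSet fun x hx => by
      simp only [g, hχL x hx, Complex.ofReal_one, one_mul]
    _ ≤ ∫ x, g x := setIntegral_le_integral hg (.of_forall hg0)
    _ = bastonProduct Ω (List.ofFn u) (cutoffForm Ω χ (beta n ^ (n - k))) := by
      rw [bastonProduct_eq_ofMeasure _ (List.length_ofFn.trans_le hk)
        (List.forall_mem_ofFn_iff.2 hu) hcs, Current.ofMeasure_apply hloc]
      simp only [hpair]

theorem Current.IsMassMeasure.le_of_cutoffForm_le {T : Current Ω} {p : ℕ} {ν : Measure (HSpace n)}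
    (hν : T.IsMassMeasure p ν) {W : Opens (HSpace n)} (hW : W ≤ Ω) {χ : 𝓓(W, ℝ)}
    (hχ : ∀ x, 0 ≤ χ x) (hχL : ∀ x ∈ L, χ x = 1) {c : ℝ}
    (hc : T (cutoffForm Ω χ (beta n ^ p)) ≤ c) : ν L ≤ ENNReal.ofReal c := by
  have hT : T (cutoffForm Ω χ (beta n ^ p)) = (∫ x, χ x ∂ν : ℝ) := by
    rw [cutoffForm, hν.eq_integral, ← integral_complex_ofReal]
    refine integral_congr_ae (.of_forall fun x => ?_)
    simp only [ofRealTest_apply, TestFunction.monoCLM_apply, if_pos (And.intro le_rfl hW)]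
  rw [hT, Complex.real_le_real] at hc
  have hint : Integrable χ ν := integrable_of_tsupport_subset hν.finite χ.contDiff.continuous
    χ.hasCompactSupport (χ.tsupport_subset.trans hW)
  exact (hint.measure_le_integral (.of_forall hχ) fun x hx => (hχL x hx).ge).trans
    (ENNReal.ofReal_le_ofReal hc)

end Mass

end QPlurisubharmonic

end

theorem proposition3p10 (n : ℕ) (K L : Set (QPlurisubharmonic.HSpace n))
    (hK : IsCompact K) (hL : IsCompact L) (hLK : L ⊆ interior K) :
    ∃ C : ℝ, 0 < C ∧
      ∀ Ω : Opens (QPlurisubharmonic.HSpace n), K ⊆ Ω →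
      ∀ k : ℕ, k ≤ n → ∀ u : Fin k → QPlurisubharmonic.HSpace n → ℝ,
        (∀ i, QPlurisubharmonic.IsPSH Ω (u i)) →
        ((∀ i, ContDiffOn ℝ 2 (u i) Ω) →
          0 ≤ QPlurisubharmonic.formMass L (n - k) (QPlurisubharmonic.bastonWedge u) ∧
          QPlurisubharmonic.formMass L (n - k) (QPlurisubharmonic.bastonWedge u) ≤
            ((C * ∏ i, QPlurisubharmonic.supNorm K (u i) : ℝ) : ℂ)) ∧
        ((∀ i, QPlurisubharmonic.IsLocallyBounded Ω (u i)) →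
          (QPlurisubharmonic.bastonProduct Ω (List.ofFn u)).HasMeasureCoeff ∧
          (QPlurisubharmonic.bastonProduct Ω (List.ofFn u)).IsPositive k ∧
          ∃ ν : Measure (QPlurisubharmonic.HSpace n),
            (QPlurisubharmonic.bastonProduct Ω (List.ofFn u)).IsMassMeasure (n - k) ν ∧
            ν L ≤ ENNReal.ofReal (C * ∏ i, QPlurisubharmonic.supNorm K (u i))) := by
  obtain ⟨χ, hχ, -, hχL⟩ :=
    QPlurisubharmonic.exists_cutoffTest (U := Opens.interior K) hL hLK
  obtain ⟨C, hC, hle⟩ := QPlurisubharmonic.exists_forall_bastonProduct_cutoffForm_le hK χ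
  refine ⟨C, hC, fun Ω hKΩ k hk u hu => ?_⟩
  have hW : Opens.interior K ≤ Ω := interior_subset.trans hKΩ
  refine ⟨fun hc => ?_, fun hb => ?_⟩
  · have hb i := QPlurisubharmonic.isLocallyBounded_of_continuousOn (hc i).continuousOn
    exact ⟨QPlurisubharmonic.formMass_bastonWedge_nonneg hk hu hc hL (hLK.trans hW),
      (QPlurisubharmonic.formMass_bastonWedge_le hk hu hc hL hW hχ hχL).trans
        (hle Ω hKΩ k hk u hu hb)⟩
  · have hT := QPlurisubharmonic.isClosedPositive_bastonProduct (List.ofFn u)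
      (List.length_ofFn.trans_le hk) (List.forall_mem_ofFn_iff.2 hu) (List.forall_mem_ofFn_iff.2 hb)
    rw [List.length_ofFn] at hT
    obtain ⟨ν, hν⟩ := hT.isPositive.exists_isMassMeasure
    exact ⟨hT.hasMeasureCoeff, hT.isPositive, ν, hν,
      hν.le_of_cutoffForm_le hW hχ hχL (hle Ω hKΩ k hk u hu hb)⟩
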